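/- **Uniform asymptotic distribution of MM-location estimates.** *Functions.* Let $\psi:\mathbb R\to\mathbb R$ satisfy: $|\psi|\le 1$ and $\psi$ is odd; $\psi$ is nondecreasing with $\lim_{u\to\infty}\psi(u)>0$; $\psi$ is twice continuously differentiable; there is $d>0$ with $|\psi(u)|=1$ for all $|u|\ge d$. Let $\rho:\mathbb R\to\mathbb R$ satisfy: $\rho(0)=0$; $\rho$ is even with $\sup_u\rho(u)=1$; $\rho$ is nondecreasing on $[0,\infty)$; $\rho'$ is bounded; there is $c>0$ with $\rho(u)=1$ for all $|u|\ge c$; $\rho$ is twice continuously differentiable. Let $b\in(0,1)$. *Estimates.* For a sample $x_1,\dots,x_n$ let $s_n(t)>0$ be the solution of $\frac1n\sum_i\rho((x_i-t)/s_n(t))=b$ (the smallest one if there are several, and $s_n(t)=0$ if there is none), and let $\hat\sigma_n=\inf_{t\in\mathbb R}s_n(t)$ be the S-scale. Let $\hat\mu_n=\hat\mu_n(x_1,\dots,x_n)$ be any measurable estimates such that $\frac1n\sum_i\psi((x_i-\hat\mu_n)/\hat\sigma_n)=0$ whenever $\hat\sigma_n>0$. *Functionals.* For a probability law $F$ on $\mathbb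 R$ let $\sigma(F,t)>0$ be the solution of $E_F\,\rho((X-t)/\sigma(F,t))=b$ (with the same conventions), $\sigma(F)=\inf_t\sigma(F,t)$, $\tilde\mu(F)=\arg\inf_t\sigma(F,t)$, and let $\mu(F)$ be the solution of $E_F\,\psi((X-\mu(F))/\sigma(F))=0$. *Neighborhood.* Let $F_0$ be a distribution with a positive, even and unimodal density (a pole at the mode $0$ is allowed), let $\mu_0\in\mathbb R$, $\sigma_0>0$, $0\le\varepsilon<1/2$, and let $\mathcal H_\varepsilon$ be the set of all distribution functions $F(x)=(1-\varepsilon)F_0((x-\mu_0)/\sigma_0)+\varepsilon H(x)$ with $H$ an arbitrary distribution function. Suppose that there are real numbers $s^-,s^+,t^*$ such that 1. $0<s^-\le\sigma(F)\le s^+<\infty$ for every $F=(1-\varepsilon)F_0+\varepsilon H$, $H$ an arbitrary distribution function (the neighborhood standardized to $\mu_0=0$, $\sigma_0=1$); 2. $\displaystyle\inf_{s^-\le s\le s^+}\Big[E_{F_0}\rho\Big(\frac{X-t}{s}\Big)-E_{F_0}\rho\Big(\frac Xs\Big)\Big]>\frac{\varepsilon}{1-\varepsilon}$ for all $|t|\ge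 t^*$; 3. $\displaystyle\inf_{-t^*\le t\le t^*,\ s^-\le s\le s^+}E_{F_0}\rho''\Big(\frac{X-t}{s}\Big)>\frac{\varepsilon}{1-\varepsilon}\,\sup_x[\rho''(x)]^-$, where $[y]^-=\max(-y,0)$. *Conclusion.* For every $F\in\mathcal H_\varepsilon$ the values $\tilde\mu(F)$ and $\mu(F)$ exist and are unique, and with $$H(F)=\frac1{E_F\,\psi'\big(\frac{X-\mu(F)}{\sigma(F)}\big)},\qquad J(F)=\frac{E_F\big\{\psi'\big(\frac{X-\mu(F)}{\sigma(F)}\big)\frac{X-\mu(F)}{\sigma(F)}\big\}}{E_F\big\{\rho'\big(\frac{X-\tilde\mu(F)}{\sigma(F)}\big)\frac{X-\tilde\mu(F)}{\sigma(F)}\big\}},$$ $$V(F)=\sigma(F)^2H(F)^2\,E_F\Big\{\Big[\psi\Big(\frac{X-\mu(F)}{\sigma(F)}\Big)-J(F)\Big(\rho\Big(\frac{X-\tilde\mu(F)}{\sigma(F)}\Big)-b\Big)\Big]^2\Big\}$$ both denominators and $V(F)$ are positive. Moreover, for $x_1,\dots,x_n$ i.i.d. with law $F$ and $\Phi$ the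 standard normal distribution function, $$\lim_{n\to\infty}\ \sup_{F\in\mathcal H_\varepsilon}\ \sup_{x\in\mathbb R}\Big|P_F\Big\{\sqrt n\,\frac{\hat\mu_n-\mu(F)}{\sqrt{V(F)}}<x\Big\}-\Phi(x)\Big|=0.$$ -/

import Mathlib

open MeasureTheory ProbabilityTheory Filter Topology Set

noncomputable section

namespace MMLocation

/-- Conditions on the function `ψ` of the M-location estimating equation. -/
structure IsPsi (ψ : ℝ → ℝ) : Prop where
  abs_le_one : ∀ u, |ψ u| ≤ 1
  odd : ∀ u, 0 ≤ u → ψ (-u) = -ψ u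
  monotone : Monotone ψ
  limit_pos : ∃ L : ℝ, 0 < L ∧ Tendsto ψ atTop (𝓝 L)
  contDiff : ContDiff ℝ 2 ψ
  abs_eq_one : ∃ d : ℝ, 0 < d ∧ ∀ u, d ≤ |u| → |ψ u| = 1

/-- Conditions on the function `ρ` of the S-scale. -/
structure IsRho (ρ : ℝ → ℝ) : Prop where
  zero : ρ 0 = 0
  even : ∀ u, 0 ≤ u → ρ (-u) = ρ u
  isLUB : IsLUB (range ρ) 1
  monotoneOn : MonotoneOn ρ (Ici 0)
  deriv_bounded : ∃ K : ℝ, ∀ u, |deriv ρ u| ≤ K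
  eq_one : ∃ c : ℝ, 0 < c ∧ ∀ u, c ≤ |u| → ρ u = 1
  contDiff : ContDiff ℝ 2 ρ

/-- `f` is a positive, even, unimodal density of the law `F₀`. The value of the density at the
mode is left free, so that a pole at the mode is allowed. -/
structure IsCentralDensity (F₀ : Measure ℝ) (f : ℝ → ℝ) : Prop where
  pos : ∀ x, 0 < f x
  even : ∀ x, f (-x) = f x
  antitoneOn : AntitoneOn f (Ioi 0)
  density : F₀ = volume.withDensity (fun x => ENNReal.ofReal (f x))

/-- The contamination neighborhood: all laws `(1 - ε) F₀((· - μ₀)/σ₀) + ε H`, with `H` an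
arbitrary probability law on the line. -/
def nbhd (F₀ : Measure ℝ) (ε μ₀ σ₀ : ℝ) : Set (Measure ℝ) :=
  {F | ∃ H : Measure ℝ, IsProbabilityMeasure H ∧
    F = ENNReal.ofReal (1 - ε) • F₀.map (fun x => μ₀ + σ₀ * x) + ENNReal.ofReal ε • H}

/-- `s_n(t)`: the solution `s > 0` of `(1/n) ∑ ρ((x_i - t)/s) = b`
(the smallest one if there are several, and `0` if there is none). -/
def sampleScaleAt (ρ : ℝ → ℝ) (b : ℝ) {n : ℕ} (x : Fin n → ℝ) (t : ℝ) : ℝ :=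
  sInf {s : ℝ | 0 < s ∧ (1 / (n : ℝ)) * ∑ i, ρ ((x i - t) / s) = b}

/-- The S-scale estimate `inf_t s_n(t)`. -/
def sampleScale (ρ : ℝ → ℝ) (b : ℝ) {n : ℕ} (x : Fin n → ℝ) : ℝ :=
  ⨅ t : ℝ, sampleScaleAt ρ b x t

/-- `σ(F, t)`: the solution `s > 0` of `E_F ρ((X - t)/s) = b`, with the same conventions. -/
def scaleAt (ρ : ℝ → ℝ) (b : ℝ) (F : Measure ℝ) (t : ℝ) : ℝ :=
  sInf {s : ℝ | 0 < s ∧ ∫ x, ρ ((x - t) / s) ∂F = b}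

/-- The S-scale functional `σ(F) = inf_t σ(F, t)`. -/
def scale (ρ : ℝ → ℝ) (b : ℝ) (F : Measure ℝ) : ℝ :=
  ⨅ t : ℝ, scaleAt ρ b F t

/-- `m` minimizes `t ↦ σ(F, t)`. -/
def IsSLocation (ρ : ℝ → ℝ) (b : ℝ) (F : Measure ℝ) (m : ℝ) : Prop :=
  ∀ t : ℝ, scaleAt ρ b F m ≤ scaleAt ρ b F t

/-- `m` solves `E_F ψ((X - m)/σ(F)) = 0`. -/
def IsMLocation (ψ ρ : ℝ → ℝ) (b : ℝ) (F : Measure ℝ) (m : ℝ) : Prop :=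
  ∫ x, ψ ((x - m) / scale ρ b F) ∂F = 0

/-- The S-location functional `arg inf_t σ(F, t)`. -/
def sLocation (ρ : ℝ → ℝ) (b : ℝ) (F : Measure ℝ) : ℝ :=
  Classical.epsilon (IsSLocation ρ b F)

/-- The MM-location functional `μ(F)`. -/
def mLocation (ψ ρ : ℝ → ℝ) (b : ℝ) (F : Measure ℝ) : ℝ :=
  Classical.epsilon (IsMLocation ψ ρ b F)

/-- `u(x) = (x - μ(F)) / σ(F)`. -/
def mResidual (ψ ρ : ℝ → ℝ) (b : ℝ) (F : Measure ℝ) (x : ℝ) : ℝ :=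
  (x - mLocation ψ ρ b F) / scale ρ b F

/-- `v(x) = (x - μ̃(F)) / σ(F)`, with `μ̃` the S-location functional. -/
def sResidual (ρ : ℝ → ℝ) (b : ℝ) (F : Measure ℝ) (x : ℝ) : ℝ :=
  (x - sLocation ρ b F) / scale ρ b F

/-- `E_F ψ'(u(X))`, whose inverse is `H(F)`. -/
def denomH (ψ ρ : ℝ → ℝ) (b : ℝ) (F : Measure ℝ) : ℝ :=
  ∫ x, deriv ψ (mResidual ψ ρ b F x) ∂F

/-- `E_F [ρ'(v(X)) v(X)]`, the denominator of `J(F)`. -/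
def denomJ (ρ : ℝ → ℝ) (b : ℝ) (F : Measure ℝ) : ℝ :=
  ∫ x, deriv ρ (sResidual ρ b F x) * sResidual ρ b F x ∂F

/-- `H(F)`. -/
def coefH (ψ ρ : ℝ → ℝ) (b : ℝ) (F : Measure ℝ) : ℝ :=
  1 / denomH ψ ρ b F

/-- `J(F)`. -/
def coefJ (ψ ρ : ℝ → ℝ) (b : ℝ) (F : Measure ℝ) : ℝ :=
  (∫ x, deriv ψ (mResidual ψ ρ b F x) * mResidual ψ ρ b F x ∂F) / denomJ ρ b F

/-- The asymptotic variance `V`. -/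
def asympVar (ψ ρ : ℝ → ℝ) (b : ℝ) (F : Measure ℝ) : ℝ :=
  scale ρ b F ^ 2 * coefH ψ ρ b F ^ 2 *
    ∫ x, (ψ (mResidual ψ ρ b F x) - coefJ ψ ρ b F * (ρ (sResidual ρ b F x) - b)) ^ 2 ∂F

/-- `0 < s⁻ ≤ σ(F) ≤ s⁺ < ∞` on the standardized (location `0`, scale `1`) neighborhood. -/
def ScaleBounds (ρ : ℝ → ℝ) (b : ℝ) (F₀ : Measure ℝ) (ε sMinus sPlus : ℝ) : Prop :=
  0 < sMinus ∧ ∀ F ∈ nbhd F₀ ε 0 1, sMinus ≤ scale ρ b F ∧ scale ρ b F ≤ sPlus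

/-- Separation: for `|t| ≥ t*`, the infimum over `s⁻ ≤ s ≤ s⁺` of
`E_{F₀} ρ((X - t)/s) - E_{F₀} ρ(X/s)` exceeds `ε / (1 - ε)`. -/
def Separation (ρ : ℝ → ℝ) (F₀ : Measure ℝ) (ε sMinus sPlus tStar : ℝ) : Prop :=
  ∀ t : ℝ, tStar ≤ |t| →
    ε / (1 - ε) < ⨅ s : Icc sMinus sPlus,
      ((∫ x, ρ ((x - t) / (s : ℝ)) ∂F₀) - ∫ x, ρ (x / (s : ℝ)) ∂F₀)

/-- Convexity: the infimum of `E_{F₀} ρ''((X - t)/s)` over `|t| ≤ t*`, `s⁻ ≤ s ≤ s⁺` exceeds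
`ε / (1 - ε)` times the supremum of the negative part of `ρ''`. -/
def Convexity (ρ : ℝ → ℝ) (F₀ : Measure ℝ) (ε sMinus sPlus tStar : ℝ) : Prop :=
  ε / (1 - ε) * (⨆ x : ℝ, max (-deriv (deriv ρ) x) 0) <
    ⨅ p : Icc (-tStar) tStar × Icc sMinus sPlus,
      ∫ x, deriv (deriv ρ) ((x - (p.1 : ℝ)) / (p.2 : ℝ)) ∂F₀

/-- `μhat` is a sequence of measurable estimates with
`(1/n) ∑ ψ((x_i - μhat_n)/σhat_n) = 0`, where `σhat_n` is the S-scale estimate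
(no requirement on samples with `σhat_n = 0`, where the equation is meaningless). -/
def IsMMEstimate (ψ ρ : ℝ → ℝ) (b : ℝ) (μhat : (n : ℕ) → (Fin n → ℝ) → ℝ) : Prop :=
  ∀ n : ℕ, Measurable (μhat n) ∧ ∀ x : Fin n → ℝ, 0 < sampleScale ρ b x →
    (1 / (n : ℝ)) * ∑ i, ψ ((x i - μhat n x) / sampleScale ρ b x) = 0

end MMLocation

end

/-!
# Uniform asymptotic normality of MM-location estimates

Write `r = σ(F) / σ̂` for the ratio of the S-scale of a law and of its sample. Both are determined
by the objective `t ↦ E ρ((X - t) / s)`: the S-scale is the value of `s` at which its minimum over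
`t` equals `b`. The central point is a deterministic statement (`scale_expansion`): if the empirical
means of `ρ`, `ρ'` and `ρ' · id` at the standardized residuals are within `e` of their
expectations, and the empirical objective at the scale `σ(F)` is strongly convex near its minimum
and separated from `b` elsewhere, then
`r - 1 = -(mean of (ρ - b)) / E[ρ'(v) v] + O(e²)`. The minimizing location enters only at second
order, because the derivative of the objective in `t` vanishes at `μ̃(F)`; no expansion of a
location estimate is needed. Inserting this into the estimating equation
(`estimating_equation_expansion`) shows that, at the location `μ(F) + h σ(F)`, it equals the
empirical mean of the score `ψ(u) - J (ρ(v) - b)` minus `h E[ψ'(u)]`, up to `O(e²)`.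

As `ψ` is monotone, `μ̂ < m` is decided by the sign of the estimating equation at `m`. On good
samples, with `e` of order `n^(-1/2)`, the event `√n (μ̂ - μ(F)) / √V(F) < x` therefore lies between
two events on a normalized sum of scores (`IsRegular.sandwich`). Good samples have probability
close to one uniformly in `F` (`eventually_good_sample`): Chebyshev's inequality handles the
individual means, and a finite grid of locations handles the convexity and separation conditions.
The sums are treated by a central limit theorem that is uniform over uniformly bounded standardized
variables (`uniform_clt`, from Lévy's continuity theorem along a hypothetical sequence of
counterexamples), and Pólya's lemma (`exists_finite_test_points`) makes the convergence uniform
in `x`.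

All of this is uniform over laws that are regular with common constants (`IsRegular`), so it remains
to find common constants for a contamination neighborhood (`exists_isRegular_mixture`). Every
constant comes from the central part `(1 - ε) G` alone, which does not depend on the contamination:
the bounds for bounded locations and scales follow by compactness and from the full support of `G`,
and those for distant locations from the mass of `G` near its center. The latter needs `b < 1 - ε`,
which holds since a point mass contamination at the center does not make the S-scale vanish. The
shape of the central density is used only to see that its law charges every nonempty open set. The
case of general `μ₀` and `σ₀` is reduced to the standardized neighborhood by affine equivariance.
-/

noncomputable section

namespace MMLocation

/-! ### The central limit theorem, uniformly over bounded laws -/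

lemma norm_pow_sub_pow_le_mul {a c : ℂ} (ha : ‖a‖ ≤ 1) (hc : ‖c‖ ≤ 1) (n : ℕ) :
    ‖a ^ n - c ^ n‖ ≤ n * ‖a - c‖ := by
  induction n with
  | zero => simp
  | succ n ih =>
    have e : a ^ (n + 1) - c ^ (n + 1) = a ^ n * (a - c) + (a ^ n - c ^ n) * c := by ring
    rw [e]
    have h1 : ‖a ^ n * (a - c)‖ ≤ ‖a - c‖ := by
      rw [norm_mul, norm_pow]
      exact mul_le_of_le_one_left (norm_nonneg _) (pow_le_one₀ (norm_nonneg _) ha)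
    have h2 : ‖(a ^ n - c ^ n) * c‖ ≤ n * ‖a - c‖ := by
      rw [norm_mul]
      exact (mul_le_of_le_one_right (norm_nonneg _) hc).trans ih
    refine (norm_add_le _ _).trans ?_
    push_cast
    linarith

lemma norm_exp_sub_quadratic_le {z : ℂ} (hz : ‖z‖ ≤ 1) :
    ‖Complex.exp z - (1 + z + z ^ 2 / 2)‖ ≤ ‖z‖ ^ 3 := by
  have h := Complex.exp_bound hz (n := 3) (by norm_num)
  simp only [Finset.sum_range_succ, Finset.sum_range_zero, Nat.factorial] at h
  norm_num at h
  refine h.trans ?_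
  nlinarith [pow_nonneg (norm_nonneg z) 3]

/-- Second-order expansion of the characteristic function of a bounded standardized variable. -/
lemma norm_charFun_sub_le {F : Measure ℝ} [IsProbabilityMeasure F] {Z : ℝ → ℝ}
    (hZ : Measurable Z) {B : ℝ} (hB : ∀ y, |Z y| ≤ B) (h0 : ∫ y, Z y ∂F = 0)
    (h1 : ∫ y, Z y ^ 2 ∂F = 1) {s : ℝ} (hs : |s| * B ≤ 1) :
    ‖(∫ y, Complex.exp ((s * Z y : ℝ) * Complex.I) ∂F) - (1 - (s : ℂ) ^ 2 / 2)‖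
      ≤ (|s| * B) ^ 3 := by
  have iZ : Integrable Z F :=
    Integrable.of_bound hZ.aestronglyMeasurable B (ae_of_all _ hB)
  have iZ2 : Integrable (fun y => Z y ^ 2) F := by
    refine Integrable.of_bound (hZ.pow_const 2).aestronglyMeasurable (B ^ 2) (ae_of_all _ fun y => ?_)
    rw [norm_pow]
    exact pow_le_pow_left₀ (norm_nonneg _) (hB y) 2
  have iE : Integrable (fun y => Complex.exp ((s * Z y : ℝ) * Complex.I)) F := by
    refine Integrable.of_bound (by fun_prop) 1 (ae_of_all _ fun y => ?_)
    rw [Complex.norm_exp_ofReal_mul_I]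
  have iC1 : Integrable (fun y => ((Z y : ℝ) : ℂ)) F := iZ.ofReal
  have iC2 : Integrable (fun y => ((Z y ^ 2 : ℝ) : ℂ)) F := iZ2.ofReal
  have e : (∫ y, Complex.exp ((s * Z y : ℝ) * Complex.I) ∂F) - (1 - (s : ℂ) ^ 2 / 2)
      = ∫ y, (Complex.exp ((s * Z y : ℝ) * Complex.I)
        - (1 + (s * Complex.I) * ((Z y : ℝ) : ℂ) - (s : ℂ) ^ 2 / 2 * ((Z y ^ 2 : ℝ) : ℂ))) ∂F := by
    have iA : Integrable (fun y => 1 + (s * Complex.I) * ((Z y : ℝ) : ℂ)) F :=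
      (integrable_const _).add (iC1.const_mul _)
    have iD : Integrable (fun y => (s : ℂ) ^ 2 / 2 * ((Z y ^ 2 : ℝ) : ℂ)) F := iC2.const_mul _
    have iAD : Integrable (fun y => 1 + (s * Complex.I) * ((Z y : ℝ) : ℂ)
        - (s : ℂ) ^ 2 / 2 * ((Z y ^ 2 : ℝ) : ℂ)) F := iA.sub iD
    rw [integral_sub iE iAD, integral_sub iA iD,
      integral_add (integrable_const _) (iC1.const_mul _), integral_const_mul, integral_const_mul,
      integral_complex_ofReal, integral_complex_ofReal, h0, h1]
    simp
  rw [e]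
  refine (norm_integral_le_of_norm_le_const (C := (|s| * B) ^ 3) (ae_of_all _ fun y => ?_)).trans
    (by simp)
  have hn : ‖((s * Z y : ℝ) : ℂ) * Complex.I‖ = |s| * |Z y| := by
    rw [norm_mul, Complex.norm_I, mul_one, Complex.norm_real, Real.norm_eq_abs, abs_mul]
  have hle : |s| * |Z y| ≤ |s| * B := mul_le_mul_of_nonneg_left (hB y) (abs_nonneg _)
  have := norm_exp_sub_quadratic_le (z := ((s * Z y : ℝ) : ℂ) * Complex.I)
    (by rw [hn]; exact hle.trans hs)
  rw [hn] at this
  refine le_trans (le_of_eq ?_) (this.trans (pow_le_pow_left₀ (by positivity) hle 3))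
  congr 2
  push_cast
  rw [mul_pow, Complex.I_sq]
  ring

lemma charFun_normalized_sum {n : ℕ} {F : Measure ℝ} [IsProbabilityMeasure F] {Z : ℝ → ℝ}
    (hZ : Measurable Z) (t : ℝ) :
    charFun ((Measure.pi fun _ : Fin n => F).map (fun X => ∑ i, (√(n : ℝ))⁻¹ * Z (X i))) t
      = (∫ y, Complex.exp (((t * (√(n : ℝ))⁻¹) * Z y : ℝ) * Complex.I) ∂F) ^ n := by
  have hind : iIndepFun (fun (i : Fin n) (X : Fin n → ℝ) => (√(n : ℝ))⁻¹ * Z (X i))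
      (Measure.pi fun _ : Fin n => F) :=
    iIndepFun_pi (X := fun (_ : Fin n) (y : ℝ) => (√(n : ℝ))⁻¹ * Z y) fun i => by fun_prop
  rw [hind.charFun_map_fun_sum_eq_prod (fun i => (by fun_prop : Measurable _).aemeasurable)]
  rw [Finset.prod_apply]
  have : ∀ i : Fin n, charFun ((Measure.pi fun _ : Fin n => F).map
      (fun X => (√(n : ℝ))⁻¹ * Z (X i))) t
      = ∫ y, Complex.exp (((t * (√(n : ℝ))⁻¹) * Z y : ℝ) * Complex.I) ∂F := by
    intro i
    have hm : (Measure.pi fun _ : Fin n => F).map (fun X => (√(n : ℝ))⁻¹ * Z (X i))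
        = F.map (fun y => (√(n : ℝ))⁻¹ * Z y) := by
      conv_rhs => rw [← (measurePreserving_eval (fun _ : Fin n => F) i).map_eq]
      rw [Measure.map_map (by fun_prop) (by fun_prop)]
      rfl
    rw [hm, charFun_apply_real, integral_map (by fun_prop) (by fun_prop)]
    congr 1 with y
    push_cast
    ring_nf
  simp [this]

/-- **Uniform central limit theorem.** The normal approximation of a normalized sum of i.i.d.
standardized variables is uniform over all laws of variables with a common bound. -/
lemma uniform_clt (B x : ℝ) {δ : ℝ} (hδ : 0 < δ) :
    ∃ N : ℕ, ∀ n ≥ N, ∀ F : Measure ℝ, IsProbabilityMeasure F → ∀ Z : ℝ → ℝ, Measurable Z →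
      (∀ y, |Z y| ≤ B) → ∫ y, Z y ∂F = 0 → ∫ y, Z y ^ 2 ∂F = 1 →
      |(Measure.pi fun _ : Fin n => F).real {X | ∑ i, (√(n : ℝ))⁻¹ * Z (X i) < x}
        - cdf (gaussianReal 0 1) x| ≤ δ := by
  -- a sequence of counterexamples would contradict Lévy's continuity theorem
  by_contra! hcon
  choose n hn F hF Z hZ hB h0 h1 hbad using hcon
  have hn' : Tendsto n atTop atTop := tendsto_atTop_mono hn tendsto_id
  have hnr : Tendsto (fun k => ((n k : ℝ))) atTop atTop := tendsto_natCast_atTop_atTop.comp hn'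
  have hB0 : 0 ≤ B := (abs_nonneg _).trans (hB 0 0)
  let ν : ℕ → ProbabilityMeasure ℝ := fun k =>
    ⟨(Measure.pi fun _ : Fin (n k) => F k).map (fun X => ∑ i, (√(n k : ℝ))⁻¹ * Z k (X i)),
      Measure.isProbabilityMeasure_map 
        (by have := hZ k; exact (by fun_prop : Measurable _).aemeasurable)⟩
  let ν₀ : ProbabilityMeasure ℝ := ⟨gaussianReal 0 1, inferInstance⟩
  have hlim : Tendsto ν atTop (𝓝 ν₀) := by
    rw [ProbabilityMeasure.tendsto_iff_tendsto_charFun]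
    intro t
    have hs : Tendsto (fun k => t * (√(n k : ℝ))⁻¹) atTop (𝓝 0) := by
      have : Tendsto (fun k => (√(n k : ℝ))⁻¹) atTop (𝓝 0) :=
        tendsto_inv_atTop_zero.comp (Real.tendsto_sqrt_atTop.comp hnr)
      simpa using this.const_mul t
    have hs1 : ∀ᶠ k in atTop, |t * (√(n k : ℝ))⁻¹| * B ≤ 1 := by
      have : Tendsto (fun k => |t * (√(n k : ℝ))⁻¹| * B) atTop (𝓝 0) := by
        simpa using hs.abs.mul_const B
      exact this.eventually_le_const one_pos
    have hs2 : ∀ᶠ k in atTop, |t * (√(n k : ℝ))⁻¹| ≤ 1 := by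
      have : Tendsto (fun k => |t * (√(n k : ℝ))⁻¹|) atTop (𝓝 0) := by simpa using hs.abs
      exact this.eventually_le_const one_pos
    have hpos : ∀ᶠ k in atTop, 0 < n k := hn'.eventually_gt_atTop 0
    rw [tendsto_iff_norm_sub_tendsto_zero]
    have hup : Tendsto (fun k => t ^ 2 * (|t * (√(n k : ℝ))⁻¹| * B ^ 3
        + (t * (√(n k : ℝ))⁻¹) ^ 2)) atTop (𝓝 0) := by
      have := ((hs.abs.mul_const (B ^ 3)).add (hs.pow 2)).const_mul (t ^ 2)
      simpa using this
    refine squeeze_zero' (Eventually.of_forall fun _ => norm_nonneg _) ?_ hup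
    filter_upwards [hs1, hs2, hpos] with k hk1 hk2 hk3
    set s := t * (√(n k : ℝ))⁻¹ with hs_def
    have hnk : (0 : ℝ) < n k := by exact_mod_cast hk3
    have hs_sq : (n k : ℝ) * s ^ 2 = t ^ 2 := by
      rw [hs_def, mul_pow, inv_pow, Real.sq_sqrt hnk.le]
      field_simp
    have hchar : charFun (ν k : Measure ℝ) t
        = (∫ y, Complex.exp ((s * Z k y : ℝ) * Complex.I) ∂(F k)) ^ n k :=
      charFun_normalized_sum (hZ k) t
    have hg : charFun (ν₀ : Measure ℝ) t = Complex.exp (-(s : ℂ) ^ 2 / 2) ^ n k := by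
      change charFun (gaussianReal 0 1) t = _
      rw [charFun_gaussianReal, ← Complex.exp_nat_mul]
      congr 1
      have : ((n k : ℕ) : ℂ) * (s : ℂ) ^ 2 = (t : ℂ) ^ 2 := by exact_mod_cast hs_sq
      push_cast
      linear_combination (1 / 2 : ℂ) * this
    rw [hchar, hg]
    have hb1 := norm_charFun_sub_le (F := F k) (hZ k) (hB k) (h0 k) (h1 k) hk1
    have hb2 : ‖Complex.exp (-(s : ℂ) ^ 2 / 2) - (1 - (s : ℂ) ^ 2 / 2)‖ ≤ s ^ 4 := by
      have hz : ‖(-(s : ℂ) ^ 2 / 2)‖ = s ^ 2 / 2 := by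
        rw [norm_div, norm_neg, norm_pow, Complex.norm_real, Real.norm_eq_abs, sq_abs]
        simp
      have hs2' : s ^ 2 ≤ 1 := by rw [← sq_abs]; exact pow_le_one₀ (abs_nonneg _) hk2
      have := Complex.norm_exp_sub_one_sub_id_le (x := -(s : ℂ) ^ 2 / 2) (by rw [hz]; linarith)
      rw [hz] at this
      refine le_trans (le_of_eq ?_) (this.trans ?_)
      · congr 1; ring
      · nlinarith [sq_nonneg (s ^ 2)]
    have hn1 : ‖∫ y, Complex.exp ((s * Z k y : ℝ) * Complex.I) ∂(F k)‖ ≤ 1 := by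
      refine (norm_integral_le_of_norm_le_const (C := 1) (ae_of_all _ fun y => ?_)).trans (by simp)
      rw [Complex.norm_exp_ofReal_mul_I]
    have hn2 : ‖Complex.exp (-(s : ℂ) ^ 2 / 2)‖ ≤ 1 := by
      rw [Complex.norm_exp]
      refine Real.exp_le_one_iff.2 ?_
      have : (-(s : ℂ) ^ 2 / 2) = ((-s ^ 2 / 2 : ℝ) : ℂ) := by push_cast; ring
      rw [this, Complex.ofReal_re]
      nlinarith [sq_nonneg s]
    refine (norm_pow_sub_pow_le_mul hn1 hn2 _).trans ?_
    have htri : ‖(∫ y, Complex.exp ((s * Z k y : ℝ) * Complex.I) ∂(F k))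
        - Complex.exp (-(s : ℂ) ^ 2 / 2)‖ ≤ (|s| * B) ^ 3 + s ^ 4 := by
      have := norm_sub_le_norm_sub_add_norm_sub
        (∫ y, Complex.exp ((s * Z k y : ℝ) * Complex.I) ∂(F k)) (1 - (s : ℂ) ^ 2 / 2)
        (Complex.exp (-(s : ℂ) ^ 2 / 2))
      rw [norm_sub_rev (1 - (s : ℂ) ^ 2 / 2)] at this
      linarith
    calc (n k : ℝ) * _ ≤ n k * ((|s| * B) ^ 3 + s ^ 4) := mul_le_mul_of_nonneg_left htri hnk.le
      _ = (n k * s ^ 2) * (|s| * B ^ 3 + s ^ 2) := by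
        have : |s| ^ 3 = s ^ 2 * |s| := by rw [pow_succ, sq_abs]
        rw [mul_pow, this]; ring
      _ = t ^ 2 * (|s| * B ^ 3 + s ^ 2) := by rw [hs_sq]
  have hconv : Tendsto (fun k => (ν k : Measure ℝ) (Iio x)) atTop (𝓝 ((ν₀ : Measure ℝ) (Iio x))) := by
    refine ProbabilityMeasure.tendsto_measure_of_null_frontier_of_tendsto' hlim ?_
    rw [frontier_Iio]
    have : NullSingletonClass (gaussianReal 0 1) := nullSingletonClass_gaussianReal one_ne_zero
    exact measure_singleton (μ := gaussianReal 0 1) x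
  have hreal : Tendsto (fun k => (ν k : Measure ℝ).real (Iio x)) atTop
      (𝓝 (cdf (gaussianReal 0 1) x)) := by
    have h2 : (ν₀ : Measure ℝ).real (Iio x) = cdf (gaussianReal 0 1) x := by
      have : NullSingletonClass (gaussianReal 0 1) := nullSingletonClass_gaussianReal one_ne_zero
      rw [cdf_eq_real]
      exact measureReal_congr (μ := gaussianReal 0 1) Iio_ae_eq_Iic
    rw [← h2]
    exact (ENNReal.tendsto_toReal (measure_ne_top _ _)).comp hconv
  have hev : ∀ᶠ k in atTop, |(ν k : Measure ℝ).real (Iio x) - cdf (gaussianReal 0 1) x| < δ := by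
    have := (tendsto_sub_nhds_zero_iff.2 hreal).abs
    rw [abs_zero] at this
    exact this.eventually_lt_const hδ
  obtain ⟨k, hk⟩ := hev.exists
  have hset : (ν k : Measure ℝ).real (Iio x) =
      (Measure.pi fun _ : Fin (n k) => F k).real {X | ∑ i, (√(n k : ℝ))⁻¹ * Z k (X i) < x} := by
    have := hZ k
    exact map_measureReal_apply (by fun_prop) measurableSet_Iio
  rw [hset] at hk
  exact absurd hk (not_lt.2 (hbad k).le)

lemma continuous_cdf_gaussianReal : Continuous (cdf (gaussianReal 0 1)) := by
  have : NullSingletonClass (gaussianReal 0 1) := nullSingletonClass_gaussianReal one_ne_zero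
  rw [continuous_iff_continuousAt]
  intro a
  rw [(monotone_cdf _).continuousAt_iff_leftLim_eq_rightLim, StieltjesFunction.rightLim_eq]
  refine le_antisymm ((monotone_cdf _).leftLim_le le_rfl) ?_
  have h := (cdf (gaussianReal 0 1)).measure_singleton a
  rw [measure_cdf, measure_singleton, eq_comm, ENNReal.ofReal_eq_zero] at h
  linarith

/-- **Pólya's lemma.** For monotone functions, closeness to a continuous distribution function at
finitely many quantiles implies uniform closeness. -/
lemma exists_finite_test_points (Φ : ℝ → ℝ) (hmono : Monotone Φ) (hcont : Continuous Φ)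
    (hbot : Tendsto Φ atBot (𝓝 0)) (htop : Tendsto Φ atTop (𝓝 1)) {δ : ℝ} (hδ : 0 < δ) :
    ∃ S : Finset ℝ, ∀ G : ℝ → ℝ, Monotone G → (∀ x, 0 ≤ G x) → (∀ x, G x ≤ 1) →
      (∀ y ∈ S, |G y - Φ y| ≤ δ) → ∀ x, |G x - Φ x| ≤ 2 * δ := by
  obtain ⟨m, hm⟩ := exists_nat_one_div_lt hδ
  set M : ℝ := (m : ℝ) + 1 with hM
  have hM0 : 0 < M := by positivity
  have hq : ∀ i : ℕ, 0 < i → (i : ℝ) < M → ∃ y, Φ y = i / M := by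
    intro i hi0 hi
    have h1 : (0 : ℝ) < i / M := by positivity
    have h2 : (i : ℝ) / M < 1 := (div_lt_one hM0).2 hi
    obtain ⟨a, ha⟩ := (hbot.eventually_lt_const h1).exists
    obtain ⟨c, hc⟩ := (htop.eventually_const_lt h2).exists
    exact mem_range_of_exists_le_of_exists_ge hcont ⟨a, ha.le⟩ ⟨c, hc.le⟩
  choose! y hy using hq
  refine ⟨(Finset.range (m + 1)).image y, fun G hG hG0 hG1 hS x => ?_⟩
  have hΦ0 : 0 ≤ Φ x := hmono.le_of_tendsto hbot x
  have hΦ1 : Φ x ≤ 1 := hmono.ge_of_tendsto htop x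
  have hS' : ∀ i : ℕ, 0 < i → (i : ℝ) < M → |G (y i) - i / M| ≤ δ := by
    intro i h0 hi
    have : i < m + 1 := by
      rw [hM] at hi
      exact_mod_cast hi
    have h := hS (y i) (Finset.mem_image_of_mem _ (Finset.mem_range.2 this))
    rwa [hy i h0 hi] at h
  rw [abs_le]
  constructor
  · -- the largest quantile strictly below `x`
    rcases Nat.eq_zero_or_pos (⌈M * Φ x⌉₊ - 1) with h0 | h0
    · have : M * Φ x ≤ 1 := by
        have h1 : ⌈M * Φ x⌉₊ ≤ 1 := by omega
        exact_mod_cast Nat.ceil_le.1 h1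
      have : Φ x ≤ 1 / M := by rw [le_div_iff₀ hM0]; linarith
      linarith [hG0 x]
    · set i := ⌈M * Φ x⌉₊ - 1 with hi
      have hlt : (i : ℝ) < M * Φ x := Nat.lt_ceil.1 (by omega)
      have hiM : (i : ℝ) < M := hlt.trans_le (by nlinarith)
      have hge : M * Φ x ≤ i + 1 := by
        have := Nat.le_ceil (M * Φ x)
        have h2 : ⌈M * Φ x⌉₊ = i + 1 := by omega
        rw [h2] at this
        exact_mod_cast this
      have hyx : y i ≤ x := by
        by_contra! h
        have := hmono h.le
        rw [hy i h0 hiM, le_div_iff₀ hM0] at this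
        linarith
      have h3 := (abs_le.1 (hS' i h0 hiM)).1
      have h4 := hG hyx
      have h5 : Φ x ≤ i / M + 1 / M := by rw [← add_div, le_div_iff₀ hM0]; linarith
      linarith
  · -- the smallest quantile strictly above `x`
    set i := ⌊M * Φ x⌋₊ + 1 with hi
    have hlt : M * Φ x < i := by
      have := Nat.lt_floor_add_one (M * Φ x)
      rw [hi]; exact_mod_cast this
    have hge : (i : ℝ) ≤ M * Φ x + 1 := by
      have := Nat.floor_le (mul_nonneg hM0.le hΦ0)
      rw [hi]; push_cast; linarith
    have h5 : (i : ℝ) / M ≤ Φ x + 1 / M := by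
      rw [div_le_iff₀ hM0, add_mul, div_mul_cancel₀ _ hM0.ne']; linarith
    rcases lt_or_ge (i : ℝ) M with hiM | hiM
    · have hyx : x ≤ y i := by
        by_contra! h
        have := hmono h.le
        rw [hy i (Nat.succ_pos _) hiM, div_le_iff₀ hM0] at this
        linarith
      have h3 := (abs_le.1 (hS' i (Nat.succ_pos _) hiM)).2
      have h4 := hG hyx
      linarith
    · have : 1 ≤ (i : ℝ) / M := by rwa [le_div_iff₀ hM0, one_mul]
      linarith [hG1 x]

/-! ### Smooth functions that are constant near infinity -/

/-- Twice continuously differentiable functions that are constant near `+∞` and near `-∞`; both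
`ψ` and `ρ` are of this kind. -/
structure IsFlat (g : ℝ → ℝ) : Prop where
  contDiff : ContDiff ℝ 2 g
  const : ∃ d : ℝ, 0 < d ∧ (∀ z, d ≤ z → g z = g d) ∧ ∀ z, z ≤ -d → g z = g (-d)

/-- `K` bounds `g`, its first two derivatives, the function `z ↦ g' z * z` together with its
Lipschitz constant, and the remainder of the first-order expansion of `g ((z - h) * θ)` in the
shift `h` and the scale factor `θ`, uniformly in `z`. -/
structure IsFlatBound (g : ℝ → ℝ) (K : ℝ) : Prop where
  pos : 0 < K
  bound : ∀ z, |g z| ≤ K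
  bound_deriv : ∀ z, |deriv g z| ≤ K
  bound_deriv2 : ∀ z, |deriv (deriv g) z| ≤ K
  bound_deriv_mul : ∀ z, |deriv g z * z| ≤ K
  lipschitz_deriv_mul : ∀ z w, |deriv g z * z - deriv g w * w| ≤ K * |z - w|
  expansion : ∀ z h θ, |h| ≤ 1 → |θ - 1| ≤ 1 / 2 →
    |g ((z - h) * θ) - g z - deriv g z * z * (θ - 1) + deriv g z * h| ≤ K * (h ^ 2 + (θ - 1) ^ 2)

lemma IsFlat.continuous {g : ℝ → ℝ} (hg : IsFlat g) : Continuous g := hg.contDiff.continuous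

lemma IsFlat.differentiable {g : ℝ → ℝ} (hg : IsFlat g) : Differentiable ℝ g :=
  hg.contDiff.differentiable (by norm_num)

lemma IsFlat.contDiff_deriv {g : ℝ → ℝ} (hg : IsFlat g) : ContDiff ℝ 1 (deriv g) :=
  ((contDiff_succ_iff_deriv (n := 1)).1 (by rw [one_add_one_eq_two]; exact hg.contDiff)).2.2

lemma IsFlat.continuous_deriv {g : ℝ → ℝ} (hg : IsFlat g) : Continuous (deriv g) :=
  hg.contDiff_deriv.continuous

lemma IsFlat.differentiable_deriv {g : ℝ → ℝ} (hg : IsFlat g) : Differentiable ℝ (deriv g) :=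
  hg.contDiff_deriv.differentiable (by norm_num)

lemma IsFlat.continuous_deriv2 {g : ℝ → ℝ} (hg : IsFlat g) : Continuous (deriv (deriv g)) :=
  hg.contDiff_deriv.continuous_deriv le_rfl

lemma IsFlat.deriv_eq_zero {g : ℝ → ℝ} (hg : IsFlat g) :
    ∃ d : ℝ, 0 < d ∧ (∀ z, d ≤ z → g z = g d) ∧ (∀ z, z ≤ -d → g z = g (-d)) ∧
      (∀ z, d < |z| → deriv g z = 0 ∧ deriv (deriv g) z = 0) := by
  obtain ⟨d, hd, h1, h2⟩ := hg.const
  have key : ∀ z, d < |z| → deriv g z = 0 := by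
    intro z hz
    rcases lt_abs.1 hz with h | h
    · have : g =ᶠ[𝓝 z] fun _ => g d := by
        filter_upwards [lt_mem_nhds h] with w hw using h1 w (le_of_lt hw)
      rw [this.deriv_eq]; simp
    · have : g =ᶠ[𝓝 z] fun _ => g (-d) := by
        filter_upwards [gt_mem_nhds (show z < -d by linarith)] with w hw using h2 w (le_of_lt hw)
      rw [this.deriv_eq]; simp
  refine ⟨d, hd, h1, h2, fun z hz => ⟨key z hz, ?_⟩⟩
  have : deriv g =ᶠ[𝓝 z] fun _ => 0 := by
    filter_upwards [continuous_abs.continuousAt.eventually_const_lt hz] with w hw using key w hw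
  rw [this.deriv_eq]; simp

lemma exists_bound_of_eq_zero {k : ℝ → ℝ} (hk : Continuous k) {d : ℝ}
    (hd : ∀ z, d < |z| → k z = 0) : ∃ K, 0 ≤ K ∧ ∀ z, |k z| ≤ K := by
  have hc : HasCompactSupport k := by
    refine HasCompactSupport.intro (isCompact_Icc (a := -d) (b := d)) fun x hx => hd x ?_
    by_contra! h
    exact hx (abs_le.1 h)
  obtain ⟨K, hK⟩ := hc.exists_bound_of_continuous hk
  exact ⟨K, (norm_nonneg _).trans (hK 0), hK⟩

lemma abs_sub_le_of_deriv_bound {k : ℝ → ℝ} (hk : Differentiable ℝ k) {K : ℝ}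
    (hK : ∀ z, |deriv k z| ≤ K) (z w : ℝ) : |k z - k w| ≤ K * |z - w| :=
  Convex.norm_image_sub_le_of_norm_deriv_le (s := univ) (fun x _ => hk x) (fun x _ => hK x)
    convex_univ (mem_univ w) (mem_univ z)

lemma abs_taylor_le {g : ℝ → ℝ} (hg : IsFlat g) {K : ℝ}
    (hK : ∀ z, |deriv (deriv g) z| ≤ K) (z w : ℝ) :
    |g w - g z - deriv g z * (w - z)| ≤ K * (w - z) ^ 2 := by
  have hd : ∀ x, HasDerivAt (fun y => g y - deriv g z * y) (deriv g x - deriv g z) x := by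
    intro x
    simpa using (hg.differentiable x).hasDerivAt.fun_sub ((hasDerivAt_id x).const_mul (deriv g z))
  have := Convex.norm_image_sub_le_of_norm_hasDerivWithin_le (s := uIcc z w)
    (f := fun y => g y - deriv g z * y) (C := K * |w - z|)
    (fun x _ => (hd x).hasDerivWithinAt) (fun x hx => by
      refine (abs_sub_le_of_deriv_bound hg.differentiable_deriv hK x z).trans ?_
      refine mul_le_mul_of_nonneg_left ?_ ((abs_nonneg _).trans (hK 0))
      exact abs_sub_left_of_mem_uIcc hx)
    (convex_uIcc z w) left_mem_uIcc right_mem_uIcc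
  rw [Real.norm_eq_abs, Real.norm_eq_abs, mul_assoc, abs_mul_abs_self] at this
  refine le_trans (le_of_eq ?_) (this.trans (le_of_eq (by ring)))
  congr 1; ring

/-- For large `|z|` both sides of the expansion are evaluated where `g` is constant, so only a
bounded range of `z` matters, and there Taylor's formula applies. -/
lemma IsFlat.exists_expansion {g : ℝ → ℝ} (hg : IsFlat g) : ∃ K, 0 ≤ K ∧
    ∀ z h θ, |h| ≤ 1 → |θ - 1| ≤ 1 / 2 →
    |g ((z - h) * θ) - g z - deriv g z * z * (θ - 1) + deriv g z * h|
      ≤ K * (h ^ 2 + (θ - 1) ^ 2) := by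
  obtain ⟨d, hd, h1, h2, h3⟩ := hg.deriv_eq_zero
  obtain ⟨K1, hK1, hB1⟩ := exists_bound_of_eq_zero hg.continuous_deriv fun z hz => (h3 z hz).1
  obtain ⟨K2, hK2, hB2⟩ := exists_bound_of_eq_zero hg.continuous_deriv2 fun z hz => (h3 z hz).2
  refine ⟨K2 * (2 * (2 * d + 1) ^ 2 + 5) + K1, by positivity, fun z h θ hh hθ => ?_⟩
  obtain ⟨hh1, hh2⟩ := abs_le.1 hh
  obtain ⟨hθ1, hθ2⟩ := abs_le.1 hθ
  rcases le_or_gt |z| (2 * d + 1) with hz | hz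
  · have ht := abs_taylor_le hg hB2 z ((z - h) * θ)
    set Δ := (z - h) * θ - z with hΔ
    have hΔ' : Δ = z * (θ - 1) + (-h * θ) := by rw [hΔ]; ring
    have hsq : Δ ^ 2 ≤ (2 * (2 * d + 1) ^ 2 + 5) * (h ^ 2 + (θ - 1) ^ 2) := by
      have e1 : Δ ^ 2 ≤ 2 * (z * (θ - 1)) ^ 2 + 2 * (-h * θ) ^ 2 := by
        rw [hΔ']; nlinarith [sq_nonneg (z * (θ - 1) - (-h * θ))]
      have e2 : z ^ 2 ≤ (2 * d + 1) ^ 2 := sq_le_sq' (abs_le.1 hz).1 (abs_le.1 hz).2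
      have e3 : θ ^ 2 ≤ 5 / 2 := by nlinarith
      have e4 : (z * (θ - 1)) ^ 2 ≤ (2 * d + 1) ^ 2 * (θ - 1) ^ 2 := by
        rw [mul_pow]; exact mul_le_mul_of_nonneg_right e2 (sq_nonneg _)
      have e5 : (-h * θ) ^ 2 ≤ 5 / 2 * h ^ 2 := by
        rw [mul_pow, neg_sq, mul_comm]; exact mul_le_mul_of_nonneg_right e3 (sq_nonneg _)
      nlinarith [mul_nonneg (sq_nonneg (2 * d + 1)) (sq_nonneg h), sq_nonneg (θ - 1)]
    have hmix : |deriv g z * (h * (θ - 1))| ≤ K1 * (h ^ 2 + (θ - 1) ^ 2) := by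
      rw [abs_mul]
      refine mul_le_mul (hB1 z) ?_ (abs_nonneg _) hK1
      rw [abs_le]; constructor <;> nlinarith [sq_nonneg (h + (θ - 1)), sq_nonneg (h - (θ - 1))]
    have e : g ((z - h) * θ) - g z - deriv g z * z * (θ - 1) + deriv g z * h
        = (g ((z - h) * θ) - g z - deriv g z * Δ) - deriv g z * (h * (θ - 1)) := by
      rw [hΔ]; ring
    rw [e]
    refine (abs_sub _ _).trans ?_
    have := mul_le_mul_of_nonneg_left hsq hK2
    nlinarith
  · have hd0 : deriv g z = 0 := (h3 z (by linarith)).1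
    have hgz : g ((z - h) * θ) = g z := by
      rcases lt_abs.1 hz with h' | h'
      · rw [h1 z (by linarith), h1 _ (by nlinarith)]
      · rw [h2 z (by linarith), h2 _ (by nlinarith)]
    rw [hd0, hgz]
    simp only [sub_self, zero_mul, add_zero, abs_zero]
    positivity

lemma IsFlat.exists_bound {g : ℝ → ℝ} (hg : IsFlat g) : ∃ K, IsFlatBound g K := by
  obtain ⟨K0, hK0, hB0⟩ := hg.exists_expansion
  obtain ⟨d, hd, h1, h2, h3⟩ := hg.deriv_eq_zero
  obtain ⟨K1, hK1, hB1⟩ := exists_bound_of_eq_zero hg.continuous_deriv fun z hz => (h3 z hz).1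
  obtain ⟨K2, hK2, hB2⟩ := exists_bound_of_eq_zero hg.continuous_deriv2 fun z hz => (h3 z hz).2
  obtain ⟨K3, hK3, hB3⟩ := exists_bound_of_eq_zero (k := fun z => deriv g z * z)
    (hg.continuous_deriv.mul continuous_id) fun z hz => by rw [(h3 z hz).1, zero_mul]
  obtain ⟨K4, hK4, hB4⟩ := exists_bound_of_eq_zero
    (k := fun z => deriv (deriv g) z * z + deriv g z)
    ((hg.continuous_deriv2.mul continuous_id).add hg.continuous_deriv) fun z hz => by
      rw [(h3 z hz).1, (h3 z hz).2, zero_mul, zero_add]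
  obtain ⟨K5, hB5⟩ := (isCompact_Icc (a := -d) (b := d)).exists_bound_of_continuousOn
    hg.continuous.continuousOn
  have hK5 : 0 ≤ K5 := (norm_nonneg _).trans (hB5 0 ⟨by linarith, hd.le⟩)
  have hB5' : ∀ z, |g z| ≤ K5 := by
    intro z
    rcases le_or_gt |z| d with h | h
    · exact hB5 z (abs_le.1 h)
    · rcases lt_abs.1 h with h' | h'
      · rw [h1 z h'.le]; exact hB5 d ⟨by linarith, le_rfl⟩
      · rw [h2 z (by linarith)]; exact hB5 (-d) ⟨le_rfl, by linarith⟩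
  have hlip : ∀ z w, |deriv g z * z - deriv g w * w| ≤ K4 * |z - w| := by
    have hder : ∀ z, HasDerivAt (fun z => deriv g z * z) (deriv (deriv g) z * z + deriv g z) z := by
      intro z
      simpa using (hg.differentiable_deriv z).hasDerivAt.fun_mul (hasDerivAt_id z)
    intro z w
    exact abs_sub_le_of_deriv_bound (k := fun z => deriv g z * z)
      (fun z => (hder z).differentiableAt) (fun z => by rw [(hder z).deriv]; exact hB4 z) z w
  refine ⟨K0 + K1 + K2 + K3 + K4 + K5 + 1, by positivity, ?_, ?_, ?_, ?_, ?_, ?_⟩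
  · intro z; linarith [hB5' z]
  · intro z; linarith [hB1 z]
  · intro z; linarith [hB2 z]
  · intro z; linarith [hB3 z]
  · intro z w
    exact (hlip z w).trans (mul_le_mul_of_nonneg_right (by linarith) (abs_nonneg _))
  · intro z h θ hh hθ
    exact (hB0 z h θ hh hθ).trans (mul_le_mul_of_nonneg_right (by linarith) (by positivity))

lemma IsPsi.eq_one {ψ : ℝ → ℝ} (hψ : IsPsi ψ) :
    ∃ d : ℝ, 0 < d ∧ (∀ z, d ≤ z → ψ z = 1) ∧ ∀ z, z ≤ -d → ψ z = -1 := by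
  obtain ⟨d, hd, h⟩ := hψ.abs_eq_one
  obtain ⟨L, hL, hlim⟩ := hψ.limit_pos
  have h1 : ψ =ᶠ[atTop] fun _ => L := by
    have hpos : ∀ᶠ z in atTop, 0 < ψ z := hlim.eventually_const_lt hL
    have hone : ψ =ᶠ[atTop] fun _ => 1 := by
      filter_upwards [hpos, eventually_ge_atTop d] with z hz hdz
      rcases (abs_eq zero_le_one).1 (h z (hdz.trans (le_abs_self z))) with h' | h'
      · exact h'
      · linarith
    have : L = 1 := tendsto_nhds_unique hlim (tendsto_const_nhds.congr' hone.symm)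
    rw [this]; exact hone
  have hL1 : ∀ z, d ≤ z → ψ z = 1 := by
    intro z hz
    rcases (abs_eq zero_le_one).1 (h z (hz.trans (le_abs_self z))) with h' | h'
    · exact h'
    -- a value `-1` at `z ≥ 0` contradicts monotonicity and `ψ 0 = 0`
    · have h0 : ψ 0 = 0 := by
        have := hψ.odd 0 le_rfl
        simp at this; linarith
      have := hψ.monotone (show (0 : ℝ) ≤ z by linarith)
      linarith
  refine ⟨d, hd, hL1, fun z hz => ?_⟩
  have := hψ.odd (-z) (by linarith)
  rw [neg_neg, hL1 (-z) (by linarith)] at this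
  exact this

lemma IsPsi.isFlat {ψ : ℝ → ℝ} (hψ : IsPsi ψ) : IsFlat ψ := by
  obtain ⟨d, hd, h1, h2⟩ := hψ.eq_one
  refine ⟨hψ.contDiff, d, hd, fun z hz => ?_, fun z hz => ?_⟩
  · rw [h1 z hz, h1 d le_rfl]
  · rw [h2 z hz, h2 (-d) le_rfl]

lemma IsRho.isFlat {ρ : ℝ → ℝ} (hρ : IsRho ρ) : IsFlat ρ := by
  obtain ⟨c, hc, h⟩ := hρ.eq_one
  refine ⟨hρ.contDiff, c, hc, fun z hz => ?_, fun z hz => ?_⟩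
  · rw [h z (hz.trans (le_abs_self z)), h c (le_abs_self c)]
  · rw [h z (by rw [abs_of_nonpos (by linarith)]; linarith), h (-c) (by rw [abs_neg, abs_of_pos hc])]

lemma IsRho.abs_eq {ρ : ℝ → ℝ} (hρ : IsRho ρ) (z : ℝ) : ρ |z| = ρ z := by
  rcases abs_cases z with ⟨h, _⟩ | ⟨h, h'⟩
  · rw [h]
  · rw [h]
    have := hρ.even (-z) (by linarith)
    rw [neg_neg] at this
    exact this.symm

lemma IsRho.le_of_abs_le {ρ : ℝ → ℝ} (hρ : IsRho ρ) {z w : ℝ} (h : |z| ≤ |w|) : ρ z ≤ ρ w := by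
  rw [← hρ.abs_eq z, ← hρ.abs_eq w]
  exact hρ.monotoneOn (abs_nonneg z) (abs_nonneg w) h

lemma IsRho.nonneg {ρ : ℝ → ℝ} (hρ : IsRho ρ) (z : ℝ) : 0 ≤ ρ z := by
  rw [← hρ.zero]; exact hρ.le_of_abs_le (by simp)

lemma IsRho.le_one {ρ : ℝ → ℝ} (hρ : IsRho ρ) (z : ℝ) : ρ z ≤ 1 := hρ.isLUB.1 ⟨z, rfl⟩

/-- The function `θ ↦ ρ (z θ)` is nondecreasing at `θ = 1`. -/
lemma IsRho.deriv_mul_nonneg {ρ : ℝ → ℝ} (hρ : IsRho ρ) (z : ℝ) : 0 ≤ deriv ρ z * z := by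
  have hd : HasDerivAt (fun θ : ℝ => ρ (z * θ)) (deriv ρ z * z) 1 := by
    have h1 : HasDerivAt (fun θ : ℝ => z * θ) z 1 := by
      simpa using (hasDerivAt_id (1 : ℝ)).const_mul z
    have h2 : HasDerivAt ρ (deriv ρ z) (z * 1) := by
      rw [mul_one]; exact (hρ.isFlat.differentiable z).hasDerivAt
    exact h2.comp 1 h1
  refine ge_of_tendsto ((hasDerivWithinAt_iff_tendsto_slope' (s := Ioi 1) (by simp)).1
    hd.hasDerivWithinAt) ?_
  filter_upwards [self_mem_nhdsWithin] with θ hθ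
  have hθ' : (1 : ℝ) < θ := hθ
  rw [slope_def_field]
  refine div_nonneg (sub_nonneg.2 (hρ.le_of_abs_le ?_)) (by linarith)
  rw [abs_mul, abs_mul, abs_one, abs_of_pos (by linarith : 0 < θ)]
  exact mul_le_mul_of_nonneg_left hθ'.le (abs_nonneg _)

lemma IsPsi.deriv_nonneg {ψ : ℝ → ℝ} (hψ : IsPsi ψ) (z : ℝ) : 0 ≤ deriv ψ z :=
  hψ.monotone.deriv_nonneg

/-! ### Integrals of shifted and rescaled functions -/

lemma integrable_of_bounded {Q : Measure ℝ} [IsFiniteMeasure Q] {g : ℝ → ℝ} (hg : Continuous g)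
    {K : ℝ} (hK : ∀ z, |g z| ≤ K) {r : ℝ → ℝ} (hr : Measurable r) :
    Integrable (fun x => g (r x)) Q :=
  Integrable.of_bound (hg.measurable.comp hr).aestronglyMeasurable K (ae_of_all _ fun _ => hK _)

lemma hasDerivAt_integral_shift {Q : Measure ℝ} [IsFiniteMeasure Q] {g : ℝ → ℝ}
    (hg : ContDiff ℝ 1 g) {K K' : ℝ} (hK : ∀ z, |g z| ≤ K) (hK' : ∀ z, |deriv g z| ≤ K') (s t : ℝ) :
    HasDerivAt (fun t => ∫ x, g ((x - t) / s) ∂Q) (-(∫ x, deriv g ((x - t) / s) ∂Q) / s) t := by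
  have hc : Continuous (deriv g) := hg.continuous_deriv le_rfl
  have h := hasDerivAt_integral_of_dominated_loc_of_deriv_le (μ := Q) (x₀ := t) (s := univ)
    (F := fun t x => g ((x - t) / s)) (F' := fun t x => deriv g ((x - t) / s) * (-1 / s))
    (bound := fun _ => K' * |-1 / s|) univ_mem
    (Eventually.of_forall fun t => (by
      have := hg.continuous; fun_prop : Continuous fun x => g ((x - t) / s)).aestronglyMeasurable)
    (integrable_of_bounded hg.continuous hK (by fun_prop))
    (by fun_prop : Continuous fun x => deriv g ((x - t) / s) * (-1 / s)).aestronglyMeasurable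
    (ae_of_all _ fun x t _ => by
      rw [norm_mul]; exact mul_le_mul_of_nonneg_right (hK' _) (norm_nonneg _))
    (integrable_const _)
    (ae_of_all _ fun x t _ => by
      have h1 : HasDerivAt (fun t => (x - t) / s) (-1 / s) t := by
        simpa using ((hasDerivAt_id t).const_sub x).div_const s
      exact ((hg.differentiable (by norm_num) _).hasDerivAt).comp t h1)
  have h2 := h.2
  rw [integral_mul_const] at h2
  exact h2.congr_deriv (by ring)

lemma continuousOn_integral_shift {Q : Measure ℝ} [IsFiniteMeasure Q] {g : ℝ → ℝ}
    (hg : Continuous g) {K : ℝ} (hK : ∀ z, |g z| ≤ K) :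
    ContinuousOn (fun p : ℝ × ℝ => ∫ x, g ((x - p.1) / p.2) ∂Q) {p | 0 < p.2} := by
  refine continuousOn_of_dominated (bound := fun _ => K) (fun p _ => ?_)
    (fun p _ => ae_of_all _ fun x => hK _) (integrable_const _) (ae_of_all _ fun x => ?_)
  · exact (by fun_prop : Continuous fun x => g ((x - p.1) / p.2)).aestronglyMeasurable
  · refine hg.comp_continuousOn (ContinuousOn.div (by fun_prop) (by fun_prop) fun p hp => ?_)
    exact (ne_of_gt hp)

lemma continuous_integral_shift {Q : Measure ℝ} [IsFiniteMeasure Q] {g : ℝ → ℝ}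
    (hg : Continuous g) {K : ℝ} (hK : ∀ z, |g z| ≤ K) (s : ℝ) :
    Continuous (fun t : ℝ => ∫ x, g ((x - t) / s) ∂Q) := by
  refine continuous_of_dominated (bound := fun _ => K) (fun p => ?_)
    (fun p => ae_of_all _ fun x => hK _) (integrable_const _) (ae_of_all _ fun x => ?_)
  · exact (by fun_prop : Continuous fun x => g ((x - p) / s)).aestronglyMeasurable
  · fun_prop

/-- A second derivative bounded below by `m` on an interval gives a quadratic lower bound. -/
lemma quadratic_lower_bound {φ φ' φ'' : ℝ → ℝ} (h1 : ∀ t, HasDerivAt φ (φ' t) t)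
    (h2 : ∀ t, HasDerivAt φ' (φ'' t) t) {p q m : ℝ} (hm : ∀ t ∈ Icc p q, m ≤ φ'' t) {a t : ℝ}
    (ha : a ∈ Icc p q) (ht : t ∈ Icc p q) :
    φ a + φ' a * (t - a) + m / 2 * (t - a) ^ 2 ≤ φ t := by
  have hχ : ∀ u, HasDerivAt (fun u => φ u - φ' a * u - m / 2 * (u - a) ^ 2)
      (φ' u - φ' a - m * (u - a)) u := by
    intro u
    have e1 := (hasDerivAt_id' u).const_mul (φ' a)
    have e2 := ((((hasDerivAt_id' u).sub_const a).fun_pow 2).const_mul (m / 2))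
    refine (((h1 u).fun_sub e1).fun_sub e2).congr_deriv ?_
    norm_num
    ring
  have hmono : MonotoneOn (fun u => φ' u - φ' a - m * (u - a)) (Icc p q) := by
    have hd : ∀ u, HasDerivAt (fun u => φ' u - φ' a - m * (u - a)) (φ'' u - m) u := by
      intro u
      have e := ((hasDerivAt_id u).sub_const a).const_mul m
      simpa using ((h2 u).sub_const (φ' a)).fun_sub e
    refine monotoneOn_of_deriv_nonneg (convex_Icc p q)
      (fun u _ => (hd u).continuousAt.continuousWithinAt)
      (fun u _ => (hd u).differentiableAt.differentiableWithinAt) fun u hu => ?_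
    rw [(hd u).deriv, sub_nonneg]
    exact hm u (interior_subset hu)
  have hcont : Continuous (fun u => φ u - φ' a * u - m / 2 * (u - a) ^ 2) :=
    continuous_iff_continuousAt.2 fun u => (hχ u).continuousAt
  rcases lt_trichotomy a t with h | h | h
  · obtain ⟨c, hc, hce⟩ := exists_hasDerivAt_eq_slope _ _ h hcont.continuousOn fun u _ => hχ u
    have := hmono ha ⟨ha.1.trans hc.1.le, hc.2.le.trans ht.2⟩ hc.1.le
    simp only [sub_self, mul_zero] at this
    rw [hce, le_div_iff₀ (by linarith)] at this
    nlinarith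
  · subst h; simp
  · obtain ⟨c, hc, hce⟩ := exists_hasDerivAt_eq_slope _ _ h hcont.continuousOn fun u _ => hχ u
    have := hmono ⟨ht.1.trans hc.1.le, hc.2.le.trans ha.2⟩ ha hc.2.le
    simp only [sub_self, mul_zero] at this
    rw [hce, div_le_iff₀ (by linarith)] at this
    nlinarith

lemma IsFlat.integral_quadratic_lower_bound {g : ℝ → ℝ} (hg : IsFlat g) {Q : Measure ℝ}
    [IsFiniteMeasure Q] {s : ℝ} (hs : 0 < s) {p q κ : ℝ}
    (hκ : ∀ t ∈ Icc p q, κ ≤ ∫ x, deriv (deriv g) ((x - t) / s) ∂Q) {a t : ℝ}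
    (ha : a ∈ Icc p q) (ht : t ∈ Icc p q) :
    (∫ x, g ((x - a) / s) ∂Q) - (∫ x, deriv g ((x - a) / s) ∂Q) * ((t - a) / s)
      + κ / 2 * ((t - a) / s) ^ 2 ≤ ∫ x, g ((x - t) / s) ∂Q := by
  obtain ⟨K, hK⟩ := hg.exists_bound
  have h1 := hasDerivAt_integral_shift (Q := Q) (hg.contDiff.of_le (by norm_num)) hK.bound
    hK.bound_deriv s
  have h2 : ∀ t, HasDerivAt (fun t => -(∫ x, deriv g ((x - t) / s) ∂Q) / s)
      ((∫ x, deriv (deriv g) ((x - t) / s) ∂Q) / s ^ 2) t := by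
    intro t
    have := ((hasDerivAt_integral_shift (Q := Q) hg.contDiff_deriv hK.bound_deriv
      hK.bound_deriv2 s t).neg).div_const s
    exact this.congr_deriv (by rw [neg_div, neg_div, neg_div, neg_neg, div_div, sq])
  have := quadratic_lower_bound h1 h2 (m := κ / s ^ 2)
    (fun u hu => div_le_div_of_nonneg_right (hκ u hu) (by positivity)) ha ht
  refine le_trans (le_of_eq ?_) this
  generalize (∫ x, deriv g ((x - a) / s) ∂Q) = y
  field_simp
  ring

/-! ### Empirical measures and uniform laws of large numbers -/

/-- The empirical measure of a sample. -/
def empirical {n : ℕ} (x : Fin n → ℝ) : Measure ℝ :=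
  (n : ENNReal)⁻¹ • ∑ i, Measure.dirac (x i)

lemma integral_empirical {n : ℕ} (x : Fin n → ℝ) (g : ℝ → ℝ) :
    ∫ y, g y ∂(empirical x) = (1 / (n : ℝ)) * ∑ i, g (x i) := by
  rw [empirical, integral_smul_measure, integral_finsetSum_measure
    (fun i _ => integrable_dirac (by simp))]
  simp

lemma isProbabilityMeasure_empirical {n : ℕ} (hn : n ≠ 0) (x : Fin n → ℝ) :
    IsProbabilityMeasure (empirical x) := by
  constructor
  simp only [empirical, Measure.smul_apply, Measure.finsetSum_apply, measure_univ,
    Finset.sum_const, Finset.card_univ, Fintype.card_fin, smul_eq_mul, nsmul_eq_mul, mul_one]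
  exact ENNReal.inv_mul_cancel (by simpa using hn) (by simp)

lemma sampleScale_eq (ρ : ℝ → ℝ) (b : ℝ) {n : ℕ} (x : Fin n → ℝ) :
    sampleScale ρ b x = scale ρ b (empirical x) := by
  simp only [sampleScale, scale, sampleScaleAt, scaleAt, integral_empirical]

/-- Chebyshev's inequality for the empirical mean of a bounded function. -/
lemma measureReal_deviation_le {n : ℕ} (hn : n ≠ 0) (F : Measure ℝ) [IsProbabilityMeasure F]
    {k : ℝ → ℝ} (hk : Measurable k) {K : ℝ} (hK : ∀ y, |k y| ≤ K) {a : ℝ} (ha : 0 < a) :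
    (Measure.pi fun _ : Fin n => F).real
      {X | a ≤ |(∫ y, k y ∂(empirical X)) - ∫ y, k y ∂F|} ≤ K ^ 2 / (n * a ^ 2) := by
  have hn0 : (0 : ℝ) < n := by exact_mod_cast Nat.pos_of_ne_zero hn
  have hL : MemLp k 2 F := MemLp.of_bound hk.aestronglyMeasurable K (ae_of_all _ hK)
  have hvar : Var[k; F] ≤ K ^ 2 := by
    refine (variance_le_expectation_sq hk.aestronglyMeasurable).trans ?_
    have : ∫ y, (k ^ 2) y ∂F ≤ ∫ _, K ^ 2 ∂F := by
      refine integral_mono_of_nonneg (ae_of_all _ fun y => by simp; positivity)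
        (integrable_const _) (ae_of_all _ fun y => ?_)
      exact sq_le_sq' (by linarith [(abs_le.1 (hK y)).1]) (abs_le.1 (hK y)).2
    simpa using this
  set P := Measure.pi fun _ : Fin n => F
  have hi : ∀ i : Fin n, MemLp (fun X : Fin n → ℝ => k (X i)) 2 P := fun i =>
    hL.comp_measurePreserving (measurePreserving_eval _ i)
  set S : (Fin n → ℝ) → ℝ := ∑ i, fun X => k (X i) with hS
  have hSL : MemLp S 2 P := memLp_finsetSum' _ fun i _ => hi i
  have hSv : Var[S; P] = n * Var[k; F] := by
    rw [hS, variance_sum_pi (fun _ => hL)]; simp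
  have hSm : ∫ X, S X ∂P = n * ∫ y, k y ∂F := by
    have : ∀ i : Fin n, ∫ X, k (X i) ∂P = ∫ y, k y ∂F := fun i =>
      integral_comp_eval (μ := fun _ : Fin n => F) (i := i) hk.aestronglyMeasurable
    simp only [hS, Finset.sum_apply]
    rw [integral_finsetSum _ fun i _ => (hi i).integrable (by norm_num)]
    simp [this]
  have hcheb := meas_ge_le_variance_div_sq hSL (c := n * a) (by positivity)
  have hset : {X : Fin n → ℝ | a ≤ |(∫ y, k y ∂(empirical X)) - ∫ y, k y ∂F|}
      = {X | n * a ≤ |S X - ∫ X, S X ∂P|} := by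
    ext X
    simp only [mem_ofPred_eq]
    rw [hSm, integral_empirical]
    have e : S X - n * ∫ y, k y ∂F = n * (1 / (n : ℝ) * ∑ i, k (X i) - ∫ y, k y ∂F) := by
      simp only [hS, Finset.sum_apply]
      field_simp
    rw [e, abs_mul, abs_of_pos hn0, mul_le_mul_iff_right₀ hn0]
  rw [hset, Measure.real]
  refine (ENNReal.toReal_mono ENNReal.ofReal_ne_top hcheb).trans ?_
  rw [ENNReal.toReal_ofReal (div_nonneg (variance_nonneg _ _) (sq_nonneg _)), hSv]
  calc n * Var[k; F] / (n * a) ^ 2 = Var[k; F] / (n * a ^ 2) := by field_simp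
    _ ≤ K ^ 2 / (n * a ^ 2) := div_le_div_of_nonneg_right hvar (by positivity)

lemma abs_integral_le {Q : Measure ℝ} [IsProbabilityMeasure Q] {k : ℝ → ℝ} {η : ℝ}
    (h : ∀ y, |k y| ≤ η) : |∫ y, k y ∂Q| ≤ η := by
  have := norm_integral_le_of_norm_le_const (μ := Q) (f := k) (C := η) (ae_of_all _ h)
  rwa [probReal_univ, mul_one] at this

lemma abs_integral_sub_le {Q : Measure ℝ} [IsProbabilityMeasure Q] {k l : ℝ → ℝ}
    (hk : Integrable k Q) (hl : Integrable l Q) {η : ℝ} (h : ∀ y, |k y - l y| ≤ η) :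
    |(∫ y, k y ∂Q) - ∫ y, l y ∂Q| ≤ η := by
  rw [← integral_sub hk hl]
  exact abs_integral_le h

/-- Uniform law of large numbers over a compact set of shifts, uniform in the law `F` and in the
scale `s` as long as `s` stays away from `0`. -/
lemma uniform_law_of_large_numbers {g : ℝ → ℝ} (hg : UniformContinuous g) {K : ℝ}
    (hK : ∀ z, |g z| ≤ K) (c T : ℝ) {s₁ η δ : ℝ} (hs₁ : 0 < s₁) (hη : 0 < η) (hδ : 0 < δ) :
    ∃ N : ℕ, ∀ n ≥ N, ∀ F : Measure ℝ, IsProbabilityMeasure F → ∀ s, s₁ ≤ s →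
      (Measure.pi fun _ : Fin n => F).real {X | ∃ t, |t - c| ≤ T ∧
        η < |(∫ y, g ((y - t) / s) ∂(empirical X)) - ∫ y, g ((y - t) / s) ∂F|} ≤ δ := by
  obtain ⟨r, hr, hgr⟩ := Metric.uniformContinuous_iff.1 hg (η / 3) (by positivity)
  obtain ⟨S, -, hSfin, hScov⟩ := (isCompact_Icc (a := c - T) (b := c + T)).finite_cover_balls
    (e := r * s₁) (by positivity)
  lift S to Finset ℝ using hSfin
  obtain ⟨N, hN⟩ := exists_nat_gt (S.card * (K ^ 2 / (η / 3) ^ 2) / δ)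
  refine ⟨N + 1, fun n hn F hF s hs => ?_⟩
  have hn0 : n ≠ 0 := by omega
  have hnr : (0 : ℝ) < n := by exact_mod_cast Nat.pos_of_ne_zero hn0
  have hs0 : 0 < s := hs₁.trans_le hs
  have hsub : {X : Fin n → ℝ | ∃ t, |t - c| ≤ T ∧
        η < |(∫ y, g ((y - t) / s) ∂(empirical X)) - ∫ y, g ((y - t) / s) ∂F|}
      ⊆ ⋃ u ∈ S, {X | η / 3 ≤
        |(∫ y, g ((y - u) / s) ∂(empirical X)) - ∫ y, g ((y - u) / s) ∂F|} := by
    rintro X ⟨t, ht, hX⟩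
    have := isProbabilityMeasure_empirical hn0 X
    obtain ⟨u, hu, hut⟩ := mem_iUnion₂.1 (hScov (show t ∈ Icc (c - T) (c + T) by
      rw [abs_le] at ht; constructor <;> linarith))
    refine mem_iUnion₂.2 ⟨u, hu, ?_⟩
    have hclose : ∀ y, |g ((y - t) / s) - g ((y - u) / s)| ≤ η / 3 := by
      intro y
      refine (hgr ?_).le
      rw [Real.dist_eq, ← sub_div, abs_div, abs_of_pos hs0, div_lt_iff₀ hs0]
      have : |y - t - (y - u)| = dist t u := by rw [Real.dist_eq, ← abs_neg]; congr 1; ring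
      rw [this]
      exact (Metric.mem_ball.1 hut).trans_le (mul_le_mul_of_nonneg_left hs hr.le)
    have hint : ∀ (Q : Measure ℝ) [IsProbabilityMeasure Q] (u : ℝ),
        Integrable (fun y => g ((y - u) / s)) Q := fun Q _ u =>
      integrable_of_bounded hg.continuous hK (by fun_prop)
    have h1 := abs_integral_sub_le (hint (empirical X) t) (hint _ u) hclose
    have h2 := abs_integral_sub_le (hint F t) (hint _ u) hclose
    rw [mem_ofPred_eq]
    by_contra! h3
    rw [abs_le] at h1 h2
    rw [abs_lt] at h3
    rcases lt_abs.1 hX with h | h <;> linarith [h1.1, h1.2, h2.1, h2.2, h3.1, h3.2]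
  refine (measureReal_mono hsub (measure_ne_top _ _)).trans ((measureReal_biUnion_finset_le _ _).trans ?_)
  calc _ ≤ ∑ _u ∈ S, K ^ 2 / (n * (η / 3) ^ 2) := by
        refine Finset.sum_le_sum fun u _ => ?_
        exact measureReal_deviation_le hn0 F (k := fun y => g ((y - u) / s))
          (hg.continuous.measurable.comp (by fun_prop)) (fun y => hK _) (by positivity)
    _ = S.card * (K ^ 2 / (η / 3) ^ 2) / n := by
        rw [Finset.sum_const, nsmul_eq_mul]; field_simp
    _ ≤ δ := by
        rw [div_le_iff₀ hnr]
        rw [div_lt_iff₀ hδ] at hN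
        have : (N : ℝ) ≤ n := by exact_mod_cast (by omega : N ≤ n)
        nlinarith

/-! ### Elementary properties of the scale functionals -/

lemma scaleAt_nonneg (ρ : ℝ → ℝ) (b : ℝ) (Q : Measure ℝ) (t : ℝ) : 0 ≤ scaleAt ρ b Q t :=
  Real.sInf_nonneg fun _ hs => hs.1.le

lemma scale_le_scaleAt (ρ : ℝ → ℝ) (b : ℝ) (Q : Measure ℝ) (t : ℝ) :
    scale ρ b Q ≤ scaleAt ρ b Q t :=
  ciInf_le ⟨0, by rintro _ ⟨u, rfl⟩; exact scaleAt_nonneg ρ b Q u⟩ t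

lemma IsRho.integrable {ρ : ℝ → ℝ} (hρ : IsRho ρ) (Q : Measure ℝ) [IsFiniteMeasure Q] {r : ℝ → ℝ}
    (hr : Measurable r) : Integrable (fun x => ρ (r x)) Q :=
  integrable_of_bounded hρ.isFlat.continuous
    (fun z => by rw [abs_of_nonneg (hρ.nonneg z)]; exact hρ.le_one z) hr

lemma IsRho.integral_antitone {ρ : ℝ → ℝ} (hρ : IsRho ρ) (Q : Measure ℝ) [IsFiniteMeasure Q]
    (t : ℝ) {s s' : ℝ} (hs : 0 < s) (h : s ≤ s') :
    ∫ x, ρ ((x - t) / s') ∂Q ≤ ∫ x, ρ ((x - t) / s) ∂Q := by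
  refine integral_mono (hρ.integrable Q (by fun_prop)) (hρ.integrable Q (by fun_prop)) fun x => ?_
  refine hρ.le_of_abs_le ?_
  rw [abs_div, abs_div, abs_of_pos hs, abs_of_pos (hs.trans_le h)]
  exact div_le_div_of_nonneg_left (abs_nonneg _) hs h

/-- If the equation defining `scaleAt` has no solution, then `scaleAt` is `sInf ∅ = 0`, and the
bound still holds. -/
lemma IsRho.scaleAt_le {ρ : ℝ → ℝ} (hρ : IsRho ρ) {b : ℝ} (Q : Measure ℝ) [IsFiniteMeasure Q]
    {t s : ℝ} (hs : 0 < s) (h : ∫ x, ρ ((x - t) / s) ∂Q ≤ b) : scaleAt ρ b Q t ≤ s := by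
  rcases eq_empty_or_nonempty {s : ℝ | 0 < s ∧ ∫ x, ρ ((x - t) / s) ∂Q = b} with he | ⟨u, hu⟩
  · rw [scaleAt, he, Real.sInf_empty]; exact hs.le
  · have hbdd : BddBelow {s : ℝ | 0 < s ∧ ∫ x, ρ ((x - t) / s) ∂Q = b} := ⟨0, fun _ hs => hs.1.le⟩
    rcases h.eq_or_lt with h | h
    · exact csInf_le hbdd ⟨hs, h⟩
    · refine (csInf_le hbdd hu).trans ?_
      by_contra! hlt
      have := hρ.integral_antitone Q t hs hlt.le
      linarith [hu.2]

lemma IsRho.tendsto_integral_atTop {ρ : ℝ → ℝ} (hρ : IsRho ρ) (Q : Measure ℝ) [IsFiniteMeasure Q]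
    (t : ℝ) : Tendsto (fun s : ℝ => ∫ x, ρ ((x - t) / s) ∂Q) atTop (𝓝 0) := by
  have h := tendsto_integral_filter_of_dominated_convergence (μ := Q) (l := (atTop : Filter ℝ))
    (F := fun s x => ρ ((x - t) / s)) (f := fun _ => (0 : ℝ)) (fun _ => 1)
    (Eventually.of_forall fun s => (hρ.integrable Q (by fun_prop)).aestronglyMeasurable)
    (Eventually.of_forall fun s => ae_of_all _ fun x => by
      rw [Real.norm_eq_abs, abs_of_nonneg (hρ.nonneg _)]; exact hρ.le_one _)
    (integrable_const _)
    (ae_of_all _ fun x => by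
      have h1 : Tendsto (fun s : ℝ => (x - t) / s) atTop (𝓝 0) :=
        tendsto_const_nhds.div_atTop tendsto_id
      have := (hρ.isFlat.continuous.tendsto 0).comp h1
      rwa [hρ.zero] at this)
  simpa using h

/-- Here the equation defining `scaleAt` has a solution, by the intermediate value theorem: the
objective tends to `0` as the scale grows. -/
lemma IsRho.le_scaleAt {ρ : ℝ → ℝ} (hρ : IsRho ρ) {b : ℝ} (hb : 0 < b) (Q : Measure ℝ)
    [IsFiniteMeasure Q] {t s : ℝ} (hs : 0 < s) (h : b < ∫ x, ρ ((x - t) / s) ∂Q) :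
    s ≤ scaleAt ρ b Q t := by
  refine le_csInf ?_ fun u hu => ?_
  · obtain ⟨s', hs', hlt⟩ := (((hρ.tendsto_integral_atTop Q t).eventually_lt_const hb).and
      (eventually_ge_atTop s)).exists
    have hc : ContinuousOn (fun s : ℝ => ∫ x, ρ ((x - t) / s) ∂Q) (Icc s s') := by
      have := continuousOn_integral_shift (Q := Q) hρ.isFlat.continuous (K := 1)
        (fun z => by rw [abs_of_nonneg (hρ.nonneg z)]; exact hρ.le_one z)
      exact this.comp (f := fun s : ℝ => ((t, s) : ℝ × ℝ)) (by fun_prop)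
        fun u hu => hs.trans_le hu.1
    obtain ⟨u, hu, hub⟩ := intermediate_value_Icc' hlt hc ⟨hs'.le, h.le⟩
    exact ⟨u, hs.trans_le hu.1, hub⟩
  · by_contra! hlt
    have := hρ.integral_antitone Q t hu.1 hlt.le
    linarith [hu.2]

lemma IsRho.scale_le {ρ : ℝ → ℝ} (hρ : IsRho ρ) {b : ℝ} (Q : Measure ℝ) [IsFiniteMeasure Q]
    {t s : ℝ} (hs : 0 < s) (h : ∫ x, ρ ((x - t) / s) ∂Q ≤ b) : scale ρ b Q ≤ s :=
  (scale_le_scaleAt ρ b Q t).trans (hρ.scaleAt_le Q hs h)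

lemma IsRho.le_scale {ρ : ℝ → ℝ} (hρ : IsRho ρ) {b : ℝ} (hb : 0 < b) (Q : Measure ℝ)
    [IsFiniteMeasure Q] {s : ℝ} (hs : 0 < s) (h : ∀ t, b < ∫ x, ρ ((x - t) / s) ∂Q) :
    s ≤ scale ρ b Q :=
  le_ciInf fun t => hρ.le_scaleAt hb Q hs (h t)

/-- First-order expansion of `∫ g ((u - h) θ)` in the shift `h` and the scale factor `θ`. -/
lemma IsFlatBound.integral_expansion {g : ℝ → ℝ} (hg : IsFlat g) {K : ℝ} (hK : IsFlatBound g K)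
    (Q : Measure ℝ) [IsProbabilityMeasure Q] {u : ℝ → ℝ} (hu : Measurable u) {h θ : ℝ}
    (hh : |h| ≤ 1) (hθ : |θ - 1| ≤ 1 / 2) :
    |(∫ x, g ((u x - h) * θ) ∂Q) - ((∫ x, g (u x) ∂Q)
      + (∫ x, deriv g (u x) * u x ∂Q) * (θ - 1) - (∫ x, deriv g (u x) ∂Q) * h)|
      ≤ K * (h ^ 2 + (θ - 1) ^ 2) := by
  have i1 : Integrable (fun x => g (u x)) Q := integrable_of_bounded hg.continuous hK.bound hu
  have i2 : Integrable (fun x => deriv g (u x) * u x) Q :=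
    integrable_of_bounded (g := fun z => deriv g z * z)
      (hg.continuous_deriv.mul continuous_id) hK.bound_deriv_mul hu
  have i3 : Integrable (fun x => deriv g (u x)) Q :=
    integrable_of_bounded hg.continuous_deriv hK.bound_deriv hu
  have i4 : Integrable (fun x => g ((u x - h) * θ)) Q :=
    integrable_of_bounded hg.continuous hK.bound (by fun_prop)
  have i5 : Integrable (fun x => g (u x) + deriv g (u x) * u x * (θ - 1)) Q :=
    i1.add (i2.mul_const _)
  rw [← integral_mul_const, ← integral_mul_const, ← integral_add i1 (i2.mul_const _),
    ← integral_sub i5 (i3.mul_const _)]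
  refine abs_integral_sub_le i4 (i5.sub (i3.mul_const _)) fun x => ?_
  refine le_trans (le_of_eq ?_) (hK.expansion (u x) h θ hh hθ)
  simp only [Pi.sub_apply]
  congr 1; ring

/-! ### Deterministic expansion of the S-scale -/

/-- First-order expansion of the S-scale of a law `Q` whose moments at the location `m` and the
scale `σ` are within `e` of those of a reference law with S-scale `σ` and S-location `m`:
`σ / σ(Q)` is `1 - (E_Q ρ - b) / D` up to `C e²`. The scale `σ(Q)` is located by evaluating the
objective of `Q` at the two trial scales `σ / (1 - a / D ± C e²)`. -/
lemma scale_expansion {ρ : ℝ → ℝ} (hρ : IsRho ρ) {b : ℝ} (hb : 0 < b) {K κ C e : ℝ}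
    (hK : IsFlatBound ρ K) (hκ : 0 < κ)
    (hC : C * κ = (2 * K / κ + 1) ^ 2 / (2 * κ) + 2 / κ + 4 * K / κ ^ 2 + 1)
    (he : 0 < e) (he1 : C * e ≤ 1 / κ) (he2 : e ≤ κ / 4) (he3 : 8 * K * e ≤ κ ^ 2)
    (Q : Measure ℝ) [IsProbabilityMeasure Q] {σ m c T D : ℝ} (hσ : 0 < σ) (hm : |m - c| ≤ T)
    (hD : κ ≤ D) (h1 : |(∫ x, ρ ((x - m) / σ) ∂Q) - b| ≤ e)
    (h2 : |∫ x, deriv ρ ((x - m) / σ) ∂Q| ≤ e)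
    (h3 : |(∫ x, deriv ρ ((x - m) / σ) * ((x - m) / σ) ∂Q) - D| ≤ e)
    (hconv : ∀ t, |t - c| ≤ T → κ ≤ ∫ x, deriv (deriv ρ) ((x - t) / σ) ∂Q)
    (hsep : ∀ t, T ≤ |t - c| → b + κ ≤ ∫ x, ρ ((x - t) / σ) ∂Q) :
    0 < scale ρ b Q ∧
      |σ / scale ρ b Q - 1 + ((∫ x, ρ ((x - m) / σ) ∂Q) - b) / D| ≤ C * e ^ 2 := by
  have hK0 := hK.pos
  have hD0 : 0 < D := hκ.trans_le hD
  set a := (∫ x, ρ ((x - m) / σ) ∂Q) - b with ha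
  have hCpos : 0 < C := by
    have : 0 < C * κ := by rw [hC]; positivity
    exact pos_of_mul_pos_left this hκ.le
  have hCe : C * e ^ 2 ≤ e / κ := by
    calc C * e ^ 2 = C * e * e := by ring
      _ ≤ 1 / κ * e := mul_le_mul_of_nonneg_right he1 he.le
      _ = e / κ := by ring
  have haD : |a / D| ≤ e / κ := by
    rw [abs_div, abs_of_pos hD0]
    exact div_le_div₀ he.le h1 hκ hD
  have heκ : 2 * (e / κ) ≤ 1 / 2 := by
    rw [← mul_div_assoc, div_le_iff₀ hκ]; linarith
  -- bounds available for both trial values of the scale factor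
  have hθ_bound : ∀ θ : ℝ, |θ - 1 + a / D| ≤ C * e ^ 2 → |θ - 1| ≤ 2 * (e / κ) := by
    intro θ h
    rw [abs_le] at h haD ⊢
    constructor <;> linarith [h.1, h.2, haD.1, haD.2]
  have hθ_sq : ∀ θ : ℝ, |θ - 1| ≤ 2 * (e / κ) →
      |θ - 1| * e + K * (θ - 1) ^ 2 ≤ (2 / κ + 4 * K / κ ^ 2) * e ^ 2 := by
    intro θ h
    have h5 : (θ - 1) ^ 2 ≤ (2 * (e / κ)) ^ 2 := by
      rw [← sq_abs]; exact pow_le_pow_left₀ (abs_nonneg _) h 2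
    calc |θ - 1| * e + K * (θ - 1) ^ 2 ≤ 2 * (e / κ) * e + K * (2 * (e / κ)) ^ 2 :=
          add_le_add (mul_le_mul_of_nonneg_right h he.le) (mul_le_mul_of_nonneg_left h5 hK0.le)
      _ = (2 / κ + 4 * K / κ ^ 2) * e ^ 2 := by field_simp; ring
  have hrescale : ∀ θ : ℝ, 0 < θ → ∀ t x : ℝ, (x - t) / (σ / θ) = ((x - t) / σ - 0) * θ := by
    intro θ hθ t x; field_simp; ring
  have hCe2 : C * κ * e ^ 2 ≤ D * (C * e ^ 2) := by
    have := mul_le_mul_of_nonneg_right hD (show 0 ≤ C * e ^ 2 by positivity)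
    linarith
  have hexp : ∀ t θ : ℝ, |θ - 1| ≤ 2 * (e / κ) →
      |(∫ x, ρ (((x - t) / σ - 0) * θ) ∂Q) - ((∫ x, ρ ((x - t) / σ) ∂Q)
        + (∫ x, deriv ρ ((x - t) / σ) * ((x - t) / σ) ∂Q) * (θ - 1))| ≤ K * (θ - 1) ^ 2 := by
    intro t θ hθ
    have := hK.integral_expansion hρ.isFlat Q (u := fun x => (x - t) / σ) (by fun_prop) (h := 0)
      (by simp) (hθ.trans heκ)
    simpa using this
  -- upper trial value: the objective exceeds `b` at every location
  have hup : σ / (1 - a / D + C * e ^ 2) ≤ scale ρ b Q := by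
    set θ := 1 - a / D + C * e ^ 2 with hθd
    have hθ1 : |θ - 1| ≤ 2 * (e / κ) := hθ_bound θ (by
      rw [hθd]; ring_nf; rw [abs_of_nonneg (by positivity)])
    have hθ0 : 0 < θ := by linarith [(abs_le.1 hθ1).1]
    refine hρ.le_scale hb Q (div_pos hσ hθ0) fun t => ?_
    simp only [hrescale θ hθ0]
    have hE := (abs_le.1 (hexp t θ hθ1)).1
    rcases le_total |t - c| T with ht | ht
    · set h := (t - m) / σ with hh
      have hq := hρ.isFlat.integral_quadratic_lower_bound (Q := Q) hσ (p := c - T) (q := c + T)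
        (κ := κ) (fun u hu => hconv u (abs_le.2 ⟨by linarith [hu.1], by linarith [hu.2]⟩))
        (a := m) (t := t) (by rw [abs_le] at hm; constructor <;> linarith)
        (by rw [abs_le] at ht; constructor <;> linarith)
      rw [← hh] at hq
      have hlip : |(∫ x, deriv ρ ((x - t) / σ) * ((x - t) / σ) ∂Q)
          - ∫ x, deriv ρ ((x - m) / σ) * ((x - m) / σ) ∂Q| ≤ K * |h| := by
        have hi : ∀ t, Integrable (fun x => deriv ρ ((x - t) / σ) * ((x - t) / σ)) Q := fun t =>
          integrable_of_bounded (g := fun z => deriv ρ z * z)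
            (hρ.isFlat.continuous_deriv.mul continuous_id) hK.bound_deriv_mul (by fun_prop)
        refine abs_integral_sub_le (hi t) (hi m) fun x => ?_
        refine (hK.lipschitz_deriv_mul _ _).trans (le_of_eq ?_)
        rw [hh, ← abs_neg]; congr 2; ring
      set I := ∫ x, deriv ρ ((x - t) / σ) * ((x - t) / σ) ∂Q
      have hI : |I - D| ≤ K * |h| + e := by
        refine (abs_sub_le _ _ _).trans (add_le_add hlip h3)
      have hI' : D * (θ - 1) - (K * |h| + e) * |θ - 1| ≤ I * (θ - 1) := by
        have h6 : |(I - D) * (θ - 1)| ≤ (K * |h| + e) * |θ - 1| := by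
          rw [abs_mul]; exact mul_le_mul_of_nonneg_right hI (abs_nonneg _)
        linarith [(abs_le.1 h6).1]
      have hlin : (∫ x, deriv ρ ((x - m) / σ) ∂Q) * h ≤ e * |h| := by
        refine (le_abs_self _).trans ?_
        rw [abs_mul]; exact mul_le_mul_of_nonneg_right h2 (abs_nonneg _)
      have hDθ : a + D * (θ - 1) = D * (C * e ^ 2) := by rw [hθd]; field_simp; ring
      have hsq := hθ_sq θ hθ1
      have hmix : K * |h| * |θ - 1| ≤ 2 * K / κ * e * |h| := by
        calc K * |h| * |θ - 1| ≤ K * |h| * (2 * (e / κ)) :=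
              mul_le_mul_of_nonneg_left hθ1 (by positivity)
          _ = 2 * K / κ * e * |h| := by ring
      -- completing the square absorbs the terms linear in `|h|`
      have hcs : (2 * K / κ + 1) * e * |h| ≤ κ / 2 * h ^ 2
          + (2 * K / κ + 1) ^ 2 / (2 * κ) * e ^ 2 := by
        have h8 : κ / 2 * h ^ 2 + (2 * K / κ + 1) ^ 2 / (2 * κ) * e ^ 2
            - (2 * K / κ + 1) * e * |h| = (κ * |h| - (2 * K / κ + 1) * e) ^ 2 / (2 * κ) := by
          rw [← sq_abs h]
          generalize 2 * K / κ + 1 = M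
          field_simp; ring
        have : 0 ≤ (κ * |h| - (2 * K / κ + 1) * e) ^ 2 / (2 * κ) := by positivity
        linarith
      have hCe3 : C * κ * e ^ 2 = (2 * K / κ + 1) ^ 2 / (2 * κ) * e ^ 2
          + (2 / κ + 4 * K / κ ^ 2) * e ^ 2 + e ^ 2 := by rw [hC]; ring
      have he0 : 0 < e ^ 2 := by positivity
      linarith
    · have hs := hsep t ht
      have hb1 : |∫ x, deriv ρ ((x - t) / σ) * ((x - t) / σ) ∂Q| ≤ K :=
        abs_integral_le fun x => hK.bound_deriv_mul _
      set I := ∫ x, deriv ρ ((x - t) / σ) * ((x - t) / σ) ∂Q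
      have h6 : |I * (θ - 1)| ≤ K * |θ - 1| := by
        rw [abs_mul]; exact mul_le_mul_of_nonneg_right hb1 (abs_nonneg _)
      have h7 : (θ - 1) ^ 2 ≤ 1 / 2 * |θ - 1| := by
        rw [← sq_abs]; nlinarith [abs_nonneg (θ - 1)]
      have h8 : K * |θ - 1| ≤ κ / 4 := by
        calc K * |θ - 1| ≤ K * (2 * (e / κ)) := mul_le_mul_of_nonneg_left hθ1 hK0.le
          _ = 8 * K * e / (4 * κ) := by field_simp; ring
          _ ≤ κ ^ 2 / (4 * κ) := div_le_div_of_nonneg_right he3 (by positivity)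
          _ = κ / 4 := by field_simp
      have h9 := (abs_le.1 h6).1
      have h10 := mul_le_mul_of_nonneg_left h7 hK0.le
      linarith
  -- lower trial value: the objective is at most `b` at the location `m`
  have hlow : scale ρ b Q ≤ σ / (1 - a / D - C * e ^ 2) := by
    set θ := 1 - a / D - C * e ^ 2 with hθd
    have hθ1 : |θ - 1| ≤ 2 * (e / κ) := hθ_bound θ (by
      rw [hθd]; ring_nf; rw [abs_neg, abs_of_nonneg (by positivity)])
    have hθ0 : 0 < θ := by linarith [(abs_le.1 hθ1).1]
    refine hρ.scale_le Q (t := m) (div_pos hσ hθ0) ?_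
    simp only [hrescale θ hθ0]
    have hE := (abs_le.1 (hexp m θ hθ1)).2
    set I := ∫ x, deriv ρ ((x - m) / σ) * ((x - m) / σ) ∂Q
    have h6 : |(I - D) * (θ - 1)| ≤ e * |θ - 1| := by
      rw [abs_mul]; exact mul_le_mul_of_nonneg_right h3 (abs_nonneg _)
    have hDθ : a + D * (θ - 1) = -(D * (C * e ^ 2)) := by rw [hθd]; field_simp; ring
    have hsq := hθ_sq θ hθ1
    have hCe3 : C * κ * e ^ 2 = (2 * K / κ + 1) ^ 2 / (2 * κ) * e ^ 2
        + (2 / κ + 4 * K / κ ^ 2) * e ^ 2 + e ^ 2 := by rw [hC]; ring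
    have he0 : 0 < e ^ 2 := by positivity
    have hp : 0 ≤ (2 * K / κ + 1) ^ 2 / (2 * κ) * e ^ 2 := by positivity
    linarith [(abs_le.1 h6).2]
  have hθu : 0 < 1 - a / D + C * e ^ 2 := by
    have : 0 ≤ C * e ^ 2 := by positivity
    linarith [(abs_le.1 haD).2]
  have hθl : 0 < 1 - a / D - C * e ^ 2 := by linarith [(abs_le.1 haD).2]
  have hpos : 0 < scale ρ b Q := (div_pos hσ hθu).trans_le hup
  refine ⟨hpos, ?_⟩
  rw [div_le_iff₀ hθu] at hup
  rw [le_div_iff₀ hθl] at hlow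
  have e1 : σ / scale ρ b Q ≤ 1 - a / D + C * e ^ 2 := by
    rw [div_le_iff₀ hpos]; linarith
  have e2 : 1 - a / D - C * e ^ 2 ≤ σ / scale ρ b Q := by
    rw [le_div_iff₀ hpos]; linarith
  rw [abs_le]
  constructor <;> linarith

/-- Linearization of the estimating equation with an estimated scale `s`, at a shift `h σ` away
from the location `m`. -/
lemma estimating_equation_expansion {ψ : ℝ → ℝ} (hψ : IsFlat ψ) {K κ C B e : ℝ}
    (hK : IsFlatBound ψ K) (hκ : 0 < κ) (he : 0 < e)
    (he1 : C * e ≤ 1 / κ) (he2 : e ≤ κ / 4) (hBe : B * e ≤ 1)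
    (Q : Measure ℝ) [IsProbabilityMeasure Q] {σ s m a D p k h : ℝ} (hσ : 0 < σ) (hs : 0 < s)
    (hD : κ ≤ D) (ha : |a| ≤ e) (hθ : |σ / s - 1 + a / D| ≤ C * e ^ 2) (hk : |k| ≤ K)
    (h1 : |(∫ x, deriv ψ ((x - m) / σ) ∂Q) - p| ≤ e)
    (h2 : |(∫ x, deriv ψ ((x - m) / σ) * ((x - m) / σ) ∂Q) - k| ≤ e) (hh : |h| ≤ B * e) :
    |(∫ x, ψ ((x - (m + h * σ)) / s) ∂Q) - ((∫ x, ψ ((x - m) / σ) ∂Q) - k / D * a - h * p)|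
      ≤ (K * (B ^ 2 + 4 / κ ^ 2) + 2 / κ + K * C + B) * e ^ 2 := by
  have hD0 : 0 < D := hκ.trans_le hD
  set θ := σ / s with hθd
  have haD : |a / D| ≤ e / κ := by
    rw [abs_div, abs_of_pos hD0]
    exact div_le_div₀ he.le ha hκ hD
  have hCe : C * e ^ 2 ≤ e / κ := by
    calc C * e ^ 2 = C * e * e := by ring
      _ ≤ 1 / κ * e := mul_le_mul_of_nonneg_right he1 he.le
      _ = e / κ := by ring
  have hθ1 : |θ - 1| ≤ 2 * (e / κ) := by
    rw [abs_le] at hθ haD ⊢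
    constructor <;> linarith [hθ.1, hθ.2, haD.1, haD.2]
  have heκ : 2 * (e / κ) ≤ 1 / 2 := by
    rw [← mul_div_assoc, div_le_iff₀ hκ]; linarith
  have hexp := hK.integral_expansion hψ Q (u := fun x => (x - m) / σ) (by fun_prop)
    (hh.trans hBe) (hθ1.trans heκ)
  have hre : ∀ x, (x - (m + h * σ)) / s = ((x - m) / σ - h) * θ := by
    intro x; rw [hθd]; field_simp; ring
  simp only [hre]
  set I1 := ∫ x, deriv ψ ((x - m) / σ) ∂Q
  set I2 := ∫ x, deriv ψ ((x - m) / σ) * ((x - m) / σ) ∂Q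
  have t1 : |(I2 - k) * (θ - 1)| ≤ e * (2 * (e / κ)) := by
    rw [abs_mul]; exact mul_le_mul h2 hθ1 (abs_nonneg _) he.le
  have t2 : |k * (θ - 1 + a / D)| ≤ K * (C * e ^ 2) := by
    rw [abs_mul]; exact mul_le_mul hk hθ (abs_nonneg _) hK.pos.le
  have t3 : |(I1 - p) * h| ≤ e * (B * e) := by
    rw [abs_mul]; exact mul_le_mul h1 hh (abs_nonneg _) he.le
  have t4 : K * (h ^ 2 + (θ - 1) ^ 2) ≤ K * ((B * e) ^ 2 + (2 * (e / κ)) ^ 2) := by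
    refine mul_le_mul_of_nonneg_left (add_le_add ?_ ?_) hK.pos.le
    · rw [← sq_abs]; exact pow_le_pow_left₀ (abs_nonneg _) hh 2
    · rw [← sq_abs]; exact pow_le_pow_left₀ (abs_nonneg _) hθ1 2
  have hsum : (K * (B ^ 2 + 4 / κ ^ 2) + 2 / κ + K * C + B) * e ^ 2
      = K * ((B * e) ^ 2 + (2 * (e / κ)) ^ 2) + e * (2 * (e / κ)) + K * (C * e ^ 2)
        + e * (B * e) := by field_simp; ring
  have hka : k / D * a = k * (a / D) := by ring
  rw [hsum, hka]
  rw [abs_le] at hexp t1 t2 t3 ⊢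
  constructor <;> linarith [hexp.1, hexp.2, t1.1, t1.2, t2.1, t2.2, t3.1, t3.2]

lemma IsPsi.integral_antitone {ψ : ℝ → ℝ} (hψ : IsPsi ψ) (Q : Measure ℝ) [IsFiniteMeasure Q]
    {s : ℝ} (hs : 0 < s) : Antitone fun m : ℝ => ∫ x, ψ ((x - m) / s) ∂Q := by
  intro m m' h
  have hi : ∀ m, Integrable (fun x => ψ ((x - m) / s)) Q := fun m =>
    integrable_of_bounded hψ.isFlat.continuous hψ.abs_le_one (by fun_prop)
  exact integral_mono (hi _) (hi _) fun x =>
    hψ.monotone (div_le_div_of_nonneg_right (by linarith) hs.le)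

/-! ### Regular laws and good samples -/

lemma IsFlatBound.mono {g : ℝ → ℝ} {K K' : ℝ} (h : IsFlatBound g K) (hK : K ≤ K') :
    IsFlatBound g K' where
  pos := h.pos.trans_le hK
  bound z := (h.bound z).trans hK
  bound_deriv z := (h.bound_deriv z).trans hK
  bound_deriv2 z := (h.bound_deriv2 z).trans hK
  bound_deriv_mul z := (h.bound_deriv_mul z).trans hK
  lipschitz_deriv_mul z w :=
    (h.lipschitz_deriv_mul z w).trans (mul_le_mul_of_nonneg_right hK (abs_nonneg _))
  expansion z a θ ha hθ :=
    (h.expansion z a θ ha hθ).trans (mul_le_mul_of_nonneg_right hK (by positivity))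

lemma IsFlat.uniformContinuous {g : ℝ → ℝ} (hg : IsFlat g) : UniformContinuous g := by
  obtain ⟨K, hK⟩ := hg.exists_bound
  refine (LipschitzWith.of_dist_le_mul (K := ⟨K, hK.pos.le⟩) fun z w => ?_).uniformContinuous
  exact abs_sub_le_of_deriv_bound hg.differentiable hK.bound_deriv z w

lemma IsFlat.uniformContinuous_deriv2 {g : ℝ → ℝ} (hg : IsFlat g) :
    UniformContinuous (deriv (deriv g)) := by
  obtain ⟨d, hd, -, -, h⟩ := hg.deriv_eq_zero
  refine hg.continuous_deriv2.uniformContinuous_of_tendsto_cocompact (x := 0) ?_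
  refine tendsto_const_nhds.congr' ?_
  have : ∀ᶠ z : ℝ in cocompact ℝ, z ∉ Icc (-d) d := isCompact_Icc.compl_mem_cocompact
  filter_upwards [this] with z hz
  refine ((h z ?_).2).symm
  by_contra! h'
  exact hz (abs_le.1 h')

/-- The mass near `c` bounds the objective at all locations far from `c`. -/
lemma IsRho.measureReal_Icc_le_integral {ρ : ℝ → ℝ} (hρ : IsRho ρ) {d : ℝ} (hd0 : 0 ≤ d)
    (hd : ∀ u, d ≤ |u| → ρ u = 1) (Q : Measure ℝ) [IsFiniteMeasure Q] {c M s σ₂ t : ℝ}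
    (hs : 0 < s) (hsσ : s ≤ σ₂) (ht : M + d * σ₂ ≤ |t - c|) :
    Q.real (Icc (c - M) (c + M)) ≤ ∫ x, ρ ((x - t) / s) ∂Q := by
  rw [← integral_indicator_one measurableSet_Icc]
  refine integral_mono ((integrable_const (1 : ℝ)).indicator measurableSet_Icc)
    (hρ.integrable Q (by fun_prop)) fun x => ?_
  by_cases hx : x ∈ Icc (c - M) (c + M)
  · rw [indicator_of_mem hx, hd, Pi.one_apply]
    rw [abs_div, abs_of_pos hs, le_div_iff₀ hs]
    have h1 : |x - c| ≤ M := abs_le.2 ⟨by linarith [hx.1], by linarith [hx.2]⟩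
    have h2 : |t - c| ≤ |x - t| + |x - c| := by
      rw [abs_sub_comm x t]; exact abs_sub_le t x c
    have h3 := mul_le_mul_of_nonneg_left hsσ hd0
    linarith
  · rw [indicator_of_notMem hx]; exact hρ.nonneg _

/-- The influence function of the MM-location functional, up to the factor `σ(F) H(F)`. -/
def score (ψ ρ : ℝ → ℝ) (b : ℝ) (F : Measure ℝ) (x : ℝ) : ℝ :=
  ψ (mResidual ψ ρ b F x) - coefJ ψ ρ b F * (ρ (sResidual ρ b F x) - b)

/-- Laws for which the S- and MM-functionals are well behaved, with quantitative constants: the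
scale lies in `[σ₁, σ₂]`, the estimating equations hold, and the objective function of the
S-location at the scale `σ(F)` is strongly convex for `|t - c| ≤ T` and exceeds its minimum `b`
by at least `κ` for `|t - c| ≥ T`. The condition `mass` controls the objective at infinity. -/
structure IsRegular (ψ ρ : ℝ → ℝ) (b c T M σ₁ σ₂ κ : ℝ) (F : Measure ℝ) : Prop where
  prob : IsProbabilityMeasure F
  le_scale : σ₁ ≤ scale ρ b F
  scale_le : scale ρ b F ≤ σ₂
  abs_sLocation_sub_le : |sLocation ρ b F - c| ≤ T
  integral_rho : ∫ x, ρ (sResidual ρ b F x) ∂F = b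
  integral_deriv_rho : ∫ x, deriv ρ (sResidual ρ b F x) ∂F = 0
  integral_psi : ∫ x, ψ (mResidual ψ ρ b F x) ∂F = 0
  le_denomH : κ ≤ denomH ψ ρ b F
  le_denomJ : κ ≤ denomJ ρ b F
  le_integral_score_sq : κ ≤ ∫ x, score ψ ρ b F x ^ 2 ∂F
  convex : ∀ t, |t - c| ≤ T → κ ≤ ∫ x, deriv (deriv ρ) ((x - t) / scale ρ b F) ∂F
  separated : ∀ t, T ≤ |t - c| → b + κ ≤ ∫ x, ρ ((x - t) / scale ρ b F) ∂F
  mass : b + κ ≤ F.real (Icc (c - M) (c + M))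

section Regular

variable {ψ ρ : ℝ → ℝ} {b c T M σ₁ σ₂ κ : ℝ} {F : Measure ℝ}

lemma measurable_mResidual (ψ ρ : ℝ → ℝ) (b : ℝ) (F : Measure ℝ) :
    Measurable (mResidual ψ ρ b F) := by unfold mResidual; fun_prop

lemma measurable_sResidual (ρ : ℝ → ℝ) (b : ℝ) (F : Measure ℝ) :
    Measurable (sResidual ρ b F) := by unfold sResidual; fun_prop

lemma measurable_score (hψ : IsPsi ψ) (hρ : IsRho ρ) (b : ℝ) (F : Measure ℝ) :
    Measurable (score ψ ρ b F) := by
  have h1 := hψ.isFlat.continuous.measurable.comp (measurable_mResidual ψ ρ b F)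
  have h2 := hρ.isFlat.continuous.measurable.comp (measurable_sResidual ρ b F)
  exact h1.sub ((h2.sub_const b).const_mul _)

lemma abs_integral_deriv_psi_le {K : ℝ} (hK : IsFlatBound ψ K) [IsProbabilityMeasure F] :
    |∫ x, deriv ψ (mResidual ψ ρ b F x) * mResidual ψ ρ b F x ∂F| ≤ K :=
  abs_integral_le fun _ => hK.bound_deriv_mul _

lemma abs_coefJ_le {K : ℝ} (hK : IsFlatBound ψ K) [IsProbabilityMeasure F] (hκ : 0 < κ)
    (h : κ ≤ denomJ ρ b F) : |coefJ ψ ρ b F| ≤ K / κ := by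
  rw [coefJ, abs_div, abs_of_pos (hκ.trans_le h)]
  exact div_le_div₀ hK.pos.le (abs_integral_deriv_psi_le hK) hκ h

lemma abs_score_le (hψ : IsPsi ψ) (hρ : IsRho ρ) (hb : 0 < b ∧ b < 1) {K : ℝ}
    (hK : IsFlatBound ψ K) [IsProbabilityMeasure F] (hκ : 0 < κ) (h : κ ≤ denomJ ρ b F) (x : ℝ) :
    |score ψ ρ b F x| ≤ 1 + K / κ := by
  refine (abs_sub _ _).trans (add_le_add (hψ.abs_le_one _) ?_)
  rw [abs_mul]
  refine (mul_le_of_le_one_right (abs_nonneg _) ?_).trans (abs_coefJ_le hK hκ h)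
  have h0 := hρ.nonneg (sResidual ρ b F x)
  have h1 := hρ.le_one (sResidual ρ b F x)
  rw [abs_le]; constructor <;> linarith

lemma integral_score (hψ : IsPsi ψ) (hρ : IsRho ρ) (b : ℝ) (F Q : Measure ℝ)
    [IsProbabilityMeasure Q] : ∫ x, score ψ ρ b F x ∂Q
      = (∫ x, ψ (mResidual ψ ρ b F x) ∂Q)
        - coefJ ψ ρ b F * ((∫ x, ρ (sResidual ρ b F x) ∂Q) - b) := by
  have i1 : Integrable (fun x => ψ (mResidual ψ ρ b F x)) Q :=
    integrable_of_bounded hψ.isFlat.continuous hψ.abs_le_one (measurable_mResidual ψ ρ b F)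
  have i2 : Integrable (fun x => ρ (sResidual ρ b F x)) Q :=
    hρ.integrable Q (measurable_sResidual ρ b F)
  have i3 : Integrable (fun x => coefJ ψ ρ b F * (ρ (sResidual ρ b F x) - b)) Q :=
    (i2.sub (integrable_const b)).const_mul _
  unfold score
  rw [integral_sub i1 i3, integral_const_mul,
    integral_sub i2 (integrable_const b)]
  simp

lemma sqrt_asympVar (hs : 0 < scale ρ b F) (hH : 0 < denomH ψ ρ b F) :
    √(asympVar ψ ρ b F)
      = scale ρ b F / denomH ψ ρ b F * √(∫ x, score ψ ρ b F x ^ 2 ∂F) := by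
  have e : asympVar ψ ρ b F
      = (scale ρ b F / denomH ψ ρ b F) ^ 2 * ∫ x, score ψ ρ b F x ^ 2 ∂F := by
    unfold asympVar coefH score
    ring
  rw [e, Real.sqrt_mul (sq_nonneg _), Real.sqrt_sq (by positivity)]

/-- The samples (represented by their empirical measure `Q`) on which all the empirical means
entering the expansion are close to their expectations. -/
structure IsGoodSample (ψ ρ : ℝ → ℝ) (b c T T' M κ e : ℝ) (F Q : Measure ℝ) : Prop where
  rho : |(∫ x, ρ (sResidual ρ b F x) ∂Q) - ∫ x, ρ (sResidual ρ b F x) ∂F| ≤ e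
  deriv_rho : |(∫ x, deriv ρ (sResidual ρ b F x) ∂Q)
    - ∫ x, deriv ρ (sResidual ρ b F x) ∂F| ≤ e
  deriv_rho_mul : |(∫ x, deriv ρ (sResidual ρ b F x) * sResidual ρ b F x ∂Q)
    - ∫ x, deriv ρ (sResidual ρ b F x) * sResidual ρ b F x ∂F| ≤ e
  deriv_psi : |(∫ x, deriv ψ (mResidual ψ ρ b F x) ∂Q)
    - ∫ x, deriv ψ (mResidual ψ ρ b F x) ∂F| ≤ e
  deriv_psi_mul : |(∫ x, deriv ψ (mResidual ψ ρ b F x) * mResidual ψ ρ b F x ∂Q)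
    - ∫ x, deriv ψ (mResidual ψ ρ b F x) * mResidual ψ ρ b F x ∂F| ≤ e
  mass : |(∫ x, (Icc (c - M) (c + M)).indicator 1 x ∂Q)
    - ∫ x, (Icc (c - M) (c + M)).indicator 1 x ∂F| ≤ κ / 2
  convex : ∀ t, |t - c| ≤ T → |(∫ x, deriv (deriv ρ) ((x - t) / scale ρ b F) ∂Q)
    - ∫ x, deriv (deriv ρ) ((x - t) / scale ρ b F) ∂F| ≤ κ / 2
  separated : ∀ t, |t - c| ≤ T' → |(∫ x, ρ ((x - t) / scale ρ b F) ∂Q)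
    - ∫ x, ρ ((x - t) / scale ρ b F) ∂F| ≤ κ / 2

/-- On a good sample the S-scale is positive, and the estimating equation at the location
`μ(F) + h σ(F)` is the mean score minus `h` times `denomH`, up to a quadratic remainder. -/
lemma IsRegular.good_sample_expansion (hψ : IsPsi ψ) (hρ : IsRho ρ) (hb : 0 < b ∧ b < 1)
    (hκ : 0 < κ) (hσ₁ : 0 < σ₁) (hF : IsRegular ψ ρ b c T M σ₁ σ₂ κ F)
    {d : ℝ} (hd0 : 0 < d) (hd : ∀ u, d ≤ |u| → ρ u = 1) {K C B e : ℝ}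
    (hKψ : IsFlatBound ψ K) (hKρ : IsFlatBound ρ K)
    (hC : C * (κ / 2) = (2 * K / (κ / 2) + 1) ^ 2 / (2 * (κ / 2)) + 2 / (κ / 2)
      + 4 * K / (κ / 2) ^ 2 + 1)
    (he : 0 < e) (he1 : C * e ≤ 1 / (κ / 2)) (he2 : e ≤ κ / 2 / 4)
    (he3 : 8 * K * e ≤ (κ / 2) ^ 2) (hBe : B * e ≤ 1)
    {Q : Measure ℝ} [IsProbabilityMeasure Q]
    (hQ : IsGoodSample ψ ρ b c T (M + d * σ₂) M κ e F Q) {h : ℝ} (hh : |h| ≤ B * e) :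
    0 < scale ρ b Q ∧
      |(∫ x, ψ ((x - (mLocation ψ ρ b F + h * scale ρ b F)) / scale ρ b Q) ∂Q)
        - ((∫ x, score ψ ρ b F x ∂Q) - h * denomH ψ ρ b F)|
        ≤ (K * (B ^ 2 + 4 / (κ / 2) ^ 2) + 2 / (κ / 2) + K * C + B) * e ^ 2 := by
  have := hF.prob
  have hσ : 0 < scale ρ b F := hσ₁.trans_le hF.le_scale
  have hrho := hQ.rho
  rw [hF.integral_rho] at hrho
  have hdrho := hQ.deriv_rho
  rw [hF.integral_deriv_rho, sub_zero] at hdrho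
  have hD : κ / 2 ≤ denomJ ρ b F := by linarith [hF.le_denomJ]
  have hsep : ∀ t, T ≤ |t - c| → b + κ / 2 ≤ ∫ x, ρ ((x - t) / scale ρ b F) ∂Q := by
    intro t ht
    rcases le_or_gt |t - c| (M + d * σ₂) with h' | h'
    · linarith [(abs_le.1 (hQ.separated t h')).1, hF.separated t ht]
    -- far from `c`, the central part of the sample already contributes more than `b`
    · have hle := hρ.measureReal_Icc_le_integral hd0.le hd Q hσ hF.scale_le h'.le
      have hm := hQ.mass
      rw [integral_indicator_one measurableSet_Icc, integral_indicator_one measurableSet_Icc] at hm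
      linarith [(abs_le.1 hm).1, hF.mass]
  obtain ⟨hpos, hexp⟩ := scale_expansion hρ hb.1 hKρ (half_pos hκ) hC he he1 he2 he3 Q hσ
    hF.abs_sLocation_sub_le hD hrho hdrho hQ.deriv_rho_mul
    (fun t ht => by linarith [(abs_le.1 (hQ.convex t ht)).1, hF.convex t ht]) hsep
  refine ⟨hpos, ?_⟩
  have := estimating_equation_expansion hψ.isFlat hKψ (half_pos hκ) he he1 he2 hBe Q hσ hpos hD
    hrho hexp (abs_integral_deriv_psi_le hKψ) hQ.deriv_psi hQ.deriv_psi_mul hh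
  rw [integral_score hψ hρ]
  exact this

/-- Good samples have probability close to one, uniformly over regular laws. -/
lemma eventually_good_sample (hψ : IsPsi ψ) (hρ : IsRho ρ) (c T T' M σ₂ : ℝ)
    (hκ : 0 < κ) (hσ₁ : 0 < σ₁) {K : ℝ} (hKψ : IsFlatBound ψ K) (hKρ : IsFlatBound ρ K)
    {δ : ℝ} (hδ : 0 < δ) {A : ℝ} (hA : 0 < A) (hAδ : K ^ 2 / A ^ 2 ≤ δ) :
    ∀ᶠ n : ℕ in atTop, ∀ F : Measure ℝ, IsRegular ψ ρ b c T M σ₁ σ₂ κ F →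
      (Measure.pi fun _ : Fin n => F).real
        {X | ¬ IsGoodSample ψ ρ b c T T' M κ (A / √(n : ℝ)) F (empirical X)} ≤ 8 * δ := by
  obtain ⟨N1, hN1⟩ := uniform_law_of_large_numbers hρ.isFlat.uniformContinuous_deriv2
    hKρ.bound_deriv2 c T hσ₁ (half_pos hκ) hδ
  obtain ⟨N2, hN2⟩ := uniform_law_of_large_numbers hρ.isFlat.uniformContinuous
    hKρ.bound c T' hσ₁ (half_pos hκ) hδ
  obtain ⟨N3, hN3⟩ := exists_nat_gt (1 / ((κ / 2) ^ 2 * δ))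
  filter_upwards [eventually_ge_atTop N1, eventually_ge_atTop N2, eventually_ge_atTop N3,
    eventually_gt_atTop 0] with n hn1 hn2 hn3 hn F hF
  have := hF.prob
  have hn0 : n ≠ 0 := hn.ne'
  have hnr : (0 : ℝ) < n := by exact_mod_cast hn
  set P := Measure.pi fun _ : Fin n => F
  have hA' : 0 < A / √(n : ℝ) := div_pos hA (Real.sqrt_pos.2 hnr)
  have hcheb : ∀ k : ℝ → ℝ, Measurable k → (∀ y, |k y| ≤ K) →
      P.real {X | A / √(n : ℝ) ≤ |(∫ y, k y ∂(empirical X)) - ∫ y, k y ∂F|} ≤ δ := by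
    intro k hk hkK
    refine (measureReal_deviation_le hn0 F hk hkK hA').trans (le_trans (le_of_eq ?_) hAδ)
    rw [div_pow, Real.sq_sqrt hnr.le, mul_div_cancel₀ _ hnr.ne']
  have mS := measurable_sResidual ρ b F
  have mM := measurable_mResidual ψ ρ b F
  have m1 := hρ.isFlat.continuous.measurable.comp mS
  have m2 := hρ.isFlat.continuous_deriv.measurable.comp mS
  have m4 := hψ.isFlat.continuous_deriv.measurable.comp mM
  have b1 := hcheb _ m1 fun _ => hKρ.bound _
  have b2 := hcheb _ m2 fun _ => hKρ.bound_deriv _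
  have b3 := hcheb _ (m2.mul mS) fun _ => hKρ.bound_deriv_mul _
  have b4 := hcheb _ m4 fun _ => hKψ.bound_deriv _
  have b5 := hcheb _ (m4.mul mM) fun _ => hKψ.bound_deriv_mul _
  have b6 : P.real {X | κ / 2 ≤ |(∫ x, (Icc (c - M) (c + M)).indicator 1 x ∂(empirical X))
      - ∫ x, (Icc (c - M) (c + M)).indicator 1 x ∂F|} ≤ δ := by
    refine (measureReal_deviation_le hn0 F (measurable_one.indicator measurableSet_Icc) (K := 1)
      (fun y => ?_) (half_pos hκ)).trans ?_
    · by_cases hy : y ∈ Icc (c - M) (c + M)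
      · rw [indicator_of_mem hy]; simp
      · rw [indicator_of_notMem hy]; simp
    · rw [one_pow, div_le_iff₀ (by positivity)]
      rw [div_lt_iff₀ (by positivity)] at hN3
      have h3 : (N3 : ℝ) ≤ n := by exact_mod_cast hn3
      have := mul_le_mul_of_nonneg_right h3 (show 0 ≤ (κ / 2) ^ 2 * δ by positivity)
      linarith
  have b7 := hN1 n hn1 F hF.prob _ hF.le_scale
  have b8 := hN2 n hn2 F hF.prob _ hF.le_scale
  have hU : ∀ {S S' : Set (Fin n → ℝ)} {x y : ℝ}, P.real S ≤ x → P.real S' ≤ y →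
      P.real (S ∪ S') ≤ x + y := fun h h' => (measureReal_union_le _ _).trans (add_le_add h h')
  have hbad := hU b1 (hU b2 (hU b3 (hU b4 (hU b5 (hU b6 (hU b7 b8))))))
  refine le_trans (measureReal_mono ?_ (measure_ne_top _ _)) (hbad.trans (le_of_eq (by ring)))
  intro X hX
  by_contra hcon
  simp only [mem_union, not_or] at hcon
  obtain ⟨h1, h2, h3, h4, h5, h6, h7, h8⟩ := hcon
  refine hX ⟨?_, ?_, ?_, ?_, ?_, ?_, ?_, ?_⟩
  · exact le_of_lt (not_le.1 h1)
  · exact le_of_lt (not_le.1 h2)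
  · exact le_of_lt (not_le.1 h3)
  · exact le_of_lt (not_le.1 h4)
  · exact le_of_lt (not_le.1 h5)
  · exact le_of_lt (not_le.1 h6)
  · exact fun t ht => not_lt.1 fun hlt => h7 ⟨t, ht, hlt⟩
  · exact fun t ht => not_lt.1 fun hlt => h8 ⟨t, ht, hlt⟩

end Regular

/-! ### Uniform asymptotic normality over regular laws -/

section UniformNormality

variable {ψ ρ : ℝ → ℝ} {b c T M σ₁ σ₂ κ : ℝ}

/-- On a good sample the event `√n (μ̂ - μ(F)) / √V(F) < x` is sandwiched between two events about
the normalized sum of the scores. -/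
lemma IsRegular.sandwich (hψ : IsPsi ψ) {F : Measure ℝ} (hκ : 0 < κ) (hσ₁ : 0 < σ₁)
    (hF : IsRegular ψ ρ b c T M σ₁ σ₂ κ F) {n : ℕ} (hn : 0 < n) {m x R ξ : ℝ} (X : Fin n → ℝ)
    (hs : 0 < scale ρ b (empirical X))
    (hm : ∫ y, ψ ((y - m) / scale ρ b (empirical X)) ∂(empirical X) = 0)
    (hexp : |(∫ y, ψ ((y - (mLocation ψ ρ b F + x / √(n : ℝ) * (√(∫ y, score ψ ρ b F y ^ 2 ∂F)
        / denomH ψ ρ b F) * scale ρ b F)) / scale ρ b (empirical X)) ∂(empirical X))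
      - ((∫ y, score ψ ρ b F y ∂(empirical X)) - x / √(n : ℝ) *
        (√(∫ y, score ψ ρ b F y ^ 2 ∂F) / denomH ψ ρ b F) * denomH ψ ρ b F)| ≤ R)
    (hR : R * √(n : ℝ) ≤ ξ * √κ) (hξ : 0 ≤ ξ) :
    (∑ i, (√(n : ℝ))⁻¹ * (score ψ ρ b F (X i) / √(∫ y, score ψ ρ b F y ^ 2 ∂F)) < x - ξ →
      √(n : ℝ) * (m - mLocation ψ ρ b F) / √(asympVar ψ ρ b F) < x) ∧
    (√(n : ℝ) * (m - mLocation ψ ρ b F) / √(asympVar ψ ρ b F) < x →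
      ∑ i, (√(n : ℝ))⁻¹ * (score ψ ρ b F (X i) / √(∫ y, score ψ ρ b F y ^ 2 ∂F)) ≤ x + ξ) := by
  have hσ : 0 < scale ρ b F := hσ₁.trans_le hF.le_scale
  have hp : 0 < denomH ψ ρ b F := hκ.trans_le hF.le_denomH
  have hτκ : √κ ≤ √(∫ y, score ψ ρ b F y ^ 2 ∂F) := Real.sqrt_le_sqrt hF.le_integral_score_sq
  rw [sqrt_asympVar hσ hp]
  set τ := √(∫ y, score ψ ρ b F y ^ 2 ∂F)
  have hτ : 0 < τ := (Real.sqrt_pos.2 hκ).trans_le hτκ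
  have hnr : (0 : ℝ) < n := by exact_mod_cast hn
  have hr : 0 < √(n : ℝ) := Real.sqrt_pos.2 hnr
  set p := denomH ψ ρ b F
  set μ := mLocation ψ ρ b F
  set σ := scale ρ b F
  set I := ∫ y, score ψ ρ b F y ∂(empirical X) with hI
  have hsum : ∑ i, (√(n : ℝ))⁻¹ * (score ψ ρ b F (X i) / τ) = √(n : ℝ) * I / τ := by
    rw [hI, integral_empirical, ← Finset.mul_sum, ← Finset.sum_div]
    generalize (∑ i, score ψ ρ b F (X i)) = S
    have : (n : ℝ) = √(n : ℝ) * √(n : ℝ) := (Real.mul_self_sqrt hnr.le).symm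
    rw [show (1 / (n : ℝ)) = 1 / (√(n : ℝ) * √(n : ℝ)) by rw [← this]]
    field_simp
  rw [hsum]
  have hiff : √(n : ℝ) * (m - μ) / (σ / p * τ) < x ↔ m < μ + x / √(n : ℝ) * (τ / p) * σ := by
    have : x * (σ / p * τ) = √(n : ℝ) * (x / √(n : ℝ) * (τ / p) * σ) := by field_simp
    rw [div_lt_iff₀ (by positivity), this, mul_lt_mul_iff_right₀ hr, sub_lt_iff_lt_add']
  rw [hiff]
  have hcancel : x / √(n : ℝ) * (τ / p) * p = x * τ / √(n : ℝ) := by field_simp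
  rw [hcancel] at hexp
  have hRτ : R ≤ ξ * τ / √(n : ℝ) := by
    rw [le_div_iff₀ hr]; exact hR.trans (mul_le_mul_of_nonneg_left hτκ hξ)
  have := isProbabilityMeasure_empirical hn.ne' X
  have hanti := hψ.integral_antitone (empirical X) hs
  rw [abs_le] at hexp
  constructor
  · intro hlt
    rw [div_lt_iff₀ hτ] at hlt
    by_contra! hle
    have h1 := hanti hle
    simp only [hm] at h1
    have h2 : I < x * τ / √(n : ℝ) - ξ * τ / √(n : ℝ) := by
      rw [← sub_div, lt_div_iff₀ hr]; linarith
    linarith [hexp.2]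
  · intro hlt
    have h1 := hanti hlt.le
    simp only [hm] at h1
    rw [div_le_iff₀ hτ]
    have h2 : I ≤ x * τ / √(n : ℝ) + ξ * τ / √(n : ℝ) := by linarith [hexp.1]
    rw [← add_div, le_div_iff₀ hr] at h2
    linarith

/-- Asymptotic normality at a fixed point, uniformly over regular laws. -/
lemma eventually_cdf_close (hψ : IsPsi ψ) (hρ : IsRho ρ) (hb : 0 < b ∧ b < 1) (hκ : 0 < κ)
    (hσ₁ : 0 < σ₁) {μhat : (n : ℕ) → (Fin n → ℝ) → ℝ} (hμ : IsMMEstimate ψ ρ b μhat) (x : ℝ)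
    {δ : ℝ} (hδ : 0 < δ) :
    ∀ᶠ n : ℕ in atTop, ∀ F : Measure ℝ, IsRegular ψ ρ b c T M σ₁ σ₂ κ F →
      |(Measure.pi fun _ : Fin n => F).real {X : Fin n → ℝ |
          √(n : ℝ) * (μhat n X - mLocation ψ ρ b F) / √(asympVar ψ ρ b F) < x}
        - cdf (gaussianReal 0 1) x| ≤ 10 * δ := by
  obtain ⟨Kψ, hKψ⟩ := hψ.isFlat.exists_bound
  obtain ⟨Kρ, hKρ⟩ := hρ.isFlat.exists_bound
  obtain ⟨d, hd0, hd⟩ := hρ.eq_one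
  replace hKψ := hKψ.mono (le_max_left Kψ Kρ)
  replace hKρ := hKρ.mono (le_max_right Kψ Kρ)
  set K := max Kψ Kρ
  have hK0 : 0 < K := hKψ.pos
  obtain ⟨C, hC⟩ : ∃ C : ℝ, C * (κ / 2) = (2 * K / (κ / 2) + 1) ^ 2 / (2 * (κ / 2)) + 2 / (κ / 2)
      + 4 * K / (κ / 2) ^ 2 + 1 := ⟨_, div_mul_cancel₀ _ (half_pos hκ).ne'⟩
  -- `L` bounds the scores, and `A` makes the probability of a bad sample small
  set L := 1 + K / κ with hL
  have hL0 : 0 < L := by positivity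
  set A := 1 + K ^ 2 / δ with hAdef
  have hA1 : 1 ≤ A := by rw [hAdef]; linarith [show 0 ≤ K ^ 2 / δ by positivity]
  have hA : 0 < A := by linarith
  have hAδ : K ^ 2 / A ^ 2 ≤ δ := by
    rw [div_le_iff₀ (by positivity)]
    have h1 : K ^ 2 = δ * (K ^ 2 / δ) := by field_simp
    have h2 : K ^ 2 / δ ≤ A := by rw [hAdef]; linarith
    have h3 : A ≤ A ^ 2 := by nlinarith
    rw [h1]; exact mul_le_mul_of_nonneg_left (h2.trans h3) hδ.le
  set B := |x| * L / κ with hB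
  set C' := K * (B ^ 2 + 4 / (κ / 2) ^ 2) + 2 / (κ / 2) + K * C + B
  have hΦ := continuous_cdf_gaussianReal.continuousAt (x := x)
  obtain ⟨r, hr, hΦr⟩ := Metric.continuousAt_iff.1 hΦ δ hδ
  set ξ := r / 3 with hξ
  have hξ0 : 0 < ξ := by positivity
  have hsqrt : Tendsto (fun n : ℕ => √(n : ℝ)) atTop atTop :=
    Real.tendsto_sqrt_atTop.comp tendsto_natCast_atTop_atTop
  have he : Tendsto (fun n : ℕ => A / √(n : ℝ)) atTop (𝓝 0) := tendsto_const_nhds.div_atTop hsqrt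
  have hmul : ∀ a y : ℝ, 0 < y → ∀ᶠ n : ℕ in atTop, a * (A / √(n : ℝ)) ≤ y := by
    intro a y hy
    have h := he.const_mul a
    rw [mul_zero] at h
    exact h.eventually_le_const hy
  obtain ⟨N1, hN1⟩ := uniform_clt (L / √κ) (x - ξ) hδ
  obtain ⟨N2, hN2⟩ := uniform_clt (L / √κ) (x + 2 * ξ) hδ
  filter_upwards [eventually_good_sample (b := b) hψ hρ c T (M + d * σ₂) M σ₂ hκ hσ₁ hKψ hKρ hδ
    hA hAδ, hmul C (1 / (κ / 2)) (by positivity), hmul 1 (κ / 2 / 4) (by positivity),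
    hmul (8 * K) ((κ / 2) ^ 2) (by positivity), hmul B 1 one_pos,
    hmul (C' * A) (ξ * √κ) (mul_pos hξ0 (Real.sqrt_pos.2 hκ)),
    eventually_ge_atTop N1, eventually_ge_atTop N2, eventually_gt_atTop 0]
    with n hgood he1 he2 he3 hBe hC' hn1 hn2 hn F hF
  have := hF.prob
  set P := Measure.pi fun _ : Fin n => F
  have hnr : (0 : ℝ) < n := by exact_mod_cast hn
  have hrn : 0 < √(n : ℝ) := Real.sqrt_pos.2 hnr
  have hp : 0 < denomH ψ ρ b F := hκ.trans_le hF.le_denomH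
  set e := A / √(n : ℝ) with he_def
  have he0 : 0 < e := by positivity
  set τ := √(∫ y, score ψ ρ b F y ^ 2 ∂F) with hτ_def
  have hτκ : √κ ≤ τ := Real.sqrt_le_sqrt hF.le_integral_score_sq
  have hτ : 0 < τ := (Real.sqrt_pos.2 hκ).trans_le hτκ
  have hscore : ∀ y, |score ψ ρ b F y| ≤ L := abs_score_le hψ hρ hb hKψ hκ hF.le_denomJ
  have hscore2 : ∫ y, score ψ ρ b F y ^ 2 ∂F ≤ L ^ 2 := by
    refine (le_abs_self _).trans (abs_integral_le fun y => ?_)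
    rw [abs_pow]; exact pow_le_pow_left₀ (abs_nonneg _) (hscore y) 2
  have hτL : τ ≤ L := by
    rw [hτ_def, ← Real.sqrt_sq hL0.le]; exact Real.sqrt_le_sqrt hscore2
  have hτ2 : τ ^ 2 = ∫ y, score ψ ρ b F y ^ 2 ∂F :=
    Real.sq_sqrt (hκ.le.trans hF.le_integral_score_sq)
  have hh : |x / √(n : ℝ) * (τ / denomH ψ ρ b F)| ≤ B * e := by
    rw [abs_mul, abs_div, abs_of_pos hrn, abs_of_pos (by positivity : 0 < τ / denomH ψ ρ b F)]
    have h1 : τ / denomH ψ ρ b F ≤ L / κ := div_le_div₀ hL0.le hτL hκ hF.le_denomH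
    calc |x| / √(n : ℝ) * (τ / denomH ψ ρ b F) ≤ |x| / √(n : ℝ) * (L / κ) :=
          mul_le_mul_of_nonneg_left h1 (by positivity)
      _ = B * (1 / √(n : ℝ)) := by rw [hB]; ring
      _ ≤ B * e := by
          refine mul_le_mul_of_nonneg_left ?_ (by positivity)
          exact div_le_div_of_nonneg_right hA1 hrn.le
  have hR : C' * e ^ 2 * √(n : ℝ) ≤ ξ * √κ := by
    refine le_trans (le_of_eq ?_) hC'
    rw [he_def]; field_simp
  -- the normalized sum of scores and its normal approximation
  have hZm : Measurable fun y => score ψ ρ b F y / τ := (measurable_score hψ hρ b F).div_const _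
  have hZb : ∀ y, |score ψ ρ b F y / τ| ≤ L / √κ := by
    intro y
    rw [abs_div, abs_of_pos hτ]
    exact div_le_div₀ hL0.le (hscore y) (Real.sqrt_pos.2 hκ) hτκ
  have hZ0 : ∫ y, score ψ ρ b F y / τ ∂F = 0 := by
    rw [integral_div, integral_score hψ hρ, hF.integral_psi, hF.integral_rho]; simp
  have hZ1 : ∫ y, (score ψ ρ b F y / τ) ^ 2 ∂F = 1 := by
    simp only [div_pow]
    rw [integral_div, ← hτ2, div_self (by positivity)]
  have hclt1 := abs_le.1 (hN1 n hn1 F hF.prob _ hZm hZb hZ0 hZ1)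
  have hclt2 := abs_le.1 (hN2 n hn2 F hF.prob _ hZm hZb hZ0 hZ1)
  have hΦ1 : |cdf (gaussianReal 0 1) (x - ξ) - cdf (gaussianReal 0 1) x| < δ := by
    refine hΦr ?_
    rw [Real.dist_eq, sub_sub_cancel_left, abs_neg, abs_of_pos hξ0]; linarith
  have hΦ2 : |cdf (gaussianReal 0 1) (x + 2 * ξ) - cdf (gaussianReal 0 1) x| < δ := by
    refine hΦr ?_
    rw [Real.dist_eq, add_sub_cancel_left, abs_of_pos (by positivity)]; linarith
  rw [abs_lt] at hΦ1 hΦ2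
  have hgoodX := hgood F hF
  have hsand : ∀ X : Fin n → ℝ,
      IsGoodSample ψ ρ b c T (M + d * σ₂) M κ e F (empirical X) → _ := fun X hX => by
    have := isProbabilityMeasure_empirical hn.ne' X
    obtain ⟨hs, hexp⟩ := hF.good_sample_expansion hψ hρ hb hκ hσ₁ hd0 hd hKψ hKρ hC he0 he1
      (by linarith) he3 hBe hX hh
    refine hF.sandwich hψ hκ hσ₁ hn X hs (m := μhat n X) ?_ hexp hR hξ0.le
    rw [integral_empirical, ← sampleScale_eq]
    exact (hμ n).2 X (by rw [sampleScale_eq]; exact hs)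
  have hlow := measureReal_mono (μ := P) (h₂ := measure_ne_top _ _) (show
      {X : Fin n → ℝ | ∑ i, (√(n : ℝ))⁻¹ * (score ψ ρ b F (X i) / τ) < x - ξ} ⊆
      {X | √(n : ℝ) * (μhat n X - mLocation ψ ρ b F) / √(asympVar ψ ρ b F) < x} ∪
      {X | ¬ IsGoodSample ψ ρ b c T (M + d * σ₂) M κ e F (empirical X)} from fun X hX => by
    by_cases hg : IsGoodSample ψ ρ b c T (M + d * σ₂) M κ e F (empirical X)
    · exact Or.inl ((hsand X hg).1 hX)
    · exact Or.inr hg)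
  have hupp := measureReal_mono (μ := P) (h₂ := measure_ne_top _ _) (show
      {X : Fin n → ℝ | √(n : ℝ) * (μhat n X - mLocation ψ ρ b F) / √(asympVar ψ ρ b F) < x} ⊆
      {X | ∑ i, (√(n : ℝ))⁻¹ * (score ψ ρ b F (X i) / τ) < x + 2 * ξ} ∪
      {X | ¬ IsGoodSample ψ ρ b c T (M + d * σ₂) M κ e F (empirical X)} from fun X hX => by
    by_cases hg : IsGoodSample ψ ρ b c T (M + d * σ₂) M κ e F (empirical X)
    · refine Or.inl (lt_of_le_of_lt ((hsand X hg).2 hX) (by linarith))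
    · exact Or.inr hg)
  have hlow' := hlow.trans (measureReal_union_le _ _)
  have hupp' := hupp.trans (measureReal_union_le _ _)
  rw [abs_le]
  constructor <;> linarith [hclt1.1, hclt1.2, hclt2.1, hclt2.2]

/-- Asymptotic normality, uniformly over regular laws and over the real line. -/
lemma tendsto_iSup_iSup_cdf (hψ : IsPsi ψ) (hρ : IsRho ρ) (hb : 0 < b ∧ b < 1) (hκ : 0 < κ)
    (hσ₁ : 0 < σ₁) {μhat : (n : ℕ) → (Fin n → ℝ) → ℝ} (hμ : IsMMEstimate ψ ρ b μhat)
    {𝓕 : Set (Measure ℝ)} (h𝓕 : ∀ F ∈ 𝓕, IsRegular ψ ρ b c T M σ₁ σ₂ κ F) :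
    Tendsto (fun n : ℕ => ⨆ F : 𝓕, ⨆ x : ℝ,
        |(Measure.pi (fun _ : Fin n => (F : Measure ℝ))).real
            {X : Fin n → ℝ | √(n : ℝ) * (μhat n X - mLocation ψ ρ b (F : Measure ℝ)) /
              √(asympVar ψ ρ b (F : Measure ℝ)) < x}
          - cdf (gaussianReal 0 1) x|) atTop (𝓝 0) := by
  have hnn : ∀ n : ℕ, 0 ≤ ⨆ F : 𝓕, ⨆ x : ℝ,
        |(Measure.pi (fun _ : Fin n => (F : Measure ℝ))).real
            {X : Fin n → ℝ | √(n : ℝ) * (μhat n X - mLocation ψ ρ b (F : Measure ℝ)) /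
              √(asympVar ψ ρ b (F : Measure ℝ)) < x}
          - cdf (gaussianReal 0 1) x| := fun n =>
    Real.iSup_nonneg fun F => Real.iSup_nonneg fun x => abs_nonneg _
  rw [Metric.tendsto_atTop']
  intro η hη
  obtain ⟨S, hS⟩ := exists_finite_test_points (cdf (gaussianReal 0 1)) (monotone_cdf _)
    continuous_cdf_gaussianReal (tendsto_cdf_atBot _) (tendsto_cdf_atTop _)
    (δ := η / 4) (by positivity)
  have hev : ∀ᶠ n : ℕ in atTop, ∀ x ∈ S, ∀ F : Measure ℝ, IsRegular ψ ρ b c T M σ₁ σ₂ κ F →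
      |(Measure.pi fun _ : Fin n => F).real {X : Fin n → ℝ |
          √(n : ℝ) * (μhat n X - mLocation ψ ρ b F) / √(asympVar ψ ρ b F) < x}
        - cdf (gaussianReal 0 1) x| ≤ η / 4 := by
    rw [eventually_all_finset]
    intro x _
    filter_upwards [eventually_cdf_close (c := c) (T := T) (M := M) (σ₂ := σ₂) hψ hρ hb hκ hσ₁ hμ x
      (δ := η / 40) (by positivity)] with n hn F hF
    exact (hn F hF).trans (by linarith)
  obtain ⟨N, hN⟩ := eventually_atTop.1 hev
  refine ⟨N, fun n hn => ?_⟩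
  rw [Real.dist_eq, sub_zero, abs_of_nonneg (hnn n)]
  refine lt_of_le_of_lt (Real.iSup_le (fun F => Real.iSup_le (fun x => ?_) (half_pos hη).le)
    (half_pos hη).le) (half_lt_self hη)
  have hF := h𝓕 F F.2
  have := hF.prob
  have h := hS (fun x => (Measure.pi (fun _ : Fin n => (F : Measure ℝ))).real
    {X : Fin n → ℝ | √(n : ℝ) * (μhat n X - mLocation ψ ρ b (F : Measure ℝ)) /
      √(asympVar ψ ρ b (F : Measure ℝ)) < x})
    (fun x y hxy => measureReal_mono (fun X hX => lt_of_lt_of_le hX hxy) (measure_ne_top _ _))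
    (fun x => measureReal_nonneg) (fun x => measureReal_le_one)
    (fun y hy => hN n hn.le y hy F hF) x
  exact h.trans (by linarith)

end UniformNormality

/-! ### Consequences of compactness and of full support -/

lemma exists_add_le_of_isCompact {α : Type*} [TopologicalSpace α] {S : Set α} (hS : IsCompact S)
    {k : α → ℝ} (hk : ContinuousOn k S) {a : ℝ} (h : ∀ p ∈ S, a < k p) :
    ∃ η, 0 < η ∧ ∀ p ∈ S, a + η ≤ k p := by
  rcases S.eq_empty_or_nonempty with rfl | hne
  · exact ⟨1, one_pos, by simp⟩
  · obtain ⟨p, hp, hmin⟩ := hS.exists_isMinOn hne hk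
    exact ⟨k p - a, sub_pos.2 (h p hp), fun q hq => by linarith [isMinOn_iff.1 hmin q hq]⟩

lemma integral_pos_of_isOpenPosMeasure {G : Measure ℝ} [IsFiniteMeasure G] [G.IsOpenPosMeasure]
    {k : ℝ → ℝ} (hk : Continuous k) {K : ℝ} (hK : ∀ z, |k z| ≤ K) (h0 : ∀ z, 0 ≤ k z) {z : ℝ}
    (hz : 0 < k z) {s : ℝ} (hs : 0 < s) (t : ℝ) : 0 < ∫ x, k ((x - t) / s) ∂G := by
  have hi : Integrable (fun x => k ((x - t) / s)) G := integrable_of_bounded hk hK (by fun_prop)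
  rw [integral_pos_iff_support_of_nonneg (fun x => h0 _) hi]
  have hc : Continuous fun x => k ((x - t) / s) := by fun_prop
  refine hc.isOpen_support.measure_pos G ⟨t + s * z, ?_⟩
  rw [Function.mem_support, add_sub_cancel_left, mul_div_cancel_left₀ _ hs.ne']
  exact hz.ne'

lemma IsPsi.exists_deriv_pos {ψ : ℝ → ℝ} (hψ : IsPsi ψ) : ∃ z, 0 < deriv ψ z := by
  by_contra! h
  obtain ⟨d, hd, h1, h2⟩ := hψ.eq_one
  have := is_const_of_deriv_eq_zero hψ.isFlat.differentiable
    (fun z => le_antisymm (h z) (hψ.deriv_nonneg z)) d (-d)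
  rw [h1 d le_rfl, h2 (-d) le_rfl] at this
  norm_num at this

lemma IsRho.exists_deriv_mul_pos {ρ : ℝ → ℝ} (hρ : IsRho ρ) : ∃ z, 0 < deriv ρ z * z := by
  by_contra! h
  obtain ⟨c, hc, h1⟩ := hρ.eq_one
  have hz : ∀ z, deriv ρ z = 0 := by
    intro z
    rcases eq_or_ne z 0 with rfl | hz
    · refine IsLocalMin.deriv_eq_zero (Eventually.of_forall fun w => ?_)
      rw [hρ.zero]; exact hρ.nonneg w
    · exact (mul_eq_zero.1 (le_antisymm (h z) (hρ.deriv_mul_nonneg z))).resolve_right hz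
  have := is_const_of_deriv_eq_zero hρ.isFlat.differentiable hz c 0
  rw [h1 c (le_abs_self c), hρ.zero] at this
  norm_num at this

/-! ### The S-location functional of a single law -/

section SLocation

variable {ρ : ℝ → ℝ} {b c T κ : ℝ} {Q : Measure ℝ}

lemma exists_solution_of_scale_pos (h : 0 < scale ρ b Q) (t : ℝ) :
    ∃ s, scale ρ b Q ≤ s ∧ ∫ x, ρ ((x - t) / s) ∂Q = b := by
  have hpos := h.trans_le (scale_le_scaleAt ρ b Q t)
  have hne : {s : ℝ | 0 < s ∧ ∫ x, ρ ((x - t) / s) ∂Q = b}.Nonempty := by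
    rw [nonempty_iff_ne_empty]
    intro he
    rw [scaleAt, he, Real.sInf_empty] at hpos
    exact lt_irrefl _ hpos
  obtain ⟨s, hs⟩ := hne
  exact ⟨s, (scale_le_scaleAt ρ b Q t).trans (csInf_le ⟨0, fun _ hs => hs.1.le⟩ hs), hs.2⟩

variable [IsProbabilityMeasure Q]

lemma IsRho.le_integral_scale (hρ : IsRho ρ) (h : 0 < scale ρ b Q) (t : ℝ) :
    b ≤ ∫ x, ρ ((x - t) / scale ρ b Q) ∂Q := by
  obtain ⟨s, hs, hsb⟩ := exists_solution_of_scale_pos h t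
  exact hsb.symm.le.trans (hρ.integral_antitone Q t h hs)

/-- If the objective exceeds `b` by `η` at scale `s`, it still exceeds `b` at a scale slightly
larger than `s`; the enlargement depends only on `η` and `s`, not on the location. -/
lemma IsRho.exists_larger_scale (hρ : IsRho ρ) {s η : ℝ} (hs : 0 < s) (hη : 0 < η) :
    ∃ s', s < s' ∧ ∀ t, b + η ≤ ∫ x, ρ ((x - t) / s) ∂Q → b < ∫ x, ρ ((x - t) / s') ∂Q := by
  obtain ⟨K, hK⟩ := hρ.isFlat.exists_bound
  have hK0 := hK.pos
  obtain ⟨r, hr0, hr1, hr2⟩ : ∃ r : ℝ, 0 < r ∧ r ≤ 1 / 2 ∧ 2 * K * r < η := by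
    refine ⟨min (1 / 2) (η / (4 * K)), by positivity, min_le_left _ _, ?_⟩
    have h := mul_le_mul_of_nonneg_left (min_le_right (1 / 2) (η / (4 * K)))
      (by positivity : 0 ≤ 2 * K)
    have e : 2 * K * (η / (4 * K)) = η / 2 := by field_simp; norm_num
    linarith
  refine ⟨s / (1 - r), ?_, fun t ht => ?_⟩
  · rw [lt_div_iff₀ (by linarith)]; nlinarith
  · have hre : ∀ x, (x - t) / (s / (1 - r)) = ((x - t) / s - 0) * (1 - r) := by
      intro x; field_simp; ring
    simp only [hre]
    have h1 := hK.integral_expansion hρ.isFlat Q (u := fun x => (x - t) / s) (by fun_prop)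
      (h := 0) (θ := 1 - r) (by simp) (by rw [sub_sub_cancel_left, abs_neg, abs_of_pos hr0]; exact hr1)
    have h2 : |∫ x, deriv ρ ((x - t) / s) * ((x - t) / s) ∂Q| ≤ K :=
      abs_integral_le fun x => hK.bound_deriv_mul _
    have h3 := mul_le_mul_of_nonneg_right (abs_le.1 h2).2 hr0.le
    have h4 := (abs_le.1 h1).1
    have h5 : K * (r * r) ≤ K * (r * (1 / 2)) :=
      mul_le_mul_of_nonneg_left (mul_le_mul_of_nonneg_left hr1 hr0.le) hK0.le
    nlinarith

/-- The infimum defining the S-scale is attained. Otherwise the objective at the scale `σ(Q)`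
would exceed `b` by a positive amount, and `σ(Q)` could be enlarged. -/
lemma IsRho.exists_integral_eq (hρ : IsRho ρ) (hb : 0 < b) (hκ : 0 < κ) (h : 0 < scale ρ b Q)
    (hsep : ∀ t, T ≤ |t - c| → b + κ ≤ ∫ x, ρ ((x - t) / scale ρ b Q) ∂Q) :
    ∃ t, ∫ x, ρ ((x - t) / scale ρ b Q) ∂Q = b := by
  by_contra! hne
  have hgt : ∀ t, b < ∫ x, ρ ((x - t) / scale ρ b Q) ∂Q := fun t =>
    lt_of_le_of_ne (hρ.le_integral_scale h t) (hne t).symm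
  have hcont := continuous_integral_shift (Q := Q) hρ.isFlat.continuous (K := 1)
    (fun z => by rw [abs_of_nonneg (hρ.nonneg z)]; exact hρ.le_one z) (scale ρ b Q)
  obtain ⟨η, hη, hmin⟩ := exists_add_le_of_isCompact (isCompact_Icc (a := c - T) (b := c + T))
    hcont.continuousOn fun t _ => hgt t
  obtain ⟨s', hs', hlt⟩ := hρ.exists_larger_scale (b := b) (Q := Q) h (lt_min hη hκ)
  have := hρ.le_scale hb Q (h.trans hs') fun t => hlt t (by
    rcases le_total |t - c| T with ht | ht
    · have := hmin t (by rw [abs_le] at ht; constructor <;> linarith)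
      linarith [min_le_left η κ]
    · linarith [hsep t ht, min_le_right η κ])
  linarith

/-- The S-locations are the points at which the objective at the scale `σ(Q)` attains its
minimum `b`. -/
lemma IsRho.isSLocation_iff (hρ : IsRho ρ) (hb : 0 < b) (h : 0 < scale ρ b Q) (m : ℝ) :
    IsSLocation ρ b Q m ↔ ∫ x, ρ ((x - m) / scale ρ b Q) ∂Q = b := by
  constructor
  · intro hm
    have hle : scaleAt ρ b Q m ≤ scale ρ b Q := le_ciInf hm
    refine le_antisymm ?_ (hρ.le_integral_scale h m)
    by_contra! hlt
    obtain ⟨s', hs', hlt'⟩ := hρ.exists_larger_scale (b := b) (Q := Q) h (sub_pos.2 hlt)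
    have := hρ.le_scaleAt hb Q (h.trans hs') (hlt' m (by linarith))
    linarith
  · intro hm t
    exact (hρ.scaleAt_le Q h hm.le).trans (scale_le_scaleAt ρ b Q t)

lemma IsRho.integral_deriv_eq_zero (hρ : IsRho ρ) (h : 0 < scale ρ b Q) {m : ℝ}
    (hm : ∫ x, ρ ((x - m) / scale ρ b Q) ∂Q = b) :
    ∫ x, deriv ρ ((x - m) / scale ρ b Q) ∂Q = 0 := by
  obtain ⟨K, hK⟩ := hρ.isFlat.exists_bound
  have hd := hasDerivAt_integral_shift (Q := Q) (hρ.contDiff.of_le (by norm_num)) hK.bound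
    hK.bound_deriv (scale ρ b Q) m
  have hmin : IsLocalMin (fun t => ∫ x, ρ ((x - t) / scale ρ b Q) ∂Q) m :=
    Eventually.of_forall fun t => by simp only [hm]; exact hρ.le_integral_scale h t
  have := hmin.hasDerivAt_eq_zero hd
  rcases div_eq_zero_iff.1 this with h' | h'
  · linarith
  · exact absurd h' h.ne'

lemma IsRho.existsUnique_isSLocation (hρ : IsRho ρ) (hb : 0 < b) (hκ : 0 < κ)
    (h : 0 < scale ρ b Q)
    (hconv : ∀ t, |t - c| ≤ T → κ ≤ ∫ x, deriv (deriv ρ) ((x - t) / scale ρ b Q) ∂Q)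
    (hsep : ∀ t, T ≤ |t - c| → b + κ ≤ ∫ x, ρ ((x - t) / scale ρ b Q) ∂Q) :
    ∃! m, IsSLocation ρ b Q m := by
  simp only [hρ.isSLocation_iff hb h]
  obtain ⟨m, hm⟩ := hρ.exists_integral_eq hb hκ h hsep
  have hmem : ∀ t, ∫ x, ρ ((x - t) / scale ρ b Q) ∂Q = b → t ∈ Icc (c - T) (c + T) := by
    intro t ht
    have : |t - c| ≤ T := by
      by_contra! hlt
      linarith [hsep t hlt.le]
    rw [abs_le] at this
    constructor <;> linarith
  refine ⟨m, hm, fun t ht => ?_⟩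
  have hq := hρ.isFlat.integral_quadratic_lower_bound (Q := Q) h (κ := κ)
    (fun u hu => hconv u (abs_le.2 ⟨by linarith [hu.1], by linarith [hu.2]⟩)) (hmem m hm)
    (hmem t ht)
  rw [hm, ht, hρ.integral_deriv_eq_zero h hm] at hq
  have hsq : ((t - m) / scale ρ b Q) ^ 2 ≤ 0 := by
    by_contra! hlt
    nlinarith [mul_pos (half_pos hκ) hlt]
  have h0 := pow_eq_zero_iff (two_ne_zero) |>.1 (le_antisymm hsq (sq_nonneg _))
  rcases div_eq_zero_iff.1 h0 with h' | h'
  · linarith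
  · exact absurd h' h.ne'

end SLocation

/-! ### The M-location functional of a single law -/

lemma IsPsi.strictAnti_integral {ψ : ℝ → ℝ} (hψ : IsPsi ψ) {Q : Measure ℝ} [IsFiniteMeasure Q]
    {s : ℝ} (hs : 0 < s) (hpos : ∀ m, 0 < ∫ x, deriv ψ ((x - m) / s) ∂Q) :
    StrictAnti fun m => ∫ x, ψ ((x - m) / s) ∂Q := by
  obtain ⟨K, hK⟩ := hψ.isFlat.exists_bound
  have hd := hasDerivAt_integral_shift (Q := Q) (hψ.contDiff.of_le (by norm_num)) hK.bound
    hK.bound_deriv s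
  refine strictAnti_of_deriv_neg fun m => ?_
  rw [(hd m).deriv]
  exact div_neg_of_neg_of_pos (neg_lt_zero.2 (hpos m)) hs

lemma IsPsi.existsUnique_isMLocation {ψ ρ : ℝ → ℝ} (hψ : IsPsi ψ) {b c R : ℝ} {Q : Measure ℝ}
    [IsFiniteMeasure Q] (hs : 0 < scale ρ b Q)
    (hpos : ∀ m, 0 < ∫ x, deriv ψ ((x - m) / scale ρ b Q) ∂Q)
    (hright : ∀ m, c + R < m → ∫ x, ψ ((x - m) / scale ρ b Q) ∂Q < 0)
    (hleft : ∀ m, m < c - R → 0 < ∫ x, ψ ((x - m) / scale ρ b Q) ∂Q) :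
    ∃! m, IsMLocation ψ ρ b Q m := by
  have hanti := hψ.strictAnti_integral hs hpos
  have hc := continuous_integral_shift (Q := Q) hψ.isFlat.continuous hψ.abs_le_one (scale ρ b Q)
  obtain ⟨m, hm⟩ := mem_range_of_exists_le_of_exists_ge hc (c := 0)
    ⟨c + R + 1, (hright _ (by linarith)).le⟩ ⟨c - R - 1, (hleft _ (by linarith)).le⟩
  exact ⟨m, hm, fun t ht => hanti.injective (ht.trans hm.symm)⟩

/-! ### Contaminated laws -/

/-- The law `(1 - ε) G + ε H`. -/
def mixture (ε : ℝ) (G H : Measure ℝ) : Measure ℝ := ENNReal.ofReal (1 - ε) • G + ENNReal.ofReal ε • H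

section Mixture

variable {ε : ℝ} {G H : Measure ℝ}

lemma isProbabilityMeasure_mixture (h0 : 0 ≤ ε) (h1 : ε ≤ 1) [IsProbabilityMeasure G]
    [IsProbabilityMeasure H] : IsProbabilityMeasure (mixture ε G H) := by
  constructor
  simp only [mixture, Measure.add_apply, Measure.smul_apply, measure_univ, smul_eq_mul, mul_one]
  rw [← ENNReal.ofReal_add (by linarith) h0]
  simp

lemma integral_mixture (h0 : 0 ≤ ε) (h1 : ε ≤ 1) {k : ℝ → ℝ} (hG : Integrable k G)
    (hH : Integrable k H) :
    ∫ x, k x ∂(mixture ε G H) = (1 - ε) * ∫ x, k x ∂G + ε * ∫ x, k x ∂H := by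
  rw [mixture, integral_add_measure (hG.smul_measure ENNReal.ofReal_ne_top)
    (hH.smul_measure ENNReal.ofReal_ne_top), integral_smul_measure, integral_smul_measure,
    ENNReal.toReal_ofReal (by linarith), ENNReal.toReal_ofReal h0, smul_eq_mul, smul_eq_mul]

lemma le_integral_mixture (h0 : 0 ≤ ε) (h1 : ε ≤ 1) {k : ℝ → ℝ} (hG : Integrable k G)
    (hH : Integrable k H) (hk : ∀ x, 0 ≤ k x) {a : ℝ} (ha : a ≤ ∫ x, k x ∂G) :
    (1 - ε) * a ≤ ∫ x, k x ∂(mixture ε G H) := by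
  rw [integral_mixture h0 h1 hG hH]
  have h2 := mul_nonneg h0 (integral_nonneg (μ := H) hk)
  have h3 := mul_le_mul_of_nonneg_left ha (by linarith : 0 ≤ 1 - ε)
  linarith

end Mixture

lemma exists_lt_measureReal_Icc (G : Measure ℝ) [IsProbabilityMeasure G] (c : ℝ) {q : ℝ}
    (hq : q < 1) : ∃ M, 0 < M ∧ q < G.real (Icc (c - M) (c + M)) := by
  have hmono : Monotone fun n : ℕ => Icc (c - (n : ℝ)) (c + n) := by
    intro n m h
    have : (n : ℝ) ≤ m := by exact_mod_cast h
    exact Icc_subset_Icc (by linarith) (by linarith)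
  have hU : ⋃ n : ℕ, Icc (c - (n : ℝ)) (c + n) = univ := by
    refine eq_univ_of_forall fun x => ?_
    obtain ⟨n, hn⟩ := exists_nat_ge |x - c|
    rw [abs_le] at hn
    exact mem_iUnion.2 ⟨n, by linarith, by linarith⟩
  have hlim := tendsto_measure_iUnion_atTop (μ := G) hmono
  rw [hU, measure_univ] at hlim
  have hlim' : Tendsto (fun n : ℕ => G.real (Icc (c - (n : ℝ)) (c + n))) atTop (𝓝 1) := by
    have := (ENNReal.tendsto_toReal ENNReal.one_ne_top).comp hlim
    exact this
  obtain ⟨n, hn, hn0⟩ := ((hlim'.eventually_const_lt hq).and (eventually_gt_atTop 0)).exists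
  exact ⟨n, by exact_mod_cast hn0, hn⟩

/-! ### Contaminated laws are uniformly regular -/

section MixtureConstants

variable {ψ ρ : ℝ → ℝ} {b c T σ₁ σ₂ ε κ₀ : ℝ} {G : Measure ℝ} [IsProbabilityMeasure G]

/-- If no point contamination makes the scale vanish, then `b < 1 - ε`. -/
lemma lt_one_sub_of_scale_pos [G.IsOpenPosMeasure] (hρ : IsRho ρ) (hε : 0 ≤ ε ∧ ε < 1 / 2)
    (h : 0 < scale ρ b (mixture ε G (Measure.dirac c))) : b < 1 - ε := by
  obtain ⟨s, hs, hsb⟩ := exists_solution_of_scale_pos h c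
  have hs0 : 0 < s := h.trans_le hs
  rw [integral_mixture hε.1 (by linarith) (hρ.integrable G (by fun_prop))
    (hρ.integrable _ (by fun_prop)), integral_dirac, sub_self, zero_div, hρ.zero] at hsb
  have hpos := integral_pos_of_isOpenPosMeasure (G := G) (k := fun z => 1 - ρ z) (K := 1)
    (continuous_const.sub hρ.isFlat.continuous)
    (fun z => abs_le.2 ⟨by linarith [hρ.le_one z], by linarith [hρ.nonneg z]⟩)
    (fun z => by linarith [hρ.le_one z]) (z := 0) (by rw [hρ.zero]; norm_num) hs0 c
  rw [integral_sub (integrable_const _) (hρ.integrable G (by fun_prop))] at hpos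
  simp only [integral_const, probReal_univ, one_smul] at hpos
  nlinarith

lemma exists_pos_le_integral [G.IsOpenPosMeasure] {k : ℝ → ℝ} (hk : Continuous k) {K : ℝ}
    (hK : ∀ z, |k z| ≤ K) (h0 : ∀ z, 0 ≤ k z) (hpos : ∃ z, 0 < k z) (hσ₁ : 0 < σ₁) (c R σ₂ : ℝ) :
    ∃ η, 0 < η ∧ ∀ t, |t - c| ≤ R → ∀ s ∈ Icc σ₁ σ₂, η ≤ ∫ x, k ((x - t) / s) ∂G := by
  obtain ⟨z, hz⟩ := hpos
  obtain ⟨η, hη, h⟩ := exists_add_le_of_isCompact (a := 0)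
    ((isCompact_Icc (a := c - R) (b := c + R)).prod (isCompact_Icc (a := σ₁) (b := σ₂)))
    ((continuousOn_integral_shift (Q := G) hk hK).mono fun p hp => hσ₁.trans_le hp.2.1)
    fun p hp => integral_pos_of_isOpenPosMeasure hk hK h0 hz (hσ₁.trans_le hp.2.1) p.1
  refine ⟨η, hη, fun t ht s hs => ?_⟩
  have := h (t, s) ⟨by rw [abs_le] at ht; constructor <;> linarith, hs⟩
  linarith

/-- Uniform separation of the objective at scale `σ(F)`: compactness handles bounded locations,
and far from the center the mass of `G` near `c` suffices, since `b < 1 - ε`. -/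
lemma exists_separation_mixture (hρ : IsRho ρ) (hε : 0 ≤ ε ∧ ε < 1 / 2) (hσ₁ : 0 < σ₁)
    (hscale : ∀ H, IsProbabilityMeasure H →
      σ₁ ≤ scale ρ b (mixture ε G H) ∧ scale ρ b (mixture ε G H) ≤ σ₂)
    (hsep : ∀ t, T ≤ |t - c| → ∀ s ∈ Icc σ₁ σ₂,
      ε / (1 - ε) < (∫ x, ρ ((x - t) / s) ∂G) - ∫ x, ρ ((x - c) / s) ∂G)
    {M κ : ℝ} (hκ : 0 < κ) (hM : b + κ ≤ (1 - ε) * G.real (Icc (c - M) (c + M))) :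
    ∃ κ', 0 < κ' ∧ ∀ H, IsProbabilityMeasure H → ∀ t, T ≤ |t - c| →
      b + κ' ≤ ∫ x, ρ ((x - t) / scale ρ b (mixture ε G H)) ∂(mixture ε G H) := by
  obtain ⟨d, hd0, hd⟩ := hρ.eq_one
  have hε1 : 0 < 1 - ε := by linarith
  have hρ1 : ∀ z, |ρ z| ≤ 1 := fun z => by rw [abs_of_nonneg (hρ.nonneg z)]; exact hρ.le_one z
  have hcont := continuousOn_integral_shift (Q := G) hρ.isFlat.continuous hρ1
  obtain ⟨η, hη, hgap⟩ := exists_add_le_of_isCompact (a := ε / (1 - ε))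
    (((isCompact_Icc (a := c - (M + d * σ₂)) (b := c + (M + d * σ₂))).inter_right
      (isClosed_le continuous_const (by fun_prop) : IsClosed {t : ℝ | T ≤ |t - c|})).prod
        (isCompact_Icc (a := σ₁) (b := σ₂)))
    (k := fun p : ℝ × ℝ => (∫ x, ρ ((x - p.1) / p.2) ∂G) - ∫ x, ρ ((x - c) / p.2) ∂G)
    ((hcont.mono fun p hp => hσ₁.trans_le hp.2.1).sub
      (hcont.comp (f := fun p : ℝ × ℝ => ((c, p.2) : ℝ × ℝ)) (by fun_prop)
        fun p hp => hσ₁.trans_le hp.2.1))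
    fun p hp => hsep p.1 hp.1.2 p.2 hp.2
  refine ⟨min κ ((1 - ε) * η), lt_min hκ (mul_pos hε1 hη), fun H hH t ht => ?_⟩
  have := isProbabilityMeasure_mixture hε.1 (by linarith) (G := G) (H := H)
  have hs : 0 < scale ρ b (mixture ε G H) := hσ₁.trans_le (hscale H hH).1
  have hi : ∀ t, ∀ Q : Measure ℝ, IsProbabilityMeasure Q →
      Integrable (fun x => ρ ((x - t) / scale ρ b (mixture ε G H))) Q :=
    fun t Q _ => hρ.integrable Q (by fun_prop)
  rcases le_total |t - c| (M + d * σ₂) with h | h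
  · have hg := hgap (t, scale ρ b (mixture ε G H))
      ⟨⟨by rw [abs_le] at h; constructor <;> linarith, ht⟩, hscale H hH⟩
    have hbase := hρ.le_integral_scale hs c
    have hmul := mul_le_mul_of_nonneg_left hg hε1.le
    rw [mul_add, mul_div_cancel₀ _ hε1.ne'] at hmul
    rw [integral_mixture hε.1 (by linarith) (hi _ G ‹_›) (hi _ H hH)] at hbase ⊢
    -- contamination changes the difference of the two objectives by at most `ε`
    have h1 : ∫ x, ρ ((x - c) / scale ρ b (mixture ε G H)) ∂H ≤ 1 :=
      (le_abs_self _).trans (abs_integral_le fun x => hρ1 _)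
    have h0 : 0 ≤ ∫ x, ρ ((x - t) / scale ρ b (mixture ε G H)) ∂H :=
      integral_nonneg fun x => hρ.nonneg _
    have h2 := mul_le_mul_of_nonneg_left h1 hε.1
    have h3 := mul_nonneg hε.1 h0
    have h4 := min_le_right κ ((1 - ε) * η)
    linarith
  · have h1 := hρ.measureReal_Icc_le_integral hd0.le hd G hs (hscale H hH).2 h
    have h2 := le_integral_mixture hε.1 (by linarith) (hi t G ‹_›) (hi t H hH)
      (fun x => hρ.nonneg _) h1
    linarith [min_le_left κ ((1 - ε) * η)]

/-- The sign of `E_F ψ((X - m)/s)` is known far from the center because `ε < 1/2`. -/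
lemma exists_sign_mixture (hψ : IsPsi ψ) (hε : 0 ≤ ε ∧ ε < 1 / 2) (c : ℝ) {σ₂ : ℝ}
    (hσ₂ : 0 < σ₂) : ∃ R, 0 < R ∧ ∀ H, IsProbabilityMeasure H → ∀ s, 0 < s → s ≤ σ₂ → ∀ m,
      (c + R < m → ∫ x, ψ ((x - m) / s) ∂(mixture ε G H) < 0) ∧
      (m < c - R → 0 < ∫ x, ψ ((x - m) / s) ∂(mixture ε G H)) := by
  obtain ⟨d, hd0, hd1, hd2⟩ := hψ.eq_one
  have hε1 : 0 < 1 - ε := by linarith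
  obtain ⟨M, hM0, hM⟩ := exists_lt_measureReal_Icc G c (q := 1 / (2 * (1 - ε))) (by
    rw [div_lt_one (by positivity)]; linarith)
  have hq : 1 < 2 * (1 - ε) * G.real (Icc (c - M) (c + M)) := by
    rw [div_lt_iff₀ (by positivity)] at hM; linarith
  set I := Icc (c - M) (c + M) with hI
  refine ⟨M + d * σ₂, by positivity, fun H hH s hs hsσ m => ?_⟩
  have hi : ∀ Q : Measure ℝ, IsProbabilityMeasure Q → Integrable (fun x => ψ ((x - m) / s)) Q :=
    fun Q _ => integrable_of_bounded hψ.isFlat.continuous hψ.abs_le_one (by fun_prop)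
  have hind : Integrable (I.indicator (1 : ℝ → ℝ)) G :=
    (integrable_const (1 : ℝ)).indicator measurableSet_Icc
  have hval : ∫ x, (1 - 2 * I.indicator (1 : ℝ → ℝ) x) ∂G = 1 - 2 * G.real I := by
    rw [integral_sub (integrable_const _) (hind.const_mul 2), integral_const_mul,
      integral_indicator_one measurableSet_Icc]
    simp [hI]
  have hintV : Integrable (fun x => 1 - 2 * I.indicator (1 : ℝ → ℝ) x) G :=
    (integrable_const _).sub (hind.const_mul 2)
  have hHb := abs_le.1 (abs_integral_le (Q := H) fun x => hψ.abs_le_one ((x - m) / s))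
  have hds := mul_le_mul_of_nonneg_left hsσ hd0.le
  rw [integral_mixture hε.1 (by linarith) (hi G ‹_›) (hi H hH)]
  constructor
  · intro hm
    have hle : ∫ x, ψ ((x - m) / s) ∂G ≤ 1 - 2 * G.real I := by
      rw [← hval]
      refine integral_mono (hi G ‹_›) hintV fun x => ?_
      by_cases hx : x ∈ I
      · have : (x - m) / s ≤ -d := by rw [div_le_iff₀ hs]; linarith [hx.2]
        simp only [indicator_of_mem hx, Pi.one_apply]
        rw [hd2 _ this]; norm_num
      · simp only [indicator_of_notMem hx]
        linarith [(abs_le.1 (hψ.abs_le_one ((x - m) / s))).2]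
    have h1 := mul_le_mul_of_nonneg_left hle hε1.le
    have h2 := mul_le_mul_of_nonneg_left hHb.2 hε.1
    linarith
  · intro hm
    have hle : -(1 - 2 * G.real I) ≤ ∫ x, ψ ((x - m) / s) ∂G := by
      rw [← hval, ← integral_neg]
      refine integral_mono hintV.neg (hi G ‹_›) fun x => ?_
      by_cases hx : x ∈ I
      · have : d ≤ (x - m) / s := by rw [le_div_iff₀ hs]; linarith [hx.1]
        simp only [indicator_of_mem hx, Pi.one_apply]
        rw [hd1 _ this]; norm_num
      · simp only [indicator_of_notMem hx]
        linarith [(abs_le.1 (hψ.abs_le_one ((x - m) / s))).1]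
    have h1 := mul_le_mul_of_nonneg_left hle hε1.le
    have h2 := mul_le_mul_of_nonneg_left hHb.1 hε.1
    linarith

/-- A lower bound for the second moment of the score: far to the right and far to the left `ρ` is
`1` while `ψ` takes the values `1` and `-1`, so the score cannot be small on both sides. -/
lemma exists_pos_le_integral_score_sq [G.IsOpenPosMeasure] (hψ : IsPsi ψ) (hρ : IsRho ρ)
    (b c R R' : ℝ) {σ₂ : ℝ} (hσ₂ : 0 < σ₂) : ∃ η, 0 < η ∧
      ∀ m m' s J : ℝ, |m - c| ≤ R → |m' - c| ≤ R' → 0 < s → s ≤ σ₂ →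
        η ≤ ∫ x, (ψ ((x - m) / s) - J * (ρ ((x - m') / s) - b)) ^ 2 ∂G := by
  obtain ⟨d, hd0, hd1, hd2⟩ := hψ.eq_one
  obtain ⟨d', hd0', hd'⟩ := hρ.eq_one
  set L := |R| + |R'| + (d + d') * σ₂ with hL
  have hL0 : 0 < L := by positivity
  have hp1 : 0 < G.real (Ioi (c + L)) :=
    ENNReal.toReal_pos (isOpen_Ioi.measure_pos G nonempty_Ioi).ne' (measure_ne_top _ _)
  have hp2 : 0 < G.real (Iio (c - L)) :=
    ENNReal.toReal_pos (isOpen_Iio.measure_pos G nonempty_Iio).ne' (measure_ne_top _ _)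
  set p := min (G.real (Ioi (c + L))) (G.real (Iio (c - L)))
  refine ⟨2 * p, mul_pos two_pos (lt_min hp1 hp2), fun m m' s J hm hm' hs hsσ => ?_⟩
  set a := J * (1 - b) with ha
  have hs1 := mul_le_mul_of_nonneg_left hsσ hd0.le
  have hs2 := mul_le_mul_of_nonneg_left hsσ hd0'.le
  have hs1' : 0 < d * σ₂ := by positivity
  have hs2' : 0 < d' * σ₂ := by positivity
  have hR := hm.trans (le_abs_self R)
  have hR' := hm'.trans (le_abs_self R')
  have hR0 := abs_nonneg R
  have hR0' := abs_nonneg R'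
  rw [abs_le] at hR hR'
  have i1 : Integrable (fun x => (Ioi (c + L)).indicator (1 : ℝ → ℝ) x * (1 - a) ^ 2) G :=
    ((integrable_const (1 : ℝ)).indicator measurableSet_Ioi).mul_const _
  have i2 : Integrable (fun x => (Iio (c - L)).indicator (1 : ℝ → ℝ) x * (1 + a) ^ 2) G :=
    ((integrable_const (1 : ℝ)).indicator measurableSet_Iio).mul_const _
  have i3 : Integrable (fun x => (ψ ((x - m) / s) - J * (ρ ((x - m') / s) - b)) ^ 2) G := by
    have hc : Continuous fun x => (ψ ((x - m) / s) - J * (ρ ((x - m') / s) - b)) ^ 2 := by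
      have h1 := hψ.isFlat.continuous
      have h2 := hρ.isFlat.continuous
      fun_prop
    refine Integrable.of_bound hc.aestronglyMeasurable ((1 + |J| * (1 + |b|)) ^ 2)
      (ae_of_all _ fun x => ?_)
    rw [norm_pow]
    refine pow_le_pow_left₀ (norm_nonneg _) ((abs_sub _ _).trans ?_) 2
    rw [abs_mul]
    refine add_le_add (hψ.abs_le_one _) (mul_le_mul_of_nonneg_left ((abs_sub _ _).trans ?_)
      (abs_nonneg _))
    rw [abs_of_nonneg (hρ.nonneg _)]
    linarith [hρ.le_one ((x - m') / s)]
  have hmono : ∫ x, ((Ioi (c + L)).indicator (1 : ℝ → ℝ) x * (1 - a) ^ 2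
      + (Iio (c - L)).indicator (1 : ℝ → ℝ) x * (1 + a) ^ 2) ∂G
      ≤ ∫ x, (ψ ((x - m) / s) - J * (ρ ((x - m') / s) - b)) ^ 2 ∂G := by
    refine integral_mono (i1.add i2) i3 fun x => ?_
    by_cases h1 : x ∈ Ioi (c + L)
    · have h2 : x ∉ Iio (c - L) := by
        have := mem_Ioi.1 h1
        simp only [mem_Iio, not_lt]; linarith
      have h1' := mem_Ioi.1 h1
      have e1 : d ≤ (x - m) / s := by rw [le_div_iff₀ hs]; linarith
      have e2 : d' ≤ (x - m') / s := by rw [le_div_iff₀ hs]; linarith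
      simp only [indicator_of_mem h1, indicator_of_notMem h2, Pi.one_apply]
      rw [hd1 _ e1, hd' _ (e2.trans (le_abs_self _))]
      simp [ha]
    · by_cases h2 : x ∈ Iio (c - L)
      · have h2' := mem_Iio.1 h2
        have e1 : (x - m) / s ≤ -d := by rw [div_le_iff₀ hs]; linarith
        have e2 : (x - m') / s ≤ -d' := by rw [div_le_iff₀ hs]; linarith
        have e3 : d' ≤ |(x - m') / s| := by linarith [neg_le_abs ((x - m') / s)]
        simp only [indicator_of_notMem h1, indicator_of_mem h2, Pi.one_apply]
        rw [hd2 _ e1, hd' _ e3]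
        simp only [ha]
        exact le_of_eq (by ring)
      · simp only [indicator_of_notMem h1, indicator_of_notMem h2]
        simp only [zero_mul, add_zero]
        positivity
  refine le_trans ?_ hmono
  rw [integral_add i1 i2, integral_mul_const, integral_mul_const,
    integral_indicator_one measurableSet_Ioi, integral_indicator_one measurableSet_Iio]
  have h1 := mul_le_mul_of_nonneg_right (min_le_left (G.real (Ioi (c + L))) (G.real (Iio (c - L))))
    (sq_nonneg (1 - a))
  have h2 := mul_le_mul_of_nonneg_right (min_le_right (G.real (Ioi (c + L))) (G.real (Iio (c - L))))
    (sq_nonneg (1 + a))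
  have hp : 0 ≤ p := (lt_min hp1 hp2).le
  have h3 := mul_nonneg hp (sq_nonneg a)
  change p * (1 - a) ^ 2 ≤ _ at h1
  change p * (1 + a) ^ 2 ≤ _ at h2
  linarith

end MixtureConstants

/-- All contaminated laws are regular with common constants, and their location functionals are
unique. -/
lemma exists_isRegular_mixture {ψ ρ : ℝ → ℝ} (hψ : IsPsi ψ) (hρ : IsRho ρ) {b : ℝ} (hb : 0 < b)
    {ε : ℝ} (hε : 0 ≤ ε ∧ ε < 1 / 2) (G : Measure ℝ) [IsProbabilityMeasure G]
    [G.IsOpenPosMeasure] {c T σ₁ σ₂ κ₀ : ℝ} (hσ₁ : 0 < σ₁) (hκ₀ : 0 < κ₀)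
    (hscale : ∀ H, IsProbabilityMeasure H →
      σ₁ ≤ scale ρ b (mixture ε G H) ∧ scale ρ b (mixture ε G H) ≤ σ₂)
    (hsep : ∀ t, T ≤ |t - c| → ∀ s ∈ Icc σ₁ σ₂,
      ε / (1 - ε) < (∫ x, ρ ((x - t) / s) ∂G) - ∫ x, ρ ((x - c) / s) ∂G)
    (hconv : ∀ H, IsProbabilityMeasure H → ∀ t, |t - c| ≤ T → ∀ s ∈ Icc σ₁ σ₂,
      κ₀ ≤ ∫ x, deriv (deriv ρ) ((x - t) / s) ∂(mixture ε G H)) :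
    ∃ M κ, 0 < κ ∧ ∀ H, IsProbabilityMeasure H →
      IsRegular ψ ρ b c T M σ₁ σ₂ κ (mixture ε G H) ∧
      (∃! m, IsSLocation ρ b (mixture ε G H) m) ∧ ∃! m, IsMLocation ψ ρ b (mixture ε G H) m := by
  have hε1 : 0 < 1 - ε := by linarith
  obtain ⟨Kψ, hKψ⟩ := hψ.isFlat.exists_bound
  obtain ⟨Kρ, hKρ⟩ := hρ.isFlat.exists_bound
  have hbε : b < 1 - ε := lt_one_sub_of_scale_pos (G := G) (c := c) hρ hε
    (hσ₁.trans_le (hscale _ inferInstance).1)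
  have hσ₂ : 0 < σ₂ :=
    hσ₁.trans_le ((hscale (Measure.dirac c) inferInstance).1.trans (hscale _ inferInstance).2)
  -- the interval `[c - M, c + M]` has mass at least `b + κ₁` under every contaminated law
  obtain ⟨M, -, hM⟩ := exists_lt_measureReal_Icc G c (q := b / (1 - ε)) (by rwa [div_lt_one hε1])
  obtain ⟨κ₁, hκ₁, hMκ⟩ : ∃ κ₁, 0 < κ₁ ∧ b + κ₁ ≤ (1 - ε) * G.real (Icc (c - M) (c + M)) := by
    rw [div_lt_iff₀ hε1] at hM
    exact ⟨(1 - ε) * G.real (Icc (c - M) (c + M)) - b, by linarith, by linarith⟩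
  obtain ⟨κ₂, hκ₂, hsep'⟩ := exists_separation_mixture hρ hε hσ₁ hscale hsep hκ₁ hMκ
  obtain ⟨R, hR, hsign⟩ := exists_sign_mixture (G := G) hψ hε c hσ₂
  obtain ⟨η₁, hη₁, hdψ⟩ := exists_pos_le_integral (G := G) hψ.isFlat.continuous_deriv
    hKψ.bound_deriv hψ.deriv_nonneg hψ.exists_deriv_pos hσ₁ c R σ₂
  obtain ⟨η₂, hη₂, hdρ⟩ := exists_pos_le_integral (G := G) (k := fun z => deriv ρ z * z)
    (hρ.isFlat.continuous_deriv.mul continuous_id)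
    hKρ.bound_deriv_mul hρ.deriv_mul_nonneg hρ.exists_deriv_mul_pos hσ₁ c T σ₂
  obtain ⟨η₃, hη₃, hvar⟩ := exists_pos_le_integral_score_sq (G := G) hψ hρ b c R T hσ₂
  obtain ⟨κ, hκ, k0, k1, k2, k3, k4, k5⟩ : ∃ κ, 0 < κ ∧ κ ≤ κ₀ ∧ κ ≤ κ₁ ∧ κ ≤ κ₂ ∧
      κ ≤ (1 - ε) * η₁ ∧ κ ≤ (1 - ε) * η₂ ∧ κ ≤ (1 - ε) * η₃ := by
    refine ⟨min κ₀ (min κ₁ (min κ₂ (min ((1 - ε) * η₁) (min ((1 - ε) * η₂) ((1 - ε) * η₃))))),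
      by positivity, ?_, ?_, ?_, ?_, ?_, ?_⟩ <;> simp
  refine ⟨M, κ, hκ, fun H hH => ?_⟩
  have hF := isProbabilityMeasure_mixture hε.1 (by linarith) (G := G) (H := H)
  set F := mixture ε G H with hFdef
  have hs := hscale H hH
  have hs0 : 0 < scale ρ b F := hσ₁.trans_le hs.1
  have hconvF : ∀ t, |t - c| ≤ T → κ ≤ ∫ x, deriv (deriv ρ) ((x - t) / scale ρ b F) ∂F :=
    fun t ht => k0.trans (hconv H hH t ht _ hs)
  have hsepF : ∀ t, T ≤ |t - c| → b + κ ≤ ∫ x, ρ ((x - t) / scale ρ b F) ∂F :=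
    fun t ht => by linarith [hsep' H hH t ht]
  have hS := hρ.existsUnique_isSLocation hb hκ hs0 hconvF hsepF
  have hposψ : ∀ m, 0 < ∫ x, deriv ψ ((x - m) / scale ρ b F) ∂F := by
    intro m
    obtain ⟨z, hz⟩ := hψ.exists_deriv_pos
    have hi : ∀ Q : Measure ℝ, IsProbabilityMeasure Q →
        Integrable (fun x => deriv ψ ((x - m) / scale ρ b F)) Q := fun Q _ =>
      integrable_of_bounded hψ.isFlat.continuous_deriv hKψ.bound_deriv (by fun_prop)
    have h1 := integral_pos_of_isOpenPosMeasure (G := G) hψ.isFlat.continuous_deriv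
      hKψ.bound_deriv hψ.deriv_nonneg hz hs0 m
    exact (mul_pos hε1 h1).trans_le (le_integral_mixture hε.1 (by linarith) (hi G ‹_›) (hi H hH)
      (fun x => hψ.deriv_nonneg _) le_rfl)
  have hMloc := hψ.existsUnique_isMLocation (ρ := ρ) (b := b) (c := c) (R := R) hs0 hposψ
    (fun m => (hsign H hH _ hs0 hs.2 m).1) (fun m => (hsign H hH _ hs0 hs.2 m).2)
  refine ⟨?_, hS, hMloc⟩
  have hSspec : IsSLocation ρ b F (sLocation ρ b F) := Classical.epsilon_spec hS.exists
  have hMspec : IsMLocation ψ ρ b F (mLocation ψ ρ b F) := Classical.epsilon_spec hMloc.exists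
  have hSb := (hρ.isSLocation_iff hb hs0 _).1 hSspec
  have hST : |sLocation ρ b F - c| ≤ T := by
    by_contra! hlt
    linarith [hsepF _ hlt.le]
  have hMR : |mLocation ψ ρ b F - c| ≤ R := by
    have hsg := hsign H hH _ hs0 hs.2 (mLocation ψ ρ b F)
    have hz : ∫ x, ψ ((x - mLocation ψ ρ b F) / scale ρ b F) ∂F = 0 := hMspec
    rw [abs_le]
    constructor
    · by_contra! hlt
      exact absurd hz (hsg.2 (by linarith)).ne'
    · by_contra! hlt
      exact absurd hz (hsg.1 (by linarith)).ne
  have hbd : ∀ {k : ℝ → ℝ}, Measurable k → ∀ {K : ℝ}, (∀ x, |k x| ≤ K) → (∀ x, 0 ≤ k x) →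
      ∀ {a : ℝ}, a ≤ ∫ x, k x ∂G → (1 - ε) * a ≤ ∫ x, k x ∂F := by
    intro k hk K hK h0 a ha
    exact le_integral_mixture hε.1 (by linarith)
      (Integrable.of_bound hk.aestronglyMeasurable K (ae_of_all _ hK))
      (Integrable.of_bound hk.aestronglyMeasurable K (ae_of_all _ hK)) h0 ha
  have mS := measurable_sResidual ρ b F
  have mM := measurable_mResidual ψ ρ b F
  have hJ : κ ≤ denomJ ρ b F := k4.trans (hbd
    ((hρ.isFlat.continuous_deriv.measurable.comp mS).mul mS) (fun x => hKρ.bound_deriv_mul _)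
    (fun x => hρ.deriv_mul_nonneg _) (hdρ _ hST _ hs))
  refine ⟨hF, hs.1, hs.2, hST, hSb, hρ.integral_deriv_eq_zero hs0 hSb, hMspec, ?_, hJ, ?_, hconvF,
    hsepF, ?_⟩
  · exact k3.trans (hbd (hψ.isFlat.continuous_deriv.measurable.comp mM)
      (fun x => hKψ.bound_deriv _) (fun x => hψ.deriv_nonneg _) (hdψ _ hMR _ hs))
  · refine k5.trans (hbd (K := (1 + Kψ / κ) ^ 2) ((measurable_score hψ hρ b F).pow_const 2)
      (fun x => ?_) (fun x => sq_nonneg _) (hvar _ _ _ _ hMR hST hs0 hs.2))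
    rw [abs_pow]
    exact pow_le_pow_left₀ (abs_nonneg _) (abs_score_le hψ hρ
      ⟨hb, hbε.trans_le (by linarith)⟩ hKψ hκ hJ x) 2
  · have hind := hbd (k := (Icc (c - M) (c + M)).indicator 1)
      (measurable_one.indicator measurableSet_Icc) (K := 1) (fun x => by
        by_cases hx : x ∈ Icc (c - M) (c + M)
        · rw [indicator_of_mem hx]; simp
        · rw [indicator_of_notMem hx]; simp)
      (fun x => indicator_nonneg (fun _ _ => zero_le_one) x)
      (le_of_eq (integral_indicator_one measurableSet_Icc).symm)
    rw [integral_indicator_one measurableSet_Icc] at hind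
    linarith

/-! ### The central law and affine equivariance -/

/-- Unimodality bounds the density below, by a positive constant, on bounded sets away from the
mode. -/
lemma IsCentralDensity.isOpenPosMeasure {F₀ : Measure ℝ} {f : ℝ → ℝ}
    (hf : IsCentralDensity F₀ f) : F₀.IsOpenPosMeasure := by
  refine ⟨fun U hU hne h0 => ?_⟩
  obtain ⟨x, hx, hx0⟩ : ∃ x ∈ U, x ≠ 0 := by
    obtain ⟨x, hx⟩ := hne
    obtain ⟨r, hr, hball⟩ := Metric.isOpen_iff.1 hU x hx
    rcases eq_or_ne x 0 with rfl | h
    · refine ⟨r / 2, hball ?_, by positivity⟩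
      rw [Metric.mem_ball, dist_zero_right, Real.norm_eq_abs, abs_of_pos (by positivity)]
      linarith
    · exact ⟨x, hx, h⟩
  obtain ⟨r, hr, hball⟩ := Metric.isOpen_iff.1 hU x hx
  -- away from the mode the density is bounded below on bounded sets
  have hlow : ∀ y ∈ Metric.ball x (min r |x|), f (2 * |x|) ≤ f y := by
    intro y hy
    have hd := lt_of_lt_of_le (Metric.mem_ball.1 hy) (min_le_right _ _)
    rw [Real.dist_eq] at hd
    have hy0 : 0 < |y| := by
      refine abs_pos.2 ?_
      rintro rfl
      rw [zero_sub, abs_neg] at hd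
      exact lt_irrefl _ hd
    have hy2 : |y| ≤ 2 * |x| := by
      have := abs_sub_abs_le_abs_sub y x
      linarith
    have hfy : f y = f |y| := by
      rcases abs_cases y with ⟨h, _⟩ | ⟨h, _⟩
      · rw [h]
      · rw [h, hf.even]
    rw [hfy]
    exact hf.antitoneOn hy0 (hy0.trans_le hy2) hy2
  have hB0 : F₀ (Metric.ball x (min r |x|)) = 0 :=
    measure_mono_null ((Metric.ball_subset_ball (min_le_left _ _)).trans hball) h0
  have hxpos : 0 < |x| := abs_pos.2 hx0
  rw [hf.density, withDensity_apply _ measurableSet_ball] at hB0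
  have hge : ENNReal.ofReal (f (2 * |x|)) * volume (Metric.ball x (min r |x|)) ≤ 0 := by
    rw [← hB0, ← setLIntegral_const]
    exact setLIntegral_mono' measurableSet_ball fun y hy => ENNReal.ofReal_le_ofReal (hlow y hy)
  refine absurd (le_antisymm hge (zero_le)) (mul_ne_zero ?_ ?_)
  · exact (ENNReal.ofReal_pos.2 (hf.pos _)).ne'
  · exact (Metric.measure_ball_pos volume x (lt_min hr hxpos)).ne'

section Affine

variable {μ₀ σ₀ : ℝ}

lemma integral_map_affine {g : ℝ → ℝ} (hg : Continuous g) (hσ₀ : 0 < σ₀) (F : Measure ℝ)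
    (t s : ℝ) : ∫ x, g ((x - t) / s) ∂(F.map fun x => μ₀ + σ₀ * x)
      = ∫ x, g ((x - (t - μ₀) / σ₀) / (s / σ₀)) ∂F := by
  rw [integral_map (by fun_prop)
    (by fun_prop : Continuous fun x => g ((x - t) / s)).aestronglyMeasurable]
  congr 1 with x
  congr 1
  rcases eq_or_ne s 0 with rfl | hs
  · simp
  · field_simp; ring

lemma scaleAt_map_affine {ρ : ℝ → ℝ} (hρ : IsRho ρ) (b : ℝ) (hσ₀ : 0 < σ₀) (F : Measure ℝ)
    (t : ℝ) : scaleAt ρ b (F.map fun x => μ₀ + σ₀ * x) t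
      = σ₀ * scaleAt ρ b F ((t - μ₀) / σ₀) := by
  unfold scaleAt
  rw [← smul_eq_mul, ← Real.sInf_smul_of_nonneg hσ₀.le]
  congr 1
  ext s
  simp only [mem_ofPred_eq, integral_map_affine hρ.isFlat.continuous hσ₀, mem_smul_set, smul_eq_mul]
  constructor
  · rintro ⟨hs, h⟩
    exact ⟨s / σ₀, ⟨by positivity, h⟩, by field_simp⟩
  · rintro ⟨u, ⟨hu, h⟩, rfl⟩
    refine ⟨by positivity, ?_⟩
    rwa [mul_div_cancel_left₀ _ hσ₀.ne']

lemma scale_map_affine {ρ : ℝ → ℝ} (hρ : IsRho ρ) (b : ℝ) (hσ₀ : 0 < σ₀) (F : Measure ℝ) :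
    scale ρ b (F.map fun x => μ₀ + σ₀ * x) = σ₀ * scale ρ b F := by
  unfold scale
  simp only [scaleAt_map_affine hρ b hσ₀ F]
  rw [Real.mul_iInf_of_nonneg hσ₀.le]
  refine Function.Surjective.iInf_comp (f := fun t : ℝ => (t - μ₀) / σ₀) (fun u => ?_)
    (fun u => σ₀ * scaleAt ρ b F u)
  exact ⟨μ₀ + σ₀ * u, by field_simp; ring⟩

/-- Every contaminated law around the affine image of `F₀` is the affine image of a contaminated law
around `F₀`. -/
lemma mixture_map_affine (hσ₀ : 0 < σ₀) (ε : ℝ) (F₀ H : Measure ℝ) :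
    mixture ε (F₀.map fun x => μ₀ + σ₀ * x) H
      = (mixture ε F₀ (H.map fun x => (x - μ₀) / σ₀)).map fun x => μ₀ + σ₀ * x := by
  have hm : Measurable fun x : ℝ => μ₀ + σ₀ * x := by fun_prop
  unfold mixture
  rw [Measure.map_add _ _ hm, Measure.map_smul, Measure.map_smul, Measure.map_map hm (by fun_prop)]
  have : ((fun x : ℝ => μ₀ + σ₀ * x) ∘ fun x => (x - μ₀) / σ₀) = id := by
    funext x
    simp only [Function.comp_apply, id]
    field_simp; ring
  rw [this, Measure.map_id]

end Affine

end MMLocation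

end

/-! ### The theorem for contamination neighborhoods -/

open MMLocation

theorem theorem3
    (ψ ρ : ℝ → ℝ) (hψ : MMLocation.IsPsi ψ) (hρ : MMLocation.IsRho ρ)
    (b : ℝ) (hb : 0 < b ∧ b < 1)
    (F₀ : Measure ℝ) (hprob : IsProbabilityMeasure F₀)
    (f : ℝ → ℝ) (hf : MMLocation.IsCentralDensity F₀ f)
    (μ₀ σ₀ : ℝ) (hσ₀ : 0 < σ₀)
    (ε : ℝ) (hε : 0 ≤ ε ∧ ε < 1 / 2)
    (sMinus sPlus tStar : ℝ)
    (hs : MMLocation.ScaleBounds ρ b F₀ ε sMinus sPlus)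
    (hsep : MMLocation.Separation ρ F₀ ε sMinus sPlus tStar)
    (hconv : MMLocation.Convexity ρ F₀ ε sMinus sPlus tStar)
    (μhat : (n : ℕ) → (Fin n → ℝ) → ℝ) (hμhat : MMLocation.IsMMEstimate ψ ρ b μhat) :
    (∀ F ∈ MMLocation.nbhd F₀ ε μ₀ σ₀,
      (∃! m : ℝ, MMLocation.IsSLocation ρ b F m) ∧
      (∃! m : ℝ, MMLocation.IsMLocation ψ ρ b F m) ∧
      0 < MMLocation.denomH ψ ρ b F ∧ 0 < MMLocation.denomJ ρ b F ∧
      0 < MMLocation.asympVar ψ ρ b F) ∧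
    Tendsto
      (fun n : ℕ => ⨆ F : MMLocation.nbhd F₀ ε μ₀ σ₀, ⨆ x : ℝ,
        |(Measure.pi (fun _ : Fin n => (F : Measure ℝ))).real
            {X : Fin n → ℝ | √(n : ℝ) * (μhat n X - MMLocation.mLocation ψ ρ b (F : Measure ℝ)) /
              √(MMLocation.asympVar ψ ρ b (F : Measure ℝ)) < x}
          - cdf (gaussianReal 0 1) x|)
      atTop (𝓝 0) := by
  have hε1 : 0 < 1 - ε := by linarith
  obtain ⟨K, hK⟩ := hρ.isFlat.exists_bound
  have hopen := hf.isOpenPosMeasure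
  -- `G` is the central law of the neighborhood, with center `μ₀`
  set G : Measure ℝ := F₀.map fun x => μ₀ + σ₀ * x with hG
  have hGprob : IsProbabilityMeasure G := Measure.isProbabilityMeasure_map (by fun_prop)
  have hGopen : G.IsOpenPosMeasure :=
    (by fun_prop : Continuous fun x : ℝ => μ₀ + σ₀ * x).isOpenPosMeasure_map
      fun u => ⟨(u - μ₀) / σ₀, by field_simp; ring⟩
  have hnbhd : ∀ F ∈ nbhd F₀ ε μ₀ σ₀, ∃ H, IsProbabilityMeasure H ∧ F = mixture ε G H :=
    fun F hF => hF
  have hscale : ∀ H, IsProbabilityMeasure H → σ₀ * sMinus ≤ scale ρ b (mixture ε G H) ∧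
      scale ρ b (mixture ε G H) ≤ σ₀ * sPlus := by
    intro H hH
    have hmem : mixture ε F₀ (H.map fun x => (x - μ₀) / σ₀) ∈ nbhd F₀ ε 0 1 := by
      refine ⟨H.map fun x => (x - μ₀) / σ₀, Measure.isProbabilityMeasure_map (by fun_prop), ?_⟩
      have : (fun x : ℝ => 0 + 1 * x) = id := by funext x; simp
      rw [this, Measure.map_id]; rfl
    obtain ⟨h1, h2⟩ := hs.2 _ hmem
    rw [hG, mixture_map_affine hσ₀, scale_map_affine hρ b hσ₀]
    exact ⟨mul_le_mul_of_nonneg_left h1 hσ₀.le, mul_le_mul_of_nonneg_left h2 hσ₀.le⟩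
  have hdiv : ∀ s ∈ Icc (σ₀ * sMinus) (σ₀ * sPlus), s / σ₀ ∈ Icc sMinus sPlus := by
    intro s hs
    exact ⟨by rw [le_div_iff₀ hσ₀]; linarith [hs.1], by rw [div_le_iff₀ hσ₀]; linarith [hs.2]⟩
  have habs : ∀ t, |(t - μ₀) / σ₀| = |t - μ₀| / σ₀ := fun t => by rw [abs_div, abs_of_pos hσ₀]
  have hsepG : ∀ t, σ₀ * tStar ≤ |t - μ₀| → ∀ s ∈ Icc (σ₀ * sMinus) (σ₀ * sPlus),
      ε / (1 - ε) < (∫ x, ρ ((x - t) / s) ∂G) - ∫ x, ρ ((x - μ₀) / s) ∂G := by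
    intro t ht s hs'
    rw [hG, integral_map_affine hρ.isFlat.continuous hσ₀,
      integral_map_affine hρ.isFlat.continuous hσ₀, sub_self, zero_div]
    simp only [sub_zero]
    refine (hsep ((t - μ₀) / σ₀) (by rw [habs, le_div_iff₀ hσ₀]; linarith)).trans_le
      (ciInf_le ⟨-1, ?_⟩ (⟨s / σ₀, hdiv s hs'⟩ : Icc sMinus sPlus))
    -- the family is bounded below by `-1`, so its infimum is not a junk value
    rintro _ ⟨u, rfl⟩
    have h1 : 0 ≤ ∫ x, ρ ((x - (t - μ₀) / σ₀) / (u : ℝ)) ∂F₀ := integral_nonneg fun x => hρ.nonneg _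
    have h2 : ∫ x, ρ (x / (u : ℝ)) ∂F₀ ≤ 1 := (le_abs_self _).trans (abs_integral_le fun x => by
      rw [abs_of_nonneg (hρ.nonneg _)]; exact hρ.le_one _)
    linarith
  obtain ⟨κ₀, hκ₀, hconvG⟩ : ∃ κ₀, 0 < κ₀ ∧ ∀ H, IsProbabilityMeasure H → ∀ t,
      |t - μ₀| ≤ σ₀ * tStar → ∀ s ∈ Icc (σ₀ * sMinus) (σ₀ * sPlus),
      κ₀ ≤ ∫ x, deriv (deriv ρ) ((x - t) / s) ∂(mixture ε G H) := by
    -- the contamination lowers the second derivative of the objective by at most `ε S`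
    unfold Convexity at hconv
    set S := ⨆ x : ℝ, max (-deriv (deriv ρ) x) 0 with hS
    set I := ⨅ p : Icc (-tStar) tStar × Icc sMinus sPlus,
      ∫ x, deriv (deriv ρ) ((x - (p.1 : ℝ)) / (p.2 : ℝ)) ∂F₀ with hI
    have hSle : ∀ z, -S ≤ deriv (deriv ρ) z := by
      intro z
      have := le_ciSup (f := fun x : ℝ => max (-deriv (deriv ρ) x) 0) ⟨K, by
        rintro _ ⟨y, rfl⟩
        exact max_le (by linarith [(abs_le.1 (hK.bound_deriv2 y)).1]) hK.pos.le⟩ z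
      have h2 := le_max_left (-deriv (deriv ρ) z) 0
      linarith
    refine ⟨(1 - ε) * I - ε * S, ?_, fun H hH t ht s hs' => ?_⟩
    · have h := mul_lt_mul_of_pos_left hconv hε1
      have e : (1 - ε) * (ε / (1 - ε) * S) = ε * S := by field_simp
      linarith
    · have hi : ∀ Q : Measure ℝ, IsProbabilityMeasure Q →
          Integrable (fun x => deriv (deriv ρ) ((x - t) / s)) Q := fun Q _ =>
        integrable_of_bounded hρ.isFlat.continuous_deriv2 hK.bound_deriv2 (by fun_prop)
      rw [integral_mixture hε.1 (by linarith) (hi G hGprob) (hi H hH)]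
      have h1 : I ≤ ∫ x, deriv (deriv ρ) ((x - t) / s) ∂G := by
        rw [hG, integral_map_affine hρ.isFlat.continuous_deriv2 hσ₀]
        have hmem : (t - μ₀) / σ₀ ∈ Icc (-tStar) tStar :=
          abs_le.1 (by rw [habs, div_le_iff₀ hσ₀]; linarith)
        refine ciInf_le (f := fun p : Icc (-tStar) tStar × Icc sMinus sPlus =>
          ∫ x, deriv (deriv ρ) ((x - (p.1 : ℝ)) / (p.2 : ℝ)) ∂F₀) ⟨-K, ?_⟩
          (⟨_, hmem⟩, ⟨_, hdiv s hs'⟩)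
        rintro _ ⟨p, rfl⟩
        exact (abs_le.1 (abs_integral_le fun x => hK.bound_deriv2 _)).1
      have h2 : -S ≤ ∫ x, deriv (deriv ρ) ((x - t) / s) ∂H := by
        have := integral_mono (integrable_const (-S)) (hi H hH) fun x => hSle _
        simpa using this
      have h3 := mul_le_mul_of_nonneg_left h1 hε1.le
      have h4 := mul_le_mul_of_nonneg_left h2 hε.1
      linarith
  have hσ₁ : 0 < σ₀ * sMinus := mul_pos hσ₀ hs.1
  obtain ⟨M, κ, hκ, hreg⟩ := exists_isRegular_mixture hψ hρ hb.1 hε G hσ₁ hκ₀ hscale hsepG hconvG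
  have hregF : ∀ F ∈ nbhd F₀ ε μ₀ σ₀,
      IsRegular ψ ρ b μ₀ (σ₀ * tStar) M (σ₀ * sMinus) (σ₀ * sPlus) κ F := by
    intro F hF
    obtain ⟨H, hH, rfl⟩ := hnbhd F hF
    exact (hreg H hH).1
  refine ⟨fun F hF => ?_, tendsto_iSup_iSup_cdf hψ hρ hb hκ hσ₁ hμhat hregF⟩
  obtain ⟨H, hH, rfl⟩ := hnbhd F hF
  obtain ⟨hR, hS, hM⟩ := hreg H hH
  have hp : 0 < denomH ψ ρ b (mixture ε G H) := hκ.trans_le hR.le_denomH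
  refine ⟨hS, hM, hp, hκ.trans_le hR.le_denomJ, Real.sqrt_pos.1 ?_⟩
  have hsc : 0 < scale ρ b (mixture ε G H) := hσ₁.trans_le hR.le_scale
  rw [sqrt_asympVar hsc hp]
  exact mul_pos (div_pos hsc hp) (Real.sqrt_pos.2 (hκ.trans_le hR.le_integral_score_sq))
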